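/- Let $\mathbb K$ be a field of characteristic $0$. For a word $w$ over the ordered alphabet of positive integers with distinct letters $b_1<\dots<b_r$, let $\mathrm{pack}(w)$ be the word obtained by replacing each $b_i$ by $i$; $w$ is *packed* if $\mathrm{pack}(w)=w$. Let $\mathbf{WQSym}$ be the vector space with basis $\mathbf M_u$, $u$ packed (realized by the noncommutative series $\mathbf M_u=\sum_{\mathrm{pack}(w)=u}w$), with unit $1=\mathbf M_\emptyset$, counit $\varepsilon(\mathbf M_u)=\delta_{u,\emptyset}$, product and coproduct $$\mathbf M_{u'}\mathbf M_{u''}=\sum_{\substack{u=vw\text{ packed}\\ \mathrm{pack}(v)=u',\ \mathrm{pack}(w)=u''}}\mathbf M_u,\qquad \Delta \mathbf M_u=\sum_{0\le k\le \max u}\mathbf M_{u|_{[1,k]}}\otimes \mathbf M_{\mathrm{pack}(u|_{[k+1,\max u]})}.$$ On the augmentation ideal $\mathbf{WQSym}^+=\ker\varepsilon$ let $\prec$, $\circ$, $\succ$ be the parts of the product given by the terms $u=vw$ with $\max v>\max w$, $\max v=\max w$, $\max v<\max w$ respectively, put ${\ll}={\prec}$ and ${\gg}={\circ}+{\succ}$,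 and let $\Delta_\ll \mathbf M_u$ (resp. $\Delta_\gg \mathbf M_u$) be the sum of the terms of $\Delta \mathbf M_u$ with $1\le k<\max u$ for which the last letter of $u$ is $\le k$ (resp. $>k$). A *dendriform trialgebra* is a vector space with bilinear operations $\prec,\circ,\succ$ such that, with $\odot={\prec}+{\circ}+{\succ}$: $\circ$ is associative, $(x\prec y)\prec z=x\prec(y\odot z)$, $(x\succ y)\prec z=x\succ(y\prec z)$, $(x\odot y)\succ z=x\succ(y\succ z)$, $(x\succ y)\circ z=x\succ(y\circ z)$, $(x\prec y)\circ z=x\circ(y\succ z)$, $(x\circ y)\prec z=x\circ(y\prec z)$. A *bidendriform bialgebra* (Foissy) is a vector space with operations $\ll,\gg$ and half-coproducts $\Delta_\ll,\Delta_\gg$ satisfying, with product $xy=x\ll y+x\gg y$ and $\bar\Delta=\Delta_\ll+\Delta_\gg$ (Sweedler notation $\bar\Delta x=x'\otimes x''$, $\Delta_\ll x=x'_\ll\otimes x''_\ll$, $\Delta_\gg x=x'_\gg\otimes x''_\gg$): the dendriform relations $(a\ll b)\ll c=a\ll(bc)$, $(a\gg b)\ll c=a\gg(b\ll c)$, $(ab)\gg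 c=a\gg(b\gg c)$; the codendriform relations $(\Delta_\ll\otimes \mathrm{Id})\Delta_\ll=(\mathrm{Id}\otimes\bar\Delta)\Delta_\ll$, $(\Delta_\gg\otimes \mathrm{Id})\Delta_\ll=(\mathrm{Id}\otimes\Delta_\ll)\Delta_\gg$, $(\bar\Delta\otimes \mathrm{Id})\Delta_\gg=(\mathrm{Id}\otimes\Delta_\gg)\Delta_\gg$; and $$\begin{aligned}\Delta_\gg(a\gg b)&=a'b'_\gg\otimes a''\gg b''_\gg+a'\otimes a''\gg b+b'_\gg\otimes a\gg b''_\gg+ab'_\gg\otimes b''_\gg+a\otimes b,\\ \Delta_\gg(a\ll b)&=a'b'_\gg\otimes a''\ll b''_\gg+a'\otimes a''\ll b+b'_\gg\otimes a\ll b''_\gg,\\ \Delta_\ll(a\gg b)&=a'b'_\ll\otimes a''\gg b''_\ll+ab'_\ll\otimes b''_\ll+b'_\ll\otimes a\gg b''_\ll,\\ \Delta_\ll(a\ll b)&=a'b'_\ll\otimes a''\ll b''_\ll+a'b\otimes a''+b'_\ll\otimes a\ll b''_\ll+b\otimes a.\end{aligned}$$ Let $\mathfrak{TD}\subset\mathbf{WQSym}$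 be the span of $1$ and of the sub-trialgebra of $\mathbf{WQSym}^+$ generated by $\mathbf M_1$. The *sylvester congruence* is the equivalence relation on words generated by $x\,ac\,y\,b\,z\equiv x\,ca\,y\,b\,z$ for words $x,y,z$ and letters $a\le b<c$, and the *sylvester quotient* of $\mathbf{WQSym}$ is its quotient by the span of all $\mathbf M_u-\mathbf M_v$ with $u\equiv v$ packed. **Theorem.** All the operations above (product, unit, coproduct, counit; $\prec,\circ,\succ$; $\Delta_\ll,\Delta_\gg$) pass to the sylvester quotient $\mathcal S$. With them $\mathcal S$ is a Hopf algebra, and its augmentation ideal is a dendriform trialgebra and a bidendriform bialgebra, whose operations split the product and the reduced coproduct of $\mathcal S$. The subspace $\mathfrak{TD}$ is stable under all these operations, and with them it is a Hopf algebra whose augmentation ideal is a dendriform trialgebra and a bidendriform bialgebra, in the same sense. There is a linear isomorphism $\mathcal S\cong\mathfrak{TD}$ that is at once an isomorphism of Hopf algebras, of dendriform trialgebras and of bidendriform bialgebras. -/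

import Mathlib

open scoped TensorProduct

noncomputable section

universe u v w

/-! ### Words and packed words -/

/-- The rank of `a` among the distinct letters of `w`: the number of distinct letters `≤ a`. -/
def letterRank (w : List ℕ) (a : ℕ) : ℕ := (w.toFinset.filter (fun b => b ≤ a)).card

/-- If `b₁ < ⋯ < b_r` are the letters occurring in `w`, then `pack w` is the image of `w`
under `b_i ↦ i`. -/
def pack (w : List ℕ) : List ℕ := w.map (letterRank w)

/-- The largest letter of a word (`0` for the empty word). -/
def maxLetter (w : List ℕ) : ℕ := w.toFinset.sup id

theorem letterRank_lt {w : List ℕ} {a b : ℕ} (hb : b ∈ w) (hab : a < b) :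
    letterRank w a < letterRank w b := by
  apply Finset.card_lt_card
  rw [Finset.ssubset_iff_of_subset]
  · exact ⟨b, by simp [hb], by simp [hab]⟩
  · intro c hc
    simp only [Finset.mem_filter] at hc ⊢
    exact ⟨hc.1, by omega⟩

theorem letterRank_strictMonoOn (w : List ℕ) : StrictMonoOn (letterRank w) {a | a ∈ w} :=
  fun _ _ _ hb hab => letterRank_lt hb hab

/-- Packing is invariant under strictly increasing relabelling of the letters. -/
theorem pack_map (w : List ℕ) (f : ℕ → ℕ) (hf : StrictMonoOn f {a | a ∈ w}) :
    pack (w.map f) = pack w := by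
  unfold pack
  rw [List.map_map]
  apply List.map_congr_left
  intro a ha
  simp only [Function.comp, letterRank]
  symm
  apply Finset.card_bij (fun b _ => f b)
  · intro b hb
    simp only [Finset.mem_filter, List.mem_toFinset, List.mem_map] at hb ⊢
    exact ⟨⟨b, hb.1, rfl⟩, (hf.le_iff_le hb.1 ha).2 hb.2⟩
  · intro b hb c hc h
    simp only [Finset.mem_filter, List.mem_toFinset] at hb hc
    exact hf.injOn hb.1 hc.1 h
  · intro c hc
    simp only [Finset.mem_filter, List.mem_toFinset, List.mem_map] at hc
    obtain ⟨⟨b, hb, rfl⟩, h⟩ := hc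
    exact ⟨b, by simp [hb, (hf.le_iff_le hb ha).1 h], rfl⟩

theorem pack_pack (w : List ℕ) : pack (pack w) = pack w :=
  pack_map w _ (letterRank_strictMonoOn w)

/-- The set of packed words: the words `w` with `pack w = w`. -/
def PackedWord : Type := {w : List ℕ // pack w = w}

instance : DecidableEq PackedWord := inferInstanceAs (DecidableEq {w : List ℕ // pack w = w})

/-- The packed word of a word. -/
def toPacked (w : List ℕ) : PackedWord := ⟨pack w, pack_pack w⟩

/-- All packed words of length `n`. -/
def packedWords (n : ℕ) : Finset PackedWord :=
  (Finset.univ : Finset (Fin n → Fin (n + 1))).image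
    (fun f => toPacked (List.ofFn (fun i => (f i : ℕ))))

theorem toPacked_val (w : List ℕ) : (toPacked w).1 = pack w := rfl

theorem length_pack (w : List ℕ) : (pack w).length = w.length := by simp [pack]

theorem mem_packedWords (n : ℕ) (p : PackedWord) : p ∈ packedWords n ↔ p.1.length = n := by
  constructor
  · intro h
    simp only [packedWords, Finset.mem_image] at h
    obtain ⟨f, -, rfl⟩ := h
    simp [toPacked, length_pack]
  · rintro rfl
    have hle : ∀ i (hi : i < p.1.length), p.1[i] < p.1.length + 1 := by
      intro i hi
      have h : p.1[i] = (pack p.1)[i]'(by rw [p.2]; exact hi) := by simp only [p.2]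
      rw [h]
      simp only [pack, List.getElem_map, letterRank]
      exact Nat.lt_succ_of_le
        ((Finset.card_le_card (Finset.filter_subset _ _)).trans (List.toFinset_card_le _))
    simp only [packedWords, Finset.mem_image]
    refine ⟨fun i => ⟨p.1[i.1], hle _ i.2⟩, Finset.mem_univ _, ?_⟩
    apply Subtype.ext
    simp only [toPacked, List.ofFn_getElem]
    exact p.2

open scoped Classical in
/-- The packed words `p = v · w` with `pack v = u'`, `pack w = u''`, for which the pair
`(max v, max w)` satisfies the condition `c`. -/
def convolution (c : ℕ → ℕ → Prop) (u' u'' : PackedWord) : Finset PackedWord :=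
  (packedWords (u'.1.length + u''.1.length)).filter fun p =>
    pack (p.1.take u'.1.length) = u'.1 ∧ pack (p.1.drop u'.1.length) = u''.1 ∧
      c (maxLetter (p.1.take u'.1.length)) (maxLetter (p.1.drop u'.1.length))

/-! ### Dendriform trialgebras, bidendriform bialgebras, Hopf algebras -/

section Laws

variable {K : Type u} [Field K] {V : Type v} [AddCommGroup V] [Module K V]

/-- `l`, `m`, `r` are the operations `≺`, `∘`, `≻` of a dendriform trialgebra, whose
multiplication is `⊙ = ≺ + ∘ + ≻`. -/
structure IsDendriformTrialgebra (l m r : V →ₗ[K] V →ₗ[K] V) : Prop where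
  mid_assoc : ∀ x y z, m (m x y) z = m x (m y z)
  left_left : ∀ x y z, l (l x y) z = l x ((l + m + r) y z)
  right_left : ∀ x y z, l (r x y) z = r x (l y z)
  mul_right : ∀ x y z, r ((l + m + r) x y) z = r x (r y z)
  right_mid : ∀ x y z, m (r x y) z = r x (m y z)
  left_mid : ∀ x y z, m (l x y) z = m x (r y z)
  mid_left : ∀ x y z, l (m x y) z = m x (l y z)

/-- `l`, `r` are the operations `≪`, `≫` of a dendriform dialgebra, whose multiplication is
`≪ + ≫`. -/
structure IsDendriformDialgebra (l r : V →ₗ[K] V →ₗ[K] V) : Prop where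
  left_left : ∀ x y z, l (l x y) z = l x ((l + r) y z)
  right_left : ∀ x y z, l (r x y) z = r x (l y z)
  mul_right : ∀ x y z, r ((l + r) x y) z = r x (r y z)

/-- `dl`, `dr` are the half-coproducts of a codendriform coalgebra, whose reduced coproduct is
`dl + dr`. -/
structure IsCodendriformCoalgebra (dl dr : V →ₗ[K] V ⊗[K] V) : Prop where
  left_left : ∀ c, TensorProduct.assoc K V V V (dl.rTensor V (dl c)) = (dl + dr).lTensor V (dl c)
  right_left : ∀ c, TensorProduct.assoc K V V V (dr.rTensor V (dl c)) = dl.lTensor V (dr c)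
  mul_right : ∀ c, TensorProduct.assoc K V V V ((dl + dr).rTensor V (dr c)) = dr.lTensor V (dr c)

/-- The laws of a bidendriform bialgebra. Here `TensorProduct.map₂ f g (a' ⊗ a'') (b' ⊗ b'')` is
`f a' b' ⊗ g a'' b''`; the product is `l + r` and the reduced coproduct is `dl + dr`. -/
structure IsBidendriformBialgebra (l r : V →ₗ[K] V →ₗ[K] V) (dl dr : V →ₗ[K] V ⊗[K] V) :
    Prop where
  dendriform : IsDendriformDialgebra l r
  codendriform : IsCodendriformCoalgebra dl dr
  coright_right : ∀ a b, dr (r a b) =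
    TensorProduct.map₂ (l + r) r ((dl + dr) a) (dr b) + (r.flip b).lTensor V ((dl + dr) a)
      + (r a).lTensor V (dr b) + ((l + r) a).rTensor V (dr b) + a ⊗ₜ[K] b
  coright_left : ∀ a b, dr (l a b) =
    TensorProduct.map₂ (l + r) l ((dl + dr) a) (dr b) + (l.flip b).lTensor V ((dl + dr) a)
      + (l a).lTensor V (dr b)
  coleft_right : ∀ a b, dl (r a b) =
    TensorProduct.map₂ (l + r) r ((dl + dr) a) (dl b) + ((l + r) a).rTensor V (dl b)
      + (r a).lTensor V (dl b)
  coleft_left : ∀ a b, dl (l a b) =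
    TensorProduct.map₂ (l + r) l ((dl + dr) a) (dl b) + ((l + r).flip b).rTensor V ((dl + dr) a)
      + (l a).lTensor V (dl b) + b ⊗ₜ[K] a

/-- The product `mul`, unit `one`, coproduct `comul` and counit `counit` make `V` a Hopf algebra:
some linear isomorphism carries them to those of a Hopf algebra. -/
def IsHopfAlgebra (mul : V →ₗ[K] V →ₗ[K] V) (one : V) (comul : V →ₗ[K] V ⊗[K] V)
    (counit : V →ₗ[K] K) : Prop :=
  ∃ (A : Type v) (_ : Ring A) (_ : HopfAlgebra K A) (e : V ≃ₗ[K] A),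
    (∀ x y, e (mul x y) = e x * e y) ∧ e one = 1 ∧
    (∀ x, TensorProduct.map e.toLinearMap e.toLinearMap (comul x) = Coalgebra.comul (R := K) (e x))
    ∧ ∀ x, Coalgebra.counit (R := K) (e x) = counit x

end Laws

/-- Operations on a vector space `H`: product, unit, coproduct, counit, and, on the augmentation
ideal `ker counit`, three partial products `≺`, `∘`, `≻` and two half-coproducts. The laws are
imposed separately, in `TriOps.IsTridendriform`, `TriOps.IsBidendriform` and `TriOps.IsHopf`. -/
structure TriOps (K : Type u) [Field K] (H : Type v) [AddCommGroup H] [Module K H] where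
  mul : H →ₗ[K] H →ₗ[K] H
  one : H
  comul : H →ₗ[K] H ⊗[K] H
  counit : H →ₗ[K] K
  left : LinearMap.ker counit →ₗ[K] LinearMap.ker counit →ₗ[K] LinearMap.ker counit
  mid : LinearMap.ker counit →ₗ[K] LinearMap.ker counit →ₗ[K] LinearMap.ker counit
  right : LinearMap.ker counit →ₗ[K] LinearMap.ker counit →ₗ[K] LinearMap.ker counit
  coleft : LinearMap.ker counit →ₗ[K] LinearMap.ker counit ⊗[K] LinearMap.ker counit
  coright : LinearMap.ker counit →ₗ[K] LinearMap.ker counit ⊗[K] LinearMap.ker counit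

namespace TriOps

variable {K : Type u} [Field K]
variable {H : Type v} [AddCommGroup H] [Module K H]
variable {H' : Type w} [AddCommGroup H'] [Module K H']

/-- The augmentation ideal. -/
abbrev plus (D : TriOps K H) : Submodule K H := LinearMap.ker D.counit

/-- The augmentation ideal is a dendriform trialgebra, with `⊙` the product of `H`. -/
structure IsTridendriform (D : TriOps K H) : Prop where
  laws : IsDendriformTrialgebra D.left D.mid D.right
  mul_eq : ∀ x y : D.plus, D.mul x y = (D.left x y : H) + D.mid x y + D.right x y

/-- The augmentation ideal is a bidendriform bialgebra for `≪ = ≺`, `≫ = ∘ + ≻` and the two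
half-coproducts, which split the product and the reduced coproduct of `H`. -/
structure IsBidendriform (D : TriOps K H) : Prop where
  laws : IsBidendriformBialgebra D.left (D.mid + D.right) D.coleft D.coright
  mul_eq : ∀ x y : D.plus, D.mul x y = (D.left x y : H) + (D.mid + D.right) x y
  comul_eq : ∀ x : D.plus, D.comul x =
    TensorProduct.map D.plus.subtype D.plus.subtype (D.coleft x + D.coright x)
      + (x : H) ⊗ₜ[K] D.one + D.one ⊗ₜ[K] (x : H)

/-- `H` is a Hopf algebra. -/
def IsHopf (D : TriOps K H) : Prop := IsHopfAlgebra D.mul D.one D.comul D.counit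

/-- The map of augmentation ideals induced by a linear map that preserves the counit. -/
def plusMap (D : TriOps K H) (D' : TriOps K H') (f : H →ₗ[K] H')
    (hf : ∀ x, D'.counit (f x) = D.counit x) : D.plus →ₗ[K] D'.plus :=
  f.restrict (fun x hx => by
    rw [LinearMap.mem_ker] at hx ⊢
    rw [hf, hx])

/-- `f` respects all operations: the first four fields say that it is a morphism of Hopf algebras,
the next three that it induces a morphism of dendriform trialgebras, and these (in particular
for `≪ = ≺`, `≫ = ∘ + ≻`) together with the last two that it induces a morphism of
bidendriform bialgebras. -/
structure IsHom (D : TriOps K H) (D' : TriOps K H') (f : H →ₗ[K] H') : Prop where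
  map_mul : ∀ x y, f (D.mul x y) = D'.mul (f x) (f y)
  map_one : f D.one = D'.one
  map_comul : ∀ x, TensorProduct.map f f (D.comul x) = D'.comul (f x)
  map_counit : ∀ x, D'.counit (f x) = D.counit x
  map_left : ∀ x y, plusMap D D' f map_counit (D.left x y) =
    D'.left (plusMap D D' f map_counit x) (plusMap D D' f map_counit y)
  map_mid : ∀ x y, plusMap D D' f map_counit (D.mid x y) =
    D'.mid (plusMap D D' f map_counit x) (plusMap D D' f map_counit y)
  map_right : ∀ x y, plusMap D D' f map_counit (D.right x y) =
    D'.right (plusMap D D' f map_counit x) (plusMap D D' f map_counit y)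
  map_coleft : ∀ x,
    TensorProduct.map (plusMap D D' f map_counit) (plusMap D D' f map_counit) (D.coleft x) =
      D'.coleft (plusMap D D' f map_counit x)
  map_coright : ∀ x,
    TensorProduct.map (plusMap D D' f map_counit) (plusMap D D' f map_counit) (D.coright x) =
      D'.coright (plusMap D D' f map_counit x)

/-- The sub-trialgebra of the augmentation ideal generated by `x`. -/
def generatedSubtrialgebra (D : TriOps K H) (x : D.plus) : Submodule K D.plus :=
  sInf {P | x ∈ P ∧ ∀ y ∈ P, ∀ z ∈ P, D.left y z ∈ P ∧ D.mid y z ∈ P ∧ D.right y z ∈ P}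

end TriOps

/-! ### The Hopf algebra `WQSym` -/

/-- The vector space with basis the elements `M u`, `u` a packed word. -/
abbrev WQSym (K : Type u) [Field K] : Type u := PackedWord →₀ K

namespace WQSym

variable (K : Type u) [Field K]

/-- The basis element `M_u`. -/
def M (u : PackedWord) : WQSym K := Finsupp.single u 1

/-- The linear map with prescribed values on the basis `M`. -/
def lift {V : Type v} [AddCommMonoid V] [Module K V] (f : PackedWord → V) : WQSym K →ₗ[K] V :=
  Finsupp.linearCombination K f

theorem lift_M {V : Type v} [AddCommMonoid V] [Module K V] (f : PackedWord → V) (u : PackedWord) :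
    lift K f (M K u) = f u := by
  simp [lift, M, Finsupp.linearCombination_single]

/-- The bilinear map with `(M_{u'}, M_{u''}) ↦ ∑ M_p`, the sum over the `p` in the convolution of
`u'` and `u''`, subject to the condition `c` on the maxima of the two factors of `p`. -/
def convProd (c : ℕ → ℕ → Prop) : WQSym K →ₗ[K] WQSym K →ₗ[K] WQSym K :=
  lift K fun u' => lift K fun u'' => ∑ p ∈ convolution c u' u'', M K p

/-- The counit: `M_u ↦ 1` if `u` is empty, and `M_u ↦ 0` otherwise. -/
def counit : WQSym K →ₗ[K] K := lift K fun u => if u.1 = [] then 1 else 0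

/-- The augmentation ideal, spanned by the `M_u` with `u` nonempty. -/
abbrev plus : Submodule K (WQSym K) := LinearMap.ker (counit K)

/-- The projection to the augmentation ideal along the unit: it fixes `M_u` for `u` nonempty and
kills the unit `M_∅`. -/
def proj : WQSym K →ₗ[K] plus K :=
  (LinearMap.id - (counit K).smulRight (M K (toPacked []))).codRestrict (plus K) (fun x => by
    have h : counit K (M K (toPacked [])) = 1 := by
      rw [counit, lift_M]
      rfl
    simp [h])

/-- The partial product on the augmentation ideal that corresponds to the condition `c`. -/
def partialProd (c : ℕ → ℕ → Prop) : plus K →ₗ[K] plus K →ₗ[K] plus K :=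
  ((convProd K c).compr₂ (proj K)).domRestrict₁₂ (plus K) (plus K)

/-- The part of `w` of letters in `[1, k]`. -/
def lower (w : PackedWord) (k : ℕ) : PackedWord := toPacked (w.1.filter (fun a => a ≤ k))

/-- The packed word of the part of `w` of letters in `[k + 1, max w]`. -/
def upper (w : PackedWord) (k : ℕ) : PackedWord := toPacked (w.1.filter (fun a => k < a))

/-- `Δ M_w = ∑_{0 ≤ k ≤ max w} M_{w|[1,k]} ⊗ M_{pack (w|[k+1,max w])}`. -/
def comul : WQSym K →ₗ[K] WQSym K ⊗[K] WQSym K :=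
  lift K fun w => ∑ k ∈ Finset.range (maxLetter w.1 + 1), M K (lower w k) ⊗ₜ[K] M K (upper w k)

/-- The half-coproducts: the terms `M_u ⊗ M_v` of `Δ M_w` with `u`, `v` nonempty for which the last
letter `a` of `w` and `k = max u` satisfy the condition `c a k`. -/
def halfComul (c : ℕ → ℕ → Prop) [DecidableRel c] : plus K →ₗ[K] plus K ⊗[K] plus K :=
  (lift K fun w => ∑ k ∈ (Finset.range (maxLetter w.1 + 1)).filter (fun k => c (w.1.getLastD 0) k),
    proj K (M K (lower w k)) ⊗ₜ[K] proj K (M K (upper w k))).domRestrict (plus K)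

/-- The operations of `WQSym`. In `left`, `mid`, `right` the numbers `a`, `b` are the maxima
of the first and the second factor; in `coleft`, `coright`, `a` is the last letter of `w` and
`k` the maximum of `u`, for the term `M_u ⊗ M_v` of `Δ M_w`. -/
def ops : TriOps K (WQSym K) where
  mul := convProd K (fun _ _ => True)
  one := M K (toPacked [])
  comul := comul K
  counit := counit K
  left := partialProd K (fun a b => b < a)
  mid := partialProd K (fun a b => b = a)
  right := partialProd K (fun a b => a < b)
  coleft := halfComul K (fun a k => a ≤ k)
  coright := halfComul K (fun a k => k < a)

end WQSym

/-! ### The realization of `WQSym` by noncommutative series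

A noncommutative formal series over the ordered alphabet `ℕ` is given by its coefficients. -/

/-- The coefficients of `∑_{pack w = u} w`, extended linearly. -/
def realize (K : Type u) [Field K] : WQSym K →ₗ[K] (List ℕ → K) :=
  WQSym.lift K fun u w => if pack w = u.1 then 1 else 0

open scoped Classical in
/-- The concatenation product of two series, restricted to the products `v · w` of words with
`c (max v) (max w)`. -/
def concatProd {K : Type u} [Field K] (c : ℕ → ℕ → Prop) (f g : List ℕ → K) : List ℕ → K := fun w =>
  ∑ n ∈ Finset.range (w.length + 1),
    if c (maxLetter (w.take n)) (maxLetter (w.drop n)) then f (w.take n) * g (w.drop n) else 0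

namespace WQSym

variable (K : Type u) [Field K]

theorem realize_apply (x : WQSym K) (w : List ℕ) : realize K x w = x (toPacked w) := by
  induction x using Finsupp.induction_linear with
  | zero => simp
  | add x y hx hy => simp [hx, hy]
  | single u k =>
    have h : (Finsupp.single u k : WQSym K) = k • M K u := by simp [M]
    rw [h, map_smul, realize, lift_M]
    have h2 : (pack w = u.1) ↔ u = toPacked w :=
      ⟨fun h => Subtype.ext h.symm, fun h => by rw [h]; rfl⟩
    simp only [Pi.smul_apply, h2, M, Finsupp.smul_apply, Finsupp.single_apply]

theorem realize_injective : Function.Injective (realize K) := by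
  intro x y h
  ext u
  have h2 := congrFun h u.1
  rw [realize_apply, realize_apply] at h2
  have h3 : toPacked u.1 = u := Subtype.ext u.2
  rwa [h3] at h2

theorem maxLetter_map {w : List ℕ} (hw : w ≠ []) (f : ℕ → ℕ) (hf : StrictMonoOn f {a | a ∈ w}) :
    maxLetter w ∈ w ∧ maxLetter (w.map f) = f (maxLetter w) := by
  have hmem : maxLetter w ∈ w := by
    have hne : w.toFinset.Nonempty := by
      obtain ⟨a, ha⟩ := List.exists_mem_of_ne_nil w hw
      exact ⟨a, List.mem_toFinset.2 ha⟩
    obtain ⟨a, ha, h⟩ := Finset.exists_mem_eq_sup w.toFinset hne id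
    unfold maxLetter
    rw [h]
    exact List.mem_toFinset.1 ha
  refine ⟨hmem, le_antisymm ?_ ?_⟩
  · apply Finset.sup_le
    intro b hb
    rw [List.mem_toFinset, List.mem_map] at hb
    obtain ⟨a, ha, rfl⟩ := hb
    exact hf.monotoneOn ha hmem (Finset.le_sup (f := id) (List.mem_toFinset.2 ha))
  · exact Finset.le_sup (f := id)
      (List.mem_toFinset.2 (List.mem_map.2 ⟨maxLetter w, hmem, rfl⟩))

theorem realize_convProd_M (c : ℕ → ℕ → Prop)
    (hc : ∀ (f : ℕ → ℕ) (s : Set ℕ), StrictMonoOn f s → ∀ a ∈ s, ∀ b ∈ s, (c (f a) (f b) ↔ c a b))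
    (u' u'' : PackedWord) (hne : (u'.1 ≠ [] ∧ u''.1 ≠ []) ∨ ∀ a b, c a b) :
    realize K (convProd K c (M K u') (M K u'')) =
      concatProd c (realize K (M K u')) (realize K (M K u'')) := by
  classical
  funext w
  have hL : realize K (convProd K c (M K u') (M K u'')) w =
      if toPacked w ∈ convolution c u' u'' then 1 else 0 := by
    rw [realize_apply, convProd, lift_M, lift_M, Finsupp.finsetSum_apply]
    simp [M, Finsupp.single_apply]
  have hr : ∀ (u : PackedWord) (v : List ℕ),
      realize K (M K u) v = if pack v = u.1 then 1 else 0 := by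
    intro u v
    rw [realize, lift_M]
  have htake : ∀ n, pack ((pack w).take n) = pack (w.take n) := by
    intro n
    rw [show (pack w).take n = (w.take n).map (letterRank w) from List.map_take.symm, pack_map _ _
      ((letterRank_strictMonoOn w).mono (fun a ha => List.mem_of_mem_take ha))]
  have hdrop : ∀ n, pack ((pack w).drop n) = pack (w.drop n) := by
    intro n
    rw [show (pack w).drop n = (w.drop n).map (letterRank w) from List.map_drop.symm, pack_map _ _
      ((letterRank_strictMonoOn w).mono (fun a ha => List.mem_of_mem_drop ha))]
  rw [hL]
  simp only [concatProd, hr]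
  by_cases hlen : w.length = u'.1.length + u''.1.length
  · rw [Finset.sum_eq_single u'.1.length]
    · have key : toPacked w ∈ convolution c u' u'' ↔
          pack (w.take u'.1.length) = u'.1 ∧ pack (w.drop u'.1.length) = u''.1 ∧
          c (maxLetter (w.take u'.1.length)) (maxLetter (w.drop u'.1.length)) := by
        simp only [convolution, Finset.mem_filter, mem_packedWords, toPacked_val, length_pack, hlen,
          true_and, htake, hdrop]
        refine and_congr_right fun h1 => and_congr_right fun h2 => ?_
        rcases hne with ⟨n1, n2⟩ | h
        · have m1 : w.take u'.1.length ≠ [] := by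
            intro h
            rw [h] at h1
            exact n1 h1.symm
          have m2 : w.drop u'.1.length ≠ [] := by
            intro h
            rw [h] at h2
            exact n2 h2.symm
          have e1 := maxLetter_map m1 (letterRank w)
            ((letterRank_strictMonoOn w).mono (fun a ha => List.mem_of_mem_take ha))
          have e2 := maxLetter_map m2 (letterRank w)
            ((letterRank_strictMonoOn w).mono (fun a ha => List.mem_of_mem_drop ha))
          rw [pack, ← List.map_take, ← List.map_drop, e1.2, e2.2]
          exact hc _ _ (letterRank_strictMonoOn w) _ (List.mem_of_mem_take e1.1) _
            (List.mem_of_mem_drop e2.1)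
        · exact ⟨fun _ => h _ _, fun _ => h _ _⟩
      rw [if_congr key rfl rfl]
      split_ifs <;> simp_all
    · intro n hn hne'
      rw [Finset.mem_range] at hn
      have : pack (w.take n) ≠ u'.1 := by
        intro h
        have := congrArg List.length h
        rw [length_pack, List.length_take] at this
        omega
      simp [this]
    · intro h
      rw [Finset.mem_range] at h
      omega
  · rw [if_neg, Finset.sum_eq_zero]
    · intro n hn
      rw [Finset.mem_range] at hn
      by_cases h1 : pack (w.take n) = u'.1
      · by_cases h2 : pack (w.drop n) = u''.1
        · exfalso
          have e1 := congrArg List.length h1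
          have e2 := congrArg List.length h2
          rw [length_pack, List.length_take] at e1
          rw [length_pack, List.length_drop] at e2
          omega
        · simp [h2]
      · simp [h1]
    · intro h
      simp only [convolution, Finset.mem_filter, mem_packedWords, toPacked_val, length_pack] at h
      exact hlen h.1

theorem concatProd_sum {ι κ : Type*} (c : ℕ → ℕ → Prop) (s : Finset ι) (t : Finset κ)
    (k : ι → K) (l : κ → K) (f : ι → List ℕ → K) (g : κ → List ℕ → K) :
    concatProd c (∑ i ∈ s, k i • f i) (∑ j ∈ t, l j • g j) =
      ∑ i ∈ s, ∑ j ∈ t, k i • l j • concatProd c (f i) (g j) := by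
  classical
  funext w
  simp only [concatProd, Finset.sum_apply, Pi.smul_apply, smul_eq_mul, Finset.mul_sum (s := Finset.range _)]
  rw [Finset.sum_congr rfl (fun i _ => Finset.sum_comm), Finset.sum_comm]
  refine Finset.sum_congr rfl fun n _ => ?_
  split_ifs
  · rw [Finset.sum_mul_sum]
    refine Finset.sum_congr rfl fun i _ => Finset.sum_congr rfl fun j _ => ?_
    ring
  · simp

theorem eq_sum_M (x : WQSym K) : x = ∑ u ∈ x.support, x u • M K u := by
  conv_lhs => rw [← Finsupp.sum_single x]
  simp [Finsupp.sum, M]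

theorem realize_convProd (c : ℕ → ℕ → Prop)
    (hc : ∀ (f : ℕ → ℕ) (s : Set ℕ), StrictMonoOn f s → ∀ a ∈ s, ∀ b ∈ s, (c (f a) (f b) ↔ c a b))
    (x y : WQSym K) (hne : (x (toPacked []) = 0 ∧ y (toPacked []) = 0) ∨ ∀ a b, c a b) :
    realize K (convProd K c x y) = concatProd c (realize K x) (realize K y) := by
  have hx : realize K x = ∑ u ∈ x.support, x u • realize K (M K u) := by
    conv_lhs => rw [eq_sum_M K x]
    simp only [map_sum, map_smul]
  have hy : realize K y = ∑ u ∈ y.support, y u • realize K (M K u) := by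
    conv_lhs => rw [eq_sum_M K y]
    simp only [map_sum, map_smul]
  have hxy : convProd K c x y =
      ∑ u ∈ x.support, ∑ v ∈ y.support, x u • y v • convProd K c (M K u) (M K v) := by
    conv_lhs => rw [eq_sum_M K x, eq_sum_M K y]
    simp only [map_sum, map_smul, LinearMap.sum_apply, LinearMap.smul_apply, Finset.smul_sum]
    rw [Finset.sum_comm]
    exact Finset.sum_congr rfl fun u _ => Finset.sum_congr rfl fun v _ => smul_comm _ _ _
  rw [hx, hy, hxy, concatProd_sum]
  simp only [map_sum, map_smul]
  refine Finset.sum_congr rfl fun u hu => ?_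
  have aux : ∀ (z : WQSym K), z (toPacked []) = 0 → ∀ u ∈ z.support, u.1 ≠ [] := by
    intro z hz u hu h
    rw [Finsupp.mem_support_iff] at hu
    have : u = toPacked [] := Subtype.ext h
    rw [this] at hu
    exact hu hz
  refine Finset.sum_congr rfl fun v hv => ?_
  rw [realize_convProd_M K c hc u v (hne.imp_left fun h => ⟨aux x h.1 u hu, aux y h.2 v hv⟩)]

theorem counit_apply (x : WQSym K) : counit K x = x (toPacked []) := by
  have h : counit K = Finsupp.lapply (toPacked []) := by
    apply Finsupp.lhom_ext'
    intro u
    ext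
    have : u.1 = [] ↔ u = toPacked [] :=
      ⟨fun h => Subtype.ext h, fun h => by rw [h]; rfl⟩
    simp [counit, lift, Finsupp.linearCombination_single, this, Finsupp.single_apply]
  rw [h]
  rfl

/-- The product of `WQSym` is the concatenation product of series. -/
theorem realize_mul (x y : WQSym K) :
    realize K ((ops K).mul x y) = concatProd (fun _ _ => True) (realize K x) (realize K y) :=
  realize_convProd K _ (fun _ _ _ _ _ _ _ => Iff.rfl) x y (Or.inr fun _ _ => trivial)

theorem realize_partialProd (c : ℕ → ℕ → Prop)
    (hc : ∀ (f : ℕ → ℕ) (s : Set ℕ), StrictMonoOn f s → ∀ a ∈ s, ∀ b ∈ s, (c (f a) (f b) ↔ c a b))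
    (x y : plus K) :
    realize K (partialProd K c x y) = concatProd c (realize K x) (realize K y) := by
  have hx : (x : WQSym K) (toPacked []) = 0 := by rw [← counit_apply]; exact x.2
  have hy : (y : WQSym K) (toPacked []) = 0 := by rw [← counit_apply]; exact y.2
  have h := realize_convProd K c hc x y (Or.inl ⟨hx, hy⟩)
  have h0 : counit K (convProd K c x y) = 0 := by
    rw [counit_apply]
    have h1 := congrFun h []
    rw [realize_apply] at h1
    rw [h1]
    simp [concatProd, realize_apply, hx]
  have h2 : ((partialProd K c x y : plus K) : WQSym K) = convProd K c x y := by
    change convProd K c x y - counit K (convProd K c x y) • M K (toPacked []) = _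
    rw [h0, zero_smul, sub_zero]
  rw [h2, h]

/-- The partial product `≺` of series: the products `v · w` with `max v > max w`. -/
theorem realize_left (x y : plus K) :
    realize K ((ops K).left x y) =
      concatProd (fun a b => b < a) (realize K x) (realize K y) := by
  refine realize_partialProd K (fun a b => b < a) ?_ x y
  intro f s hf a ha b hb
  exact hf.lt_iff_lt hb ha

/-- The partial product `∘` of series: the products `v · w` with `max v = max w`. -/
theorem realize_mid (x y : plus K) :
    realize K ((ops K).mid x y) =
      concatProd (fun a b => b = a) (realize K x) (realize K y) := by
  refine realize_partialProd K (fun a b => b = a) ?_ x y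
  intro f s hf a ha b hb
  exact hf.injOn.eq_iff hb ha

/-- The partial product `≻` of series: the products `v · w` with `max v < max w`. -/
theorem realize_right (x y : plus K) :
    realize K ((ops K).right x y) =
      concatProd (fun a b => a < b) (realize K x) (realize K y) := by
  refine realize_partialProd K (fun a b => a < b) ?_ x y
  intro f s hf a ha b hb
  exact hf.lt_iff_lt ha hb

end WQSym

/-! ### The sylvester quotient and the trialgebra `TD` -/

/-- An elementary sylvester move `x a c y b z → x c a y b z`, where `a ≤ b < c`. -/
inductive SylvesterStep : List ℕ → List ℕ → Prop
  | intro (x y z : List ℕ) (a b c : ℕ) (hab : a ≤ b) (hbc : b < c) :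
      SylvesterStep (x ++ a :: c :: y ++ b :: z) (x ++ c :: a :: y ++ b :: z)

/-- The sylvester congruence on words. -/
def SylvesterCongr : List ℕ → List ℕ → Prop := Relation.EqvGen SylvesterStep

/-- The span of the differences `M_u - M_v`, for sylvester congruent packed words `u`, `v`. -/
def sylvesterIdeal (K : Type u) [Field K] : Submodule K (WQSym K) :=
  Submodule.span K
    {x | ∃ u v : PackedWord, SylvesterCongr u.1 v.1 ∧ x = WQSym.M K u - WQSym.M K v}

/-- The sylvester quotient of `WQSym`. -/
abbrev SylvesterQuotient (K : Type u) [Field K] : Type u := WQSym K ⧸ sylvesterIdeal K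

/-- The element `M_1`, the sum of all letters, in the augmentation ideal of `WQSym`. -/
def MOne (K : Type u) [Field K] : WQSym.plus K := WQSym.proj K (WQSym.M K (toPacked [1]))

/-- `TD`: the sub-trialgebra of the augmentation ideal of `WQSym` generated by `M_1`, with the unit
adjoined. -/
def TD (K : Type u) [Field K] : Submodule K (WQSym K) :=
  Submodule.span K {(WQSym.ops K).one} ⊔
    ((WQSym.ops K).generatedSubtrialgebra (MOne K)).map (WQSym.plus K).subtype

end

noncomputable section

/-! ### Packing -/

/-! Identities in WQSym are read off from the series realization. The coefficient of a partial
product at a word is a sum over the factorizations `v · v'` of that word, restricted by a condition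
on `max v` and `max v'` (`realize_partialProd_apply`). Each dendriform axiom thereby becomes a
statement about three maxima (`partialProd_assoc`).

Dually, if all letters of `p` are smaller than all letters of `q`, the coefficient of `Δ x` at `(p,
q)` is the sum of the coefficients of `x` over the shuffles of `p` and `q` (`coeff₂_comul`), and the
half-coproducts keep the shuffles whose last letter comes from `p`, respectively from `q`. Cutting a
shuffle in two gives shuffles of the corresponding pieces (`shuffleSum_splitSum`). Hence `Δ` is
multiplicative, and the half-coproducts of a partial product obey two formulas, valid for every
order condition, that contain the four bidendriform relations (`halfComul_gt_partialProd`,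
`halfComul_le_partialProd`).

The sylvester congruence is compatible with concatenation, increasing relabelling and restriction to
intervals of letters, and it preserves the letters and the last letter. So all operations descend to
the quotient `S`, and the laws follow by surjectivity. Since `S` is conilpotent, its antipode is a
geometric series for convolution. The same two formulas show that TD is stable under the
half-coproducts, because both halves vanish on `M_1`.

It remains to see that the composite TD → WQSym → `S`, which respects all operations, is bijective.
A word `v · r` is congruent to `U · L · r`, where `U` collects the letters of `v` that exceed `r`
and `L` the others: this is the root decomposition of a binary search tree. Recursively it attaches
to each word a monomial `nf` in `M_1`, which depends only on the sylvester class (`nf_congr`). These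
monomials span the augmentation ideal of TD, since the trialgebra axioms rewrite every product as a
combination of them (`TDPlus_le_nfSpan`). Their classes span the augmentation ideal of `S`, length
by length, by a triangularity argument (`MPlus_mem_sup`).

Injectivity then needs no enumeration of classes. The map `M_u ↦ nf u` induces an endomorphism
`nfEnd` of `S`; the image of each finite-dimensional filtration step contains that step, so `nfEnd`
is injective there. An element of TD⁺ that dies in `S` is the normal-form image of some `y` whose
class is killed by `nfEnd`; so the class of `y` is zero, and with it the element. -/

theorem letterRank_congr {u v : List ℕ} (h : ∀ a, a ∈ u ↔ a ∈ v) : letterRank u = letterRank v := by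
  have : u.toFinset = v.toFinset := by ext a; simp [h]
  funext a
  simp [letterRank, this]

theorem letterRank_mono (w : List ℕ) : Monotone (letterRank w) := fun a b hab =>
  Finset.card_le_card fun c hc => by
    simp only [Finset.mem_filter] at hc ⊢
    exact ⟨hc.1, hc.2.trans hab⟩

theorem letterRank_le_letterRank_iff {w : List ℕ} {a b : ℕ} (ha : a ∈ w) :
    letterRank w a ≤ letterRank w b ↔ a ≤ b :=
  ⟨fun h => not_lt.1 fun hab => (letterRank_lt ha hab).not_ge h, fun h => letterRank_mono w h⟩

theorem letterRank_pos {w : List ℕ} {a : ℕ} (ha : a ∈ w) : 0 < letterRank w a :=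
  Finset.card_pos.2 ⟨a, by simp [ha]⟩

/-- Ranks are injective on the letters and lie between 1 and the number of distinct letters, so by
counting every value in that range is attained. -/
theorem mem_pack_iff {w : List ℕ} {a : ℕ} : a ∈ pack w ↔ 1 ≤ a ∧ a ≤ w.toFinset.card := by
  have hsub : w.toFinset.image (letterRank w) ⊆ Finset.Icc 1 w.toFinset.card := by
    intro b hb
    simp only [Finset.mem_image, List.mem_toFinset] at hb
    obtain ⟨c, hc, rfl⟩ := hb
    exact Finset.mem_Icc.2 ⟨letterRank_pos hc, Finset.card_le_card (Finset.filter_subset _ _)⟩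
  have hcard : (w.toFinset.image (letterRank w)).card = w.toFinset.card :=
    Finset.card_image_of_injOn fun b hb c hc h =>
      (letterRank_strictMonoOn w).injOn (by simpa using hb) (by simpa using hc) h
  have heq := Finset.eq_of_subset_of_card_le hsub (by rw [hcard]; simp)
  rw [← Finset.mem_Icc, ← heq]
  simp [pack]

theorem maxLetter_le_iff {w : List ℕ} {n : ℕ} : maxLetter w ≤ n ↔ ∀ a ∈ w, a ≤ n := by
  simp [maxLetter]

theorem le_maxLetter {w : List ℕ} {a : ℕ} (h : a ∈ w) : a ≤ maxLetter w :=
  maxLetter_le_iff.1 le_rfl a h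

theorem maxLetter_nil : maxLetter [] = 0 := rfl

theorem maxLetter_mem {w : List ℕ} (hw : w ≠ []) : maxLetter w ∈ w :=
  (WQSym.maxLetter_map hw id (fun _ _ _ _ h => h)).1

theorem maxLetter_append (v w : List ℕ) : maxLetter (v ++ w) = max (maxLetter v) (maxLetter w) := by
  simp [maxLetter, Finset.sup_union]

theorem maxLetter_congr {u v : List ℕ} (h : ∀ a, a ∈ u ↔ a ∈ v) : maxLetter u = maxLetter v := by
  have : u.toFinset = v.toFinset := by ext a; simp [h]
  simp [maxLetter, this]

theorem pack_nil : pack [] = [] := rfl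

theorem pack_eq_nil {w : List ℕ} : pack w = [] ↔ w = [] := by simp [pack]

theorem maxLetter_pack (w : List ℕ) : maxLetter (pack w) = w.toFinset.card := by
  apply le_antisymm
  · exact maxLetter_le_iff.2 fun a ha => (mem_pack_iff.1 ha).2
  · by_cases h : w.toFinset.card = 0
    · omega
    · exact le_maxLetter (mem_pack_iff.2 ⟨by omega, le_rfl⟩)

theorem mem_packed_iff {w : List ℕ} (hw : pack w = w) {a : ℕ} :
    a ∈ w ↔ 1 ≤ a ∧ a ≤ maxLetter w := by
  conv_lhs => rw [← hw]
  conv_rhs => rw [← hw]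
  rw [mem_pack_iff, maxLetter_pack]

theorem letterRank_packed {w : List ℕ} (hw : pack w = w) {a : ℕ} (ha : a ∈ w) :
    letterRank w a = a := by
  have h : w.map (letterRank w) = w.map id := by rw [List.map_id]; exact hw
  exact List.map_inj_left.1 h a ha

theorem pack_eq_self_iff {w : List ℕ} : pack w = w ↔ ∀ a ∈ w, letterRank w a = a := by
  refine ⟨fun h a => letterRank_packed h, fun h => ?_⟩
  rw [pack]
  conv_rhs => rw [← List.map_id w]
  exact List.map_congr_left h

/-- The inverse of `letterRank w` on the letters of `w`. -/
def unrank (w : List ℕ) : ℕ → ℕ := Function.invFunOn (letterRank w) {a | a ∈ w}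

theorem unrank_congr {u v : List ℕ} (h : ∀ a, a ∈ u ↔ a ∈ v) : unrank u = unrank v := by
  have : {a | a ∈ u} = {a | a ∈ v} := Set.ext h
  rw [unrank, unrank, letterRank_congr h, this]

theorem unrank_letterRank {w : List ℕ} {a : ℕ} (ha : a ∈ w) : unrank w (letterRank w a) = a :=
  (letterRank_strictMonoOn w).injOn.leftInvOn_invFunOn ha

theorem map_unrank_pack (w : List ℕ) : (pack w).map (unrank w) = w := by
  rw [pack, List.map_map]
  conv_rhs => rw [← List.map_id w]
  exact List.map_congr_left fun a ha => unrank_letterRank ha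

theorem strictMonoOn_unrank (w : List ℕ) : StrictMonoOn (unrank w) {a | a ∈ pack w} := by
  intro a ha b hb hab
  simp only [pack, Set.mem_ofPred_eq, List.mem_map] at ha hb
  obtain ⟨a, ha, rfl⟩ := ha
  obtain ⟨b, hb, rfl⟩ := hb
  rw [unrank_letterRank ha, unrank_letterRank hb]
  exact ((letterRank_strictMonoOn w).lt_iff_lt ha hb).1 hab

theorem toPacked_eq_iff {w : List ℕ} {u : PackedWord} : toPacked w = u ↔ pack w = u.1 :=
  ⟨fun h => by rw [← h]; rfl, fun h => Subtype.ext h⟩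

theorem toPacked_val_self (u : PackedWord) : toPacked u.1 = u := Subtype.ext u.2

theorem toPacked_eq_toPacked_iff {v w : List ℕ} : toPacked v = toPacked w ↔ pack v = pack w :=
  toPacked_eq_iff

theorem filter_pack (w : List ℕ) (p : ℕ → Bool) :
    (pack w).filter p = (w.filter (fun a => p (letterRank w a))).map (letterRank w) := by
  rw [pack, List.filter_map]; rfl

theorem pack_filter_pack_le (w : List ℕ) (n : ℕ) :
    pack ((pack w).filter (fun a => a ≤ letterRank w n)) = pack (w.filter (fun a => a ≤ n)) := by
  rw [filter_pack, pack_map _ _ ((letterRank_strictMonoOn w).mono fun a ha => List.mem_of_mem_filter ha)]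
  congr 1
  apply List.filter_congr
  intro a ha
  simp [letterRank_le_letterRank_iff ha]

theorem pack_filter_pack_gt (w : List ℕ) (n : ℕ) :
    pack ((pack w).filter (fun a => letterRank w n < a)) = pack (w.filter (fun a => n < a)) := by
  rw [filter_pack, pack_map _ _ ((letterRank_strictMonoOn w).mono fun a ha => List.mem_of_mem_filter ha)]
  congr 1
  apply List.filter_congr
  intro a ha
  simp only [decide_eq_decide]
  rw [← not_le, letterRank_le_letterRank_iff ha, not_le]

/-! ### Cutting a packed word between two letter values -/

namespace WQSym

/-- The letters up to `k` form an initial segment of the letters of a packed word, so their ranks do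
not change and no repacking takes place. -/
theorem lower_val (w : PackedWord) (k : ℕ) : (lower w k).1 = w.1.filter (fun a => a ≤ k) := by
  refine pack_eq_self_iff.2 fun a ha => ?_
  rw [List.mem_filter] at ha
  have hk : a ≤ k := by simpa using ha.2
  rw [← letterRank_packed w.2 ha.1, letterRank_packed w.2 ha.1]
  conv_rhs => rw [← letterRank_packed w.2 ha.1]
  unfold letterRank
  congr 1
  ext b
  simp only [Finset.mem_filter, List.mem_toFinset, List.mem_filter, decide_eq_true_eq]
  exact ⟨fun h => ⟨h.1.1, h.2⟩, fun h => ⟨⟨h.1, h.2.trans hk⟩, h.2⟩⟩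

theorem upper_val (w : PackedWord) (k : ℕ) :
    (upper w k).1 = (w.1.filter (fun a => k < a)).map (· - k) := by
  change pack _ = _
  rw [pack]
  apply List.map_congr_left
  intro a ha
  rw [List.mem_filter] at ha
  have hk : k < a := by simpa using ha.2
  have h : (w.1.filter (fun a => k < a)).toFinset.filter (fun b => b ≤ a) = Finset.Ioc k a := by
    ext b
    simp only [Finset.mem_filter, List.mem_toFinset, List.mem_filter, decide_eq_true_eq,
      Finset.mem_Ioc]
    have h1 := mem_packed_iff w.2 (a := b)
    have h2 := le_maxLetter ha.1
    constructor
    · rintro ⟨⟨-, h⟩, h'⟩; exact ⟨h, h'⟩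
    · rintro ⟨h, h'⟩; exact ⟨⟨h1.2 ⟨by omega, by omega⟩, h⟩, h'⟩
  rw [letterRank, h, Nat.card_Ioc]

theorem maxLetter_lower (w : PackedWord) {k : ℕ} (hk : k ≤ maxLetter w.1) :
    maxLetter (lower w k).1 = k := by
  rw [lower_val]
  apply le_antisymm
  · exact maxLetter_le_iff.2 fun a ha => by simpa using (List.mem_filter.1 ha).2
  · rcases Nat.eq_zero_or_pos k with rfl | h
    · omega
    · exact le_maxLetter (List.mem_filter.2 ⟨(mem_packed_iff w.2).2 ⟨h, hk⟩, by simp⟩)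

theorem maxLetter_upper (w : PackedWord) {k : ℕ} (hk : k ≤ maxLetter w.1) :
    maxLetter (upper w k).1 = maxLetter w.1 - k := by
  rw [upper_val]
  apply le_antisymm
  · refine maxLetter_le_iff.2 fun a ha => ?_
    simp only [List.mem_map, List.mem_filter] at ha
    obtain ⟨b, ⟨hb, -⟩, rfl⟩ := ha
    have := le_maxLetter hb
    omega
  · rcases Nat.eq_or_lt_of_le hk with h | h
    · omega
    · refine le_maxLetter (List.mem_map.2 ⟨maxLetter w.1, List.mem_filter.2
        ⟨(mem_packed_iff w.2).2 ⟨by omega, le_rfl⟩, by simpa using h⟩, rfl⟩)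

/-- With `upper_upper` and `lower_upper` this identifies the three pieces of a double cut, whichever
cut is made first; coassociativity uses nothing else about the pieces. -/
theorem lower_lower (w : PackedWord) {j k : ℕ} (h : j ≤ k) : lower (lower w k) j = lower w j := by
  apply Subtype.ext
  rw [lower_val, lower_val, lower_val, List.filter_filter]
  apply List.filter_congr
  intro a _
  simp only [← Bool.decide_and, decide_eq_decide]
  omega

theorem upper_upper (w : PackedWord) (j i : ℕ) : upper (upper w j) i = upper w (j + i) := by
  apply Subtype.ext
  rw [upper_val, upper_val, upper_val, List.filter_map, List.filter_filter, List.map_map]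
  have : w.1.filter (fun a => ((fun a => decide (i < a)) ∘ fun x => x - j) a && decide (j < a)) =
      w.1.filter (fun a => decide (j + i < a)) := by
    apply List.filter_congr
    intro a _
    simp only [Function.comp, ← Bool.decide_and, decide_eq_decide]
    omega
  rw [this]
  apply List.map_congr_left
  intro a _
  simp only [Function.comp]
  omega

theorem lower_upper (w : PackedWord) (j i : ℕ) :
    lower (upper w j) i = upper (lower w (j + i)) j := by
  apply Subtype.ext
  rw [lower_val, upper_val, upper_val, lower_val, List.filter_map, List.filter_filter,
    List.filter_filter]
  congr 1
  apply List.filter_congr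
  intro a _
  simp only [Function.comp, ← Bool.decide_and, decide_eq_decide]
  omega

end WQSym

/-! ### The last letter of a word -/

theorem getLastD_filter {w : List ℕ} {p : ℕ → Bool} {d : ℕ} (hw : w ≠ []) (h : p (w.getLastD d)) (e : ℕ) :
    (w.filter p).getLastD e = w.getLastD d := by
  obtain ⟨v, a, rfl⟩ := List.eq_nil_or_concat w |>.resolve_left hw
  simp only [List.concat_eq_append] at h ⊢
  have h1 : ∀ (l : List ℕ) (b c : ℕ), (l ++ [b]).getLastD c = b := by
    intro l b c; simp [List.getLastD_eq_getLast?]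
  rw [h1] at h
  rw [List.filter_append, List.filter_cons_of_pos h, List.filter_nil, h1, h1]

theorem getLastD_map {w : List ℕ} (f : ℕ → ℕ) {d : ℕ} (hw : w ≠ []) (e : ℕ) :
    (w.map f).getLastD e = f (w.getLastD d) := by
  obtain ⟨v, a, rfl⟩ := List.eq_nil_or_concat w |>.resolve_left hw
  simp [List.getLastD_eq_getLast?]

theorem getLastD_append_singleton (l : List ℕ) (b c : ℕ) : (l ++ [b]).getLastD c = b := by
  simp [List.getLastD_eq_getLast?]

theorem getLastD_append {v w : List ℕ} (hw : w ≠ []) (c : ℕ) :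
    (v ++ w).getLastD c = w.getLastD c := by
  obtain ⟨x, a, rfl⟩ := List.eq_nil_or_concat w |>.resolve_left hw
  rw [List.concat_eq_append, ← List.append_assoc, getLastD_append_singleton,
    getLastD_append_singleton]

theorem getLastD_mem {w : List ℕ} (hw : w ≠ []) (c : ℕ) : w.getLastD c ∈ w := by
  obtain ⟨x, a, rfl⟩ := List.eq_nil_or_concat w |>.resolve_left hw
  simp [List.getLastD_eq_getLast?]

/-! ### The sylvester congruence -/

theorem SylvesterStep.perm {u v : List ℕ} (h : SylvesterStep u v) : u.Perm v := by
  obtain ⟨x, y, z, a, b, c, -, -⟩ := h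
  simp only [List.append_assoc, List.cons_append]
  exact (List.Perm.swap c a _).append_left x

namespace SylvesterCongr

theorem refl (u : List ℕ) : SylvesterCongr u u := Relation.EqvGen.refl u

theorem symm {u v : List ℕ} (h : SylvesterCongr u v) : SylvesterCongr v u :=
  Relation.EqvGen.symm _ _ h

theorem trans {u v w : List ℕ} (h : SylvesterCongr u v) (h' : SylvesterCongr v w) :
    SylvesterCongr u w := Relation.EqvGen.trans _ _ _ h h'

theorem of_step {u v : List ℕ} (h : SylvesterStep u v) : SylvesterCongr u v :=
  Relation.EqvGen.rel _ _ h

theorem perm {u v : List ℕ} (h : SylvesterCongr u v) : u.Perm v := by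
  induction h with
  | rel _ _ h => exact h.perm
  | refl => exact .refl _
  | symm _ _ _ ih => exact ih.symm
  | trans _ _ _ _ _ ih ih' => exact ih.trans ih'

theorem mem_iff {u v : List ℕ} (h : SylvesterCongr u v) (a : ℕ) : a ∈ u ↔ a ∈ v := h.perm.mem_iff

theorem append_left {u v : List ℕ} (h : SylvesterCongr u v) (w : List ℕ) :
    SylvesterCongr (w ++ u) (w ++ v) := by
  induction h with
  | rel _ _ h =>
    obtain ⟨x, y, z, a, b, c, hab, hbc⟩ := h
    have := SylvesterStep.intro (w ++ x) y z a b c hab hbc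
    simp only [List.append_assoc] at this ⊢
    exact of_step this
  | refl => exact refl _
  | symm _ _ _ ih => exact ih.symm
  | trans _ _ _ _ _ ih ih' => exact ih.trans ih'

theorem append_right {u v : List ℕ} (h : SylvesterCongr u v) (w : List ℕ) :
    SylvesterCongr (u ++ w) (v ++ w) := by
  induction h with
  | rel _ _ h =>
    obtain ⟨x, y, z, a, b, c, hab, hbc⟩ := h
    have := SylvesterStep.intro x y (z ++ w) a b c hab hbc
    simp only [List.append_assoc, List.cons_append] at this ⊢
    exact of_step this
  | refl => exact refl _
  | symm _ _ _ ih => exact ih.symm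
  | trans _ _ _ _ _ ih ih' => exact ih.trans ih'

theorem cons {u v : List ℕ} (h : SylvesterCongr u v) (a : ℕ) : SylvesterCongr (a :: u) (a :: v) :=
  h.append_left [a]

theorem map {u v : List ℕ} (h : SylvesterCongr u v) {f : ℕ → ℕ}
    (hf : StrictMonoOn f {a | a ∈ u}) : SylvesterCongr (u.map f) (v.map f) := by
  induction h with
  | rel _ _ h =>
    obtain ⟨x, y, z, a, b, c, hab, hbc⟩ := h
    have := SylvesterStep.intro (x.map f) (y.map f) (z.map f) (f a) (f b) (f c)
      (hf.monotoneOn (by simp) (by simp) hab) (hf (by simp) (by simp) hbc)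
    simpa using of_step this
  | refl => exact refl _
  | symm _ _ h ih =>
    have h := mem_iff h
    exact (ih (by simpa only [h] using hf)).symm
  | trans _ _ _ h _ ih ih' =>
    have h := mem_iff h
    exact (ih hf).trans (ih' (by simpa only [← h] using hf))

theorem pack {u v : List ℕ} (h : SylvesterCongr u v) : SylvesterCongr (pack u) (pack v) := by
  have := h.map (letterRank_strictMonoOn u)
  rw [_root_.pack, _root_.pack, ← letterRank_congr h.mem_iff]
  exact this

/-- If both exchanged letters `a`, `c` survive, so does the witness `b` between them, and the move
persists. If one of them is removed, the two filtered words coincide. -/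
theorem filter_of_ordConnected {u v : List ℕ} (h : SylvesterCongr u v) {p : ℕ → Bool}
    (hp : ∀ a b c, a ≤ b → b ≤ c → p a → p c → p b) :
    SylvesterCongr (u.filter p) (v.filter p) := by
  induction h with
  | rel _ _ h =>
    obtain ⟨x, y, z, a, b, c, hab, hbc⟩ := h
    by_cases ha : p a
    · by_cases hc : p c
      · have := SylvesterStep.intro (x.filter p) (y.filter p) (z.filter p) a b c hab hbc
        simpa [List.filter_cons, ha, hc, hp a b c hab hbc.le ha hc] using of_step this
      · simpa [List.filter_cons, ha, hc] using refl _
    · simpa [List.filter_cons, ha] using refl _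
  | refl => exact refl _
  | symm _ _ _ ih => exact ih.symm
  | trans _ _ _ _ _ ih ih' => exact ih.trans ih'

theorem filter_le {u v : List ℕ} (h : SylvesterCongr u v) (k : ℕ) :
    SylvesterCongr (u.filter (fun a => a ≤ k)) (v.filter (fun a => a ≤ k)) :=
  h.filter_of_ordConnected fun a b c hab hbc ha hc => by
    simp only [decide_eq_true_eq] at *; omega

theorem filter_gt {u v : List ℕ} (h : SylvesterCongr u v) (k : ℕ) :
    SylvesterCongr (u.filter (fun a => k < a)) (v.filter (fun a => k < a)) :=
  h.filter_of_ordConnected fun a b c hab hbc ha hc => by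
    simp only [decide_eq_true_eq] at *; omega

/-- The witness `b` stands to the right of the exchanged letters, so a move never reaches the last
position. -/
theorem getLastD_eq {u v : List ℕ} (h : SylvesterCongr u v) (d : ℕ) :
    u.getLastD d = v.getLastD d := by
  induction h with
  | rel _ _ h =>
    obtain ⟨x, y, z, a, b, c, hab, hbc⟩ := h
    rw [getLastD_append (by simp), getLastD_append (by simp)]
  | refl => rfl
  | symm _ _ _ ih => exact ih.symm
  | trans _ _ _ _ _ ih ih' => exact ih.trans ih'

/-- Congruent words have the same last letter `r`, and remain congruent when this letter is removed
and the remaining letters `≤ r`, resp. `> r`, are kept. -/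
theorem filter_dropLast {u v : List ℕ} (h : SylvesterCongr u v) :
    SylvesterCongr (u.dropLast.filter (fun a => a ≤ u.getLastD 0))
        (v.dropLast.filter (fun a => a ≤ v.getLastD 0)) ∧
      SylvesterCongr (u.dropLast.filter (fun a => u.getLastD 0 < a))
        (v.dropLast.filter (fun a => v.getLastD 0 < a)) := by
  induction h with
  | rel _ _ h =>
    rw [(of_step h).getLastD_eq 0]
    obtain ⟨x, y, z, a, b, c, hab, hbc⟩ := h
    -- If the witness `b` is itself the last letter, then `a` and `c` go to different parts and each
    -- filter gives equal words. Otherwise the witness survives the removal of the last letter, and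
    -- the same move applies to what remains.
    rcases List.eq_nil_or_concat z with rfl | ⟨z, r, rfl⟩
    · rw [List.dropLast_concat, List.dropLast_concat, getLastD_append_singleton]
      have hca : ¬ c ≤ b := by omega
      have hba : ¬ b < a := by omega
      constructor
      · simpa [List.filter_cons, hab, hca] using refl _
      · simpa [List.filter_cons, hba, hbc] using refl _
    · have h : ∀ l, l ++ b :: z.concat r = (l ++ b :: z) ++ [r] := by intro l; simp
      rw [h, h, List.dropLast_concat, List.dropLast_concat, getLastD_append_singleton]
      have hs := of_step (SylvesterStep.intro x y z a b c hab hbc)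
      exact ⟨hs.filter_le r, hs.filter_gt r⟩
  | refl => exact ⟨refl _, refl _⟩
  | symm _ _ _ ih => exact ⟨ih.1.symm, ih.2.symm⟩
  | trans _ _ _ _ _ ih ih' => exact ⟨ih.1.trans ih'.1, ih.2.trans ih'.2⟩

/-- The final letter `r` serves as the witness for exchanging `a` with each letter of `u` in turn.
-/
theorem move_right {a r : ℕ} (ha : a ≤ r) (u z : List ℕ) (hu : ∀ c ∈ u, r < c) :
    SylvesterCongr (a :: u ++ z ++ [r]) (u ++ a :: z ++ [r]) := by
  induction u with
  | nil => exact refl _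
  | cons c u ih =>
    have h1 := of_step (SylvesterStep.intro [] (u ++ z) [] a r c ha (hu c (by simp)))
    have h2 := (ih fun d hd => hu d (by simp [hd])).cons c
    simp only [List.nil_append, List.append_assoc, List.cons_append] at h1 h2 ⊢
    exact h1.trans h2

/-- The representative that exhibits a binary search tree with root `r`: the right subtree, then the
left subtree, then the root. -/
theorem sort_by_last (w : List ℕ) (r : ℕ) :
    SylvesterCongr (w ++ [r])
      (w.filter (fun a => r < a) ++ w.filter (fun a => a ≤ r) ++ [r]) := by
  induction w with
  | nil => exact refl _
  | cons a w ih =>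
    by_cases h : a ≤ r
    · have h' : ¬ r < a := by omega
      have := move_right h (w.filter (fun a => r < a)) (w.filter (fun a => a ≤ r))
        (fun c hc => by simpa using (List.mem_filter.1 hc).2)
      simpa [List.filter_cons, h, h'] using (ih.cons a).trans (by simpa using this)
    · have h' : r < a := by omega
      simpa [List.filter_cons, h, h'] using ih.cons a

end SylvesterCongr

/-! ### Sums over the factorizations of a word -/

section SplitSum

variable {A : Type*} [AddCommMonoid A]

/-- The sum of `G x y` over all factorizations `w = x ++ y`. -/
def splitSum (G : List ℕ → List ℕ → A) : List ℕ → A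
  | [] => G [] []
  | a :: w => G [] (a :: w) + splitSum (fun x y => G (a :: x) y) w

theorem splitSum_eq_sum (G : List ℕ → List ℕ → A) (w : List ℕ) :
    splitSum G w = ∑ n ∈ Finset.range (w.length + 1), G (w.take n) (w.drop n) := by
  induction w generalizing G with
  | nil => simp [splitSum]
  | cons a w ih =>
    rw [splitSum, ih, List.length_cons, Finset.sum_range_succ' _ (w.length + 1), add_comm]
    simp

theorem splitSum_congr {G G' : List ℕ → List ℕ → A} {w : List ℕ}
    (h : ∀ x y, x ++ y = w → G x y = G' x y) : splitSum G w = splitSum G' w := by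
  rw [splitSum_eq_sum, splitSum_eq_sum]
  exact Finset.sum_congr rfl fun n _ => h _ _ (List.take_append_drop n w)

theorem splitSum_add (G G' : List ℕ → List ℕ → A) (w : List ℕ) :
    splitSum (fun x y => G x y + G' x y) w = splitSum G w + splitSum G' w := by
  simp only [splitSum_eq_sum, Finset.sum_add_distrib]

theorem splitSum_zero (w : List ℕ) : splitSum (fun _ _ => (0 : A)) w = 0 := by
  simp [splitSum_eq_sum]

/-- Both sides enumerate the factorizations of `w` into three factors. -/
theorem splitSum_assoc (G : List ℕ → List ℕ → List ℕ → A) (w : List ℕ) :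
    splitSum (fun v z => splitSum (fun x y => G x y z) v) w =
      splitSum (fun x v => splitSum (fun y z => G x y z) v) w := by
  induction w generalizing G with
  | nil => simp [splitSum]
  | cons a w ih =>
    simp only [splitSum, splitSum_add]
    rw [ih, ← add_assoc]

theorem splitSum_ite_left (G : List ℕ → A) (w : List ℕ) :
    splitSum (fun x y => if x = [] then G y else 0) w = G w := by
  cases w with
  | nil => simp [splitSum]
  | cons a w => simp [splitSum, splitSum_zero]

theorem splitSum_ite_right (G : List ℕ → A) (w : List ℕ) :
    splitSum (fun x y => if y = [] then G x else 0) w = G w := by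
  induction w generalizing G with
  | nil => simp [splitSum]
  | cons a w ih => simp [splitSum, ih (fun x => G (a :: x))]

theorem splitSum_mul_right {K : Type*} [Semiring K] (G : List ℕ → List ℕ → K) (k : K) (w : List ℕ) :
    splitSum G w * k = splitSum (fun x y => G x y * k) w := by
  simp only [splitSum_eq_sum, Finset.sum_mul]

theorem splitSum_mul_left {K : Type*} [Semiring K] (G : List ℕ → List ℕ → K) (k : K) (w : List ℕ) :
    k * splitSum G w = splitSum (fun x y => k * G x y) w := by
  simp only [splitSum_eq_sum, Finset.mul_sum]

theorem splitSum_ite {A : Type*} [AddCommMonoid A] (G : List ℕ → List ℕ → A) (P : Prop) [Decidable P]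
    (w : List ℕ) : (if P then splitSum G w else 0) = splitSum (fun x y => if P then G x y else 0) w := by
  split_ifs
  · rfl
  · rw [splitSum_zero]

end SplitSum

/-! ### Order conditions, and the dendriform laws on series -/

open scoped Classical in
theorem concatProd_eq_splitSum {K : Type u} [Field K] (c : ℕ → ℕ → Prop) (f g : List ℕ → K)
    (w : List ℕ) : concatProd c f g w =
      splitSum (fun x y => if c (maxLetter x) (maxLetter y) then f x * g y else 0) w := by
  rw [splitSum_eq_sum]; rfl

/-- A relation on letters that is invariant under strictly increasing relabelling. -/
def IsOrderCond (c : ℕ → ℕ → Prop) : Prop :=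
  ∀ (f : ℕ → ℕ) (s : Set ℕ), StrictMonoOn f s → ∀ a ∈ s, ∀ b ∈ s, (c (f a) (f b) ↔ c a b)

theorem isOrderCond_gt : IsOrderCond (fun a b => b < a) := fun _ _ hf _ ha _ hb =>
  hf.lt_iff_lt hb ha

theorem isOrderCond_eq : IsOrderCond (fun a b => b = a) := fun _ _ hf _ ha _ hb =>
  hf.injOn.eq_iff hb ha

theorem isOrderCond_lt : IsOrderCond (fun a b => a < b) := fun _ _ hf _ ha _ hb =>
  hf.lt_iff_lt ha hb

theorem isOrderCond_le : IsOrderCond (fun a b => a ≤ b) := fun _ _ hf _ ha _ hb =>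
  hf.le_iff_le ha hb

theorem isOrderCond_true : IsOrderCond (fun _ _ => True) := fun _ _ _ _ _ _ _ => Iff.rfl

namespace WQSym

variable (K : Type u) [Field K]

theorem counit_M (u : PackedWord) : counit K (M K u) = if u.1 = [] then 1 else 0 := by
  rw [counit, lift_M]

theorem M_mem_plus {u : PackedWord} (hu : u.1 ≠ []) : M K u ∈ plus K := by
  rw [LinearMap.mem_ker, counit_M, if_neg hu]

theorem coe_proj (x : WQSym K) :
    ((proj K x : plus K) : WQSym K) = x - counit K x • M K (toPacked []) := rfl

theorem proj_coe (x : plus K) : proj K (x : WQSym K) = x := by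
  apply Subtype.ext
  rw [coe_proj, x.2, zero_smul, sub_zero]

theorem proj_one : proj K (M K (toPacked [])) = 0 := by
  apply Subtype.ext
  rw [coe_proj, counit_M, if_pos (by rfl), one_smul, sub_self]; rfl

theorem coe_proj_M {u : PackedWord} (hu : u.1 ≠ []) :
    ((proj K (M K u) : plus K) : WQSym K) = M K u := by
  rw [coe_proj, counit_M, if_neg hu, zero_smul, sub_zero]

theorem realize_M (u : PackedWord) (v : List ℕ) :
    realize K (M K u) v = if pack v = u.1 then 1 else 0 := by
  rw [realize, lift_M]

theorem realize_plus_nil (x : plus K) : realize K (x : WQSym K) [] = 0 := by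
  rw [realize_apply, ← counit_apply]; exact x.2

theorem realize_congr (x : WQSym K) {v w : List ℕ} (h : pack v = pack w) :
    realize K x v = realize K x w := by
  rw [realize_apply, realize_apply, toPacked_eq_toPacked_iff.2 h]

theorem plus_ext {x y : plus K} (h : ∀ w, realize K (x : WQSym K) w = realize K (y : WQSym K) w) :
    x = y := Subtype.ext (realize_injective K (funext h))

/-- A product whose first factor is some `M_u` with `u` nonempty involves nonempty words only, so
the projection in the definition changes nothing. -/
theorem coe_partialProd (c : ℕ → ℕ → Prop) (x y : plus K) :
    ((partialProd K c x y : plus K) : WQSym K) = convProd K c x y := by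
  have h0 : counit K (convProd K c x y) = 0 := by
    have aux : ∀ u v : PackedWord, u.1 ≠ [] → convProd K c (M K u) (M K v) ∈ plus K := by
      intro u v hu
      rw [convProd, lift_M, lift_M]
      refine Submodule.sum_mem _ fun p hp => M_mem_plus K fun h => hu ?_
      simp only [convolution, Finset.mem_filter, mem_packedWords, h, List.length_nil] at hp
      exact List.length_eq_zero_iff.1 (by omega)
    have hx : (x : WQSym K) (toPacked []) = 0 := by rw [← counit_apply]; exact x.2
    change convProd K c x y ∈ plus K
    rw [eq_sum_M K (x : WQSym K), eq_sum_M K (y : WQSym K)]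
    simp only [map_sum, map_smul, LinearMap.sum_apply, LinearMap.smul_apply]
    refine Submodule.sum_mem _ fun v _ => Submodule.smul_mem _ _
      (Submodule.sum_mem _ fun u hu => Submodule.smul_mem _ _ (aux u v ?_))
    intro h
    rw [Finsupp.mem_support_iff] at hu
    exact hu ((Subtype.ext h : u = toPacked []) ▸ hx)
  change convProd K c x y - counit K (convProd K c x y) • M K (toPacked []) = _
  rw [h0, zero_smul, sub_zero]

open scoped Classical in
theorem realize_partialProd_apply {c : ℕ → ℕ → Prop} (hc : IsOrderCond c) (x y : plus K)
    (w : List ℕ) : realize K (partialProd K c x y : WQSym K) w =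
      splitSum (fun v v' => if c (maxLetter v) (maxLetter v') then
        realize K (x : WQSym K) v * realize K (y : WQSym K) v' else 0) w := by
  rw [realize_partialProd K c hc, concatProd_eq_splitSum]

theorem realize_mul_apply (x y : WQSym K) (w : List ℕ) :
    realize K ((ops K).mul x y) w =
      splitSum (fun v v' => realize K x v * realize K y v') w := by
  classical
  rw [realize_mul, concatProd_eq_splitSum]
  simp

theorem partialProd_add {c c' d : ℕ → ℕ → Prop} (hc : IsOrderCond c) (hc' : IsOrderCond c')
    (hd : IsOrderCond d) (h : ∀ a b, d a b ↔ c a b ∨ c' a b) (h' : ∀ a b, ¬ (c a b ∧ c' a b)) :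
    partialProd K c + partialProd K c' = partialProd K d := by
  classical
  refine LinearMap.ext fun x => LinearMap.ext fun y => plus_ext K fun w => ?_
  simp only [LinearMap.add_apply, Submodule.coe_add, map_add, Pi.add_apply]
  rw [realize_partialProd_apply K hc, realize_partialProd_apply K hc',
    realize_partialProd_apply K hd, ← splitSum_add]
  refine splitSum_congr fun v v' _ => ?_
  have h1 := h (maxLetter v) (maxLetter v')
  have h2 := h' (maxLetter v) (maxLetter v')
  split_ifs <;> simp_all

theorem partialProd_eq_add_lt :
    partialProd K (fun a b => b = a) + partialProd K (fun a b => a < b) =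
      partialProd K (fun a b => a ≤ b) :=
  partialProd_add K isOrderCond_eq isOrderCond_lt isOrderCond_le
    (fun a b => by omega) (fun a b => by omega)

theorem partialProd_gt_add_le :
    partialProd K (fun a b => b < a) + partialProd K (fun a b => a ≤ b) =
      partialProd K (fun _ _ => True) :=
  partialProd_add K isOrderCond_gt isOrderCond_le isOrderCond_true
    (fun a b => by simpa using lt_or_ge b a) (fun a b => by omega)

theorem partialProd_gt_add_eq_add_lt :
    partialProd K (fun a b => b < a) + partialProd K (fun a b => b = a) +
      partialProd K (fun a b => a < b) = partialProd K (fun _ _ => True) := by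
  rw [add_assoc, partialProd_eq_add_lt, partialProd_gt_add_le]

/-- Both sides are sums over factorizations into three factors, and the maximum of a concatenation
is the larger of the two maxima. So only the conditions on the three maxima `i`, `j`, `k` have to be
compared; every trialgebra and dialgebra axiom is an instance. -/
theorem partialProd_assoc {c₁ c₂ d₁ d₂ : ℕ → ℕ → Prop} (hc₁ : IsOrderCond c₁) (hc₂ : IsOrderCond c₂)
    (hd₁ : IsOrderCond d₁) (hd₂ : IsOrderCond d₂)
    (h : ∀ i j k, (c₂ i j ∧ c₁ (max i j) k) ↔ (d₁ i (max j k) ∧ d₂ j k)) (x y z : plus K) :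
    partialProd K c₁ (partialProd K c₂ x y) z = partialProd K d₁ x (partialProd K d₂ y z) := by
  classical
  refine plus_ext K fun w => ?_
  rw [realize_partialProd_apply K hc₁, realize_partialProd_apply K hd₁]
  simp only [realize_partialProd_apply K hc₂, realize_partialProd_apply K hd₂, splitSum_mul_right,
    splitSum_mul_left, splitSum_ite]
  have key := splitSum_assoc (fun v₁ v₂ v₃ =>
    if c₂ (maxLetter v₁) (maxLetter v₂) ∧ c₁ (max (maxLetter v₁) (maxLetter v₂)) (maxLetter v₃) then
      realize K (x : WQSym K) v₁ * realize K (y : WQSym K) v₂ * realize K (z : WQSym K) v₃ else 0) w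
  refine Eq.trans (splitSum_congr fun v v₃ _ => splitSum_congr fun v₁ v₂ hv => ?_)
    (key.trans (splitSum_congr fun v₁ v _ => splitSum_congr fun v₂ v₃ hv => ?_))
  · rw [← hv, maxLetter_append]
    split_ifs <;> simp_all
  · rw [← hv, maxLetter_append, if_congr (h _ _ _) rfl rfl]
    split_ifs <;> simp_all [mul_assoc]

theorem isDendriformTrialgebra : IsDendriformTrialgebra (K := K) (V := plus K) (partialProd K fun a b => b < a)
    (partialProd K fun a b => b = a) (partialProd K fun a b => a < b) where
  mid_assoc := partialProd_assoc K isOrderCond_eq isOrderCond_eq isOrderCond_eq isOrderCond_eq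
    fun i j k => by omega
  left_left := by
    rw [partialProd_gt_add_eq_add_lt]
    exact partialProd_assoc K isOrderCond_gt isOrderCond_gt isOrderCond_gt isOrderCond_true
      fun i j k => by simp only [and_true]; omega
  right_left := partialProd_assoc K isOrderCond_gt isOrderCond_lt isOrderCond_lt isOrderCond_gt
    fun i j k => by omega
  mul_right := by
    rw [partialProd_gt_add_eq_add_lt]
    exact partialProd_assoc K isOrderCond_lt isOrderCond_true isOrderCond_lt isOrderCond_lt
      fun i j k => by simp only [true_and]; omega
  right_mid := partialProd_assoc K isOrderCond_eq isOrderCond_lt isOrderCond_lt isOrderCond_eq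
    fun i j k => by omega
  left_mid := partialProd_assoc K isOrderCond_eq isOrderCond_gt isOrderCond_eq isOrderCond_lt
    fun i j k => by omega
  mid_left := partialProd_assoc K isOrderCond_gt isOrderCond_eq isOrderCond_eq isOrderCond_gt
    fun i j k => by omega

theorem isTridendriform : (ops K).IsTridendriform where
  laws := isDendriformTrialgebra K
  mul_eq x y := by
    have h := congrArg (fun f => ((f x y : plus K) : WQSym K)) (partialProd_gt_add_eq_add_lt K)
    exact (coe_partialProd K _ x y).symm.trans h.symm

theorem isDendriformDialgebra : IsDendriformDialgebra (K := K) (V := plus K) (partialProd K fun a b => b < a)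
    (partialProd K fun a b => a ≤ b) where
  left_left := by
    rw [partialProd_gt_add_le]
    exact partialProd_assoc K isOrderCond_gt isOrderCond_gt isOrderCond_gt isOrderCond_true
      fun i j k => by simp only [and_true]; omega
  right_left := partialProd_assoc K isOrderCond_gt isOrderCond_le isOrderCond_le isOrderCond_gt
    fun i j k => by omega
  mul_right := by
    rw [partialProd_gt_add_le]
    exact partialProd_assoc K isOrderCond_le isOrderCond_true isOrderCond_le isOrderCond_le
      fun i j k => by simp only [true_and]; omega

theorem mul_assoc' (x y z : WQSym K) :
    (ops K).mul ((ops K).mul x y) z = (ops K).mul x ((ops K).mul y z) := by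
  refine realize_injective K (funext fun w => ?_)
  simp only [realize_mul_apply, splitSum_mul_right, splitSum_mul_left]
  rw [splitSum_assoc]
  simp only [mul_assoc]

theorem realize_one (w : List ℕ) : realize K (ops K).one w = if w = [] then 1 else 0 := by
  change realize K (M K (toPacked [])) w = _
  rw [realize_M]
  exact if_congr (by rw [toPacked_val, pack_nil, pack_eq_nil]) rfl rfl

theorem one_mul' (x : WQSym K) : (ops K).mul (ops K).one x = x := by
  refine realize_injective K (funext fun w => ?_)
  simp only [realize_mul_apply, realize_one, ite_mul, one_mul, zero_mul]
  exact splitSum_ite_left _ _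

theorem mul_one' (x : WQSym K) : (ops K).mul x (ops K).one = x := by
  refine realize_injective K (funext fun w => ?_)
  simp only [realize_mul_apply, realize_one, mul_ite, mul_one, mul_zero]
  exact splitSum_ite_right _ _

theorem counit_eq_realize (x : WQSym K) : (ops K).counit x = realize K x [] := by
  rw [realize_apply]; exact counit_apply K x

theorem counit_mul' (x y : WQSym K) :
    (ops K).counit ((ops K).mul x y) = (ops K).counit x * (ops K).counit y := by
  simp [counit_eq_realize, realize_mul_apply, splitSum]

theorem counit_one' : (ops K).counit (ops K).one = 1 := by
  simp [counit_eq_realize, realize_one]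

end WQSym

namespace WQSym

variable (K : Type u) [Field K]

/-! ### The coproduct and its two halves -/

/-- The basis element `M_u` for `u` nonempty, and `0` for `u` empty, in the augmentation ideal. -/
def MPlus (u : PackedWord) : plus K := proj K (M K u)

variable {K} in
theorem hom_ext_M {V : Type*} [AddCommMonoid V] [Module K V] {f g : WQSym K →ₗ[K] V}
    (h : ∀ u, f (M K u) = g (M K u)) : f = g :=
  Finsupp.lhom_ext' fun u => LinearMap.ext_ring (h u)

variable {K} in
-- The projection `proj` restricts to the identity on the augmentation ideal and kills the unit, so
-- maps can be compared after composing with it, on the basis of all of WQSym.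
theorem hom_ext_MPlus {V : Type*} [AddCommMonoid V] [Module K V] {f g : plus K →ₗ[K] V}
    (h : ∀ u : PackedWord, u.1 ≠ [] → f (MPlus K u) = g (MPlus K u)) : f = g := by
  have h1 : f ∘ₗ proj K = g ∘ₗ proj K := by
    refine hom_ext_M fun u => ?_
    by_cases hu : u.1 = []
    · have : u = toPacked [] := Subtype.ext hu
      rw [LinearMap.comp_apply, LinearMap.comp_apply, this, proj_one, map_zero, map_zero]
    · exact h u hu
  refine LinearMap.ext fun x => ?_
  have h2 := LinearMap.congr_fun h1 (x : WQSym K)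
  rwa [LinearMap.comp_apply, LinearMap.comp_apply, proj_coe] at h2

theorem comul_M (w : PackedWord) : comul K (M K w) =
    ∑ k ∈ Finset.range (maxLetter w.1 + 1), M K (lower w k) ⊗ₜ[K] M K (upper w k) := by
  rw [comul, lift_M]

theorem lower_eq_nil_iff {w : PackedWord} {k : ℕ} (hk : k ≤ maxLetter w.1) :
    (lower w k).1 = [] ↔ k = 0 := by
  have h := maxLetter_lower w hk
  constructor
  · intro h'
    rw [h', maxLetter_nil] at h
    exact h.symm
  · rintro rfl
    rw [lower_val, List.filter_eq_nil_iff]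
    intro a ha
    have := ((mem_packed_iff w.2).1 ha).1
    simp only [decide_eq_true_eq]; omega

theorem upper_eq_nil_iff {w : PackedWord} {k : ℕ} (hk : k ≤ maxLetter w.1) :
    (upper w k).1 = [] ↔ k = maxLetter w.1 := by
  have h := maxLetter_upper w hk
  constructor
  · intro h'
    rw [h', maxLetter_nil] at h
    omega
  · rintro rfl
    rw [upper_val, List.map_eq_nil_iff, List.filter_eq_nil_iff]
    intro a ha
    have := ((mem_packed_iff w.2).1 ha).2
    simp only [decide_eq_true_eq]; omega

theorem upper_zero (w : PackedWord) : upper w 0 = w := by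
  apply Subtype.ext
  rw [upper_val, List.filter_eq_self.2, ← List.map_id w.1, List.map_map]
  · rfl
  · intro a ha
    have := ((mem_packed_iff w.2).1 ha).1
    simp only [decide_eq_true_eq]; omega

theorem lower_maxLetter (w : PackedWord) : lower w (maxLetter w.1) = w := by
  apply Subtype.ext
  rw [lower_val, List.filter_eq_self.2]
  intro a ha
  simpa using le_maxLetter ha

theorem sum_counit_lower (w : PackedWord) :
    ∑ k ∈ Finset.range (maxLetter w.1 + 1), counit K (M K (lower w k)) • M K (upper w k) =
      M K w := by
  rw [Finset.sum_eq_single 0]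
  · rw [counit_M, if_pos ((lower_eq_nil_iff (Nat.zero_le _)).2 rfl), one_smul, upper_zero]
  · intro k hk h0
    rw [counit_M, if_neg (mt (lower_eq_nil_iff (Nat.lt_succ_iff.1 (Finset.mem_range.1 hk))).1 h0),
      zero_smul]
  · simp

theorem sum_counit_upper (w : PackedWord) :
    ∑ k ∈ Finset.range (maxLetter w.1 + 1), counit K (M K (upper w k)) • M K (lower w k) =
      M K w := by
  rw [Finset.sum_eq_single (maxLetter w.1)]
  · rw [counit_M, if_pos ((upper_eq_nil_iff le_rfl).2 rfl), one_smul, lower_maxLetter]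
  · intro k hk h0
    rw [counit_M, if_neg (mt (upper_eq_nil_iff (Nat.lt_succ_iff.1 (Finset.mem_range.1 hk))).1 h0),
      zero_smul]
  · simp

theorem rTensor_counit_comul (x : WQSym K) :
    (counit K).rTensor (WQSym K) (comul K x) = 1 ⊗ₜ[K] x := by
  suffices h : (counit K).rTensor (WQSym K) ∘ₗ comul K = TensorProduct.mk K K (WQSym K) 1 from
    LinearMap.congr_fun h x
  refine hom_ext_M fun w => ?_
  rw [LinearMap.comp_apply, comul_M, map_sum]
  simp only [LinearMap.rTensor_tmul, TensorProduct.mk_apply]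
  conv_rhs => rw [← sum_counit_lower K w, TensorProduct.tmul_sum]
  refine Finset.sum_congr rfl fun k _ => ?_
  rw [TensorProduct.tmul_smul, TensorProduct.smul_tmul', smul_eq_mul, mul_one]

theorem lTensor_counit_comul (x : WQSym K) :
    (counit K).lTensor (WQSym K) (comul K x) = x ⊗ₜ[K] 1 := by
  suffices h : (counit K).lTensor (WQSym K) ∘ₗ comul K =
      (TensorProduct.mk K (WQSym K) K).flip 1 from LinearMap.congr_fun h x
  refine hom_ext_M fun w => ?_
  rw [LinearMap.comp_apply, comul_M, map_sum]
  simp only [LinearMap.lTensor_tmul, TensorProduct.mk_apply, LinearMap.flip_apply]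
  conv_rhs => rw [← sum_counit_upper K w, TensorProduct.sum_tmul]
  refine Finset.sum_congr rfl fun k _ => ?_
  rw [← TensorProduct.smul_tmul', ← TensorProduct.tmul_smul, smul_eq_mul, mul_one]

/-- Double cuts `j ≤ k`, listed by the upper cut first, or by the lower cut first together with the
gap `i = k - j`. -/
theorem sum_range_cut_twice {A : Type*} [AddCommMonoid A] (m : ℕ) (G : ℕ → ℕ → A) :
    ∑ k ∈ Finset.range (m + 1), ∑ j ∈ Finset.range (k + 1), G j k =
      ∑ j ∈ Finset.range (m + 1), ∑ i ∈ Finset.range (m - j + 1), G j (j + i) := by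
  have h := Finset.sum_range_diag_flip (m + 1) (fun j i => G j (j + i))
  rw [show (∑ k ∈ Finset.range (m + 1), ∑ j ∈ Finset.range (k + 1), G j k) =
    ∑ k ∈ Finset.range (m + 1), ∑ j ∈ Finset.range (k + 1), G j (j + (k - j)) from ?_, h]
  · refine Finset.sum_congr rfl fun j hj => ?_
    rw [Nat.succ_sub (Nat.lt_succ_iff.1 (Finset.mem_range.1 hj))]
  · refine Finset.sum_congr rfl fun k _ => Finset.sum_congr rfl fun j hj => ?_
    rw [Finset.mem_range] at hj
    rw [Nat.add_sub_cancel' (by omega)]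

theorem coassoc (x : WQSym K) :
    TensorProduct.assoc K _ _ _ ((comul K).rTensor (WQSym K) (comul K x)) =
      (comul K).lTensor (WQSym K) (comul K x) := by
  suffices h : (TensorProduct.assoc K (WQSym K) (WQSym K) (WQSym K)).toLinearMap ∘ₗ
      (comul K).rTensor (WQSym K) ∘ₗ comul K = (comul K).lTensor (WQSym K) ∘ₗ comul K from
    LinearMap.congr_fun h x
  refine hom_ext_M fun w => ?_
  simp only [LinearMap.comp_apply, comul_M, map_sum, LinearMap.rTensor_tmul, LinearMap.lTensor_tmul,
    LinearEquiv.coe_coe, TensorProduct.sum_tmul, TensorProduct.tmul_sum, TensorProduct.assoc_tmul]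
  refine Eq.trans (Finset.sum_congr rfl fun k hk => ?_)
    ((sum_range_cut_twice (maxLetter w.1) fun j k =>
      M K (lower w j) ⊗ₜ[K] (M K (upper (lower w k) j) ⊗ₜ[K] M K (upper w k))).trans
        (Finset.sum_congr rfl fun j hj => ?_))
  · rw [Finset.mem_range] at hk
    rw [maxLetter_lower w (by omega)]
    refine Finset.sum_congr rfl fun j hj => ?_
    rw [Finset.mem_range] at hj
    rw [lower_lower w (by omega)]
  · rw [Finset.mem_range] at hj
    rw [maxLetter_upper w (by omega)]
    exact Finset.sum_congr rfl fun i _ => by rw [lower_upper, upper_upper]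

/-- The cuts at `0` and at the maximum need not be excluded: one of their two pieces is empty, and
`MPlus` vanishes on the empty word. -/
theorem halfComul_MPlus (c : ℕ → ℕ → Prop) [DecidableRel c] (w : PackedWord) :
    halfComul K c (MPlus K w) = ∑ k ∈ Finset.range (maxLetter w.1 + 1),
      if c (w.1.getLastD 0) k then MPlus K (lower w k) ⊗ₜ[K] MPlus K (upper w k) else 0 := by
  rw [← Finset.sum_filter]
  by_cases hw : w.1 = []
  · have h : w = toPacked [] := Subtype.ext hw
    have h0 : MPlus K w = 0 := by rw [MPlus, h, proj_one]
    rw [h0, map_zero, Finset.sum_eq_zero]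
    intro k hk
    have : lower w k = toPacked [] := Subtype.ext (by rw [lower_val, hw]; rfl)
    rw [this, MPlus, proj_one, TensorProduct.zero_tmul]
  · rw [halfComul, LinearMap.domRestrict_apply, MPlus, coe_proj_M K hw, lift_M]
    rfl

theorem halfComul_add {c c' d : ℕ → ℕ → Prop} [DecidableRel c] [DecidableRel c'] [DecidableRel d]
    (h : ∀ a b, d a b ↔ c a b ∨ c' a b) (h' : ∀ a b, ¬ (c a b ∧ c' a b)) :
    halfComul K c + halfComul K c' = halfComul K d := by
  refine hom_ext_MPlus fun w _ => ?_
  rw [LinearMap.add_apply, halfComul_MPlus, halfComul_MPlus, halfComul_MPlus,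
    ← Finset.sum_add_distrib]
  refine Finset.sum_congr rfl fun k _ => ?_
  have h1 := h (w.1.getLastD 0) k
  have h2 := h' (w.1.getLastD 0) k
  split_ifs <;> simp_all

theorem halfComul_le_add_gt : halfComul K (fun a k => a ≤ k) + halfComul K (fun a k => k < a) =
    halfComul K (fun _ _ => True) :=
  halfComul_add K (fun a b => by simpa using le_or_gt a b) (fun a b => by omega)

/-- The pieces of a double cut do not depend on which cut is made first. What remains to be matched
is the selection of double cuts by the last letter, and this is the hypothesis `h`. -/
theorem halfComul_coassoc {c₁ c₂ d₁ d₂ : ℕ → ℕ → Prop} [DecidableRel c₁] [DecidableRel c₂]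
    [DecidableRel d₁] [DecidableRel d₂]
    (h : ∀ w : PackedWord, w.1 ≠ [] → ∀ j k, j ≤ k →
      ((c₂ (w.1.getLastD 0) k ∧ c₁ ((lower w k).1.getLastD 0) j) ↔
        (d₂ (w.1.getLastD 0) j ∧ d₁ ((upper w j).1.getLastD 0) (k - j)))) (x : plus K) :
    TensorProduct.assoc K _ _ _ ((halfComul K c₁).rTensor (plus K) (halfComul K c₂ x)) =
      (halfComul K d₁).lTensor (plus K) (halfComul K d₂ x) := by
  suffices h : (TensorProduct.assoc K (plus K) (plus K) (plus K)).toLinearMap ∘ₗ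
      (halfComul K c₁).rTensor (plus K) ∘ₗ halfComul K c₂ =
        (halfComul K d₁).lTensor (plus K) ∘ₗ halfComul K d₂ from
    LinearMap.congr_fun h x
  refine hom_ext_MPlus fun w hw => ?_
  simp only [LinearMap.comp_apply, halfComul_MPlus, map_sum, apply_ite, map_zero,
    LinearMap.rTensor_tmul, LinearMap.lTensor_tmul, LinearEquiv.coe_coe, TensorProduct.sum_tmul,
    TensorProduct.tmul_sum]
  simp only [TensorProduct.ite_tmul, apply_ite, map_zero, TensorProduct.assoc_tmul,
    TensorProduct.tmul_zero]
  refine Eq.trans (Finset.sum_congr rfl fun k hk => ?_)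
    ((sum_range_cut_twice (maxLetter w.1) fun j k =>
      if c₂ (w.1.getLastD 0) k ∧ c₁ ((lower w k).1.getLastD 0) j then
        MPlus K (lower w j) ⊗ₜ[K] (MPlus K (upper (lower w k) j) ⊗ₜ[K] MPlus K (upper w k))
      else 0).trans (Finset.sum_congr rfl fun j hj => ?_))
  · rw [Finset.mem_range] at hk
    rw [maxLetter_lower w (by omega)]
    by_cases h2 : c₂ (w.1.getLastD 0) k
    · rw [if_pos h2]
      refine Finset.sum_congr rfl fun j hj => ?_
      rw [Finset.mem_range] at hj
      rw [lower_lower w (by omega)]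
      simp only [h2, true_and]
    · simp only [h2, false_and, if_false, Finset.sum_const_zero]
  · rw [Finset.mem_range] at hj
    rw [maxLetter_upper w (by omega)]
    by_cases h2 : d₂ (w.1.getLastD 0) j
    · rw [if_pos h2]
      refine Finset.sum_congr rfl fun i _ => ?_
      rw [if_congr (h w hw j (j + i) (by omega)) rfl rfl, lower_upper, upper_upper]
      simp only [h2, true_and, Nat.add_sub_cancel_left]
    · rw [if_neg h2]
      refine Finset.sum_eq_zero fun i _ => ?_
      rw [if_congr (h w hw j (j + i) (by omega)) rfl rfl]
      simp only [h2, false_and, if_false]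

theorem getLastD_lower {w : PackedWord} (hw : w.1 ≠ []) {k : ℕ} (h : w.1.getLastD 0 ≤ k) :
    (lower w k).1.getLastD 0 = w.1.getLastD 0 := by
  rw [lower_val]
  exact getLastD_filter hw (by simpa using h) 0

theorem getLastD_upper {w : PackedWord} (hw : w.1 ≠ []) {k : ℕ} (h : k < w.1.getLastD 0) :
    (upper w k).1.getLastD 0 = w.1.getLastD 0 - k := by
  rw [upper_val, getLastD_map _ (d := 0), getLastD_filter hw (by simpa using h) 0]
  exact List.ne_nil_of_mem (List.mem_filter.2 ⟨getLastD_mem hw 0, by simpa using h⟩)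

/-- The three axioms correspond to the position of the last letter of the word: in the lowest, the
middle or the highest of the three pieces. -/
theorem isCodendriformCoalgebra : IsCodendriformCoalgebra (K := K) (V := plus K)
    (halfComul K fun a k => a ≤ k) (halfComul K fun a k => k < a) where
  left_left := by
    rw [halfComul_le_add_gt]
    refine halfComul_coassoc K fun w hw j k hjk => ?_
    by_cases h : w.1.getLastD 0 ≤ k
    · rw [getLastD_lower hw h]; simp only [and_true]; omega
    · simp only [and_true]; omega
  right_left := by
    refine halfComul_coassoc K fun w hw j k hjk => ?_
    by_cases h : w.1.getLastD 0 ≤ k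
    · rw [getLastD_lower hw h]
      by_cases h' : j < w.1.getLastD 0
      · rw [getLastD_upper hw h']; omega
      · omega
    · by_cases h' : j < w.1.getLastD 0
      · rw [getLastD_upper hw h']; omega
      · omega
  mul_right := by
    rw [halfComul_le_add_gt]
    refine halfComul_coassoc K fun w hw j k hjk => ?_
    by_cases h' : j < w.1.getLastD 0
    · rw [getLastD_upper hw h']; simp only [and_true]; omega
    · simp only [and_true]; omega

theorem comul_eq_halfComul (x : plus K) : comul K (x : WQSym K) =
    TensorProduct.map (plus K).subtype (plus K).subtype (halfComul K (fun _ _ => True) x) +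
      (x : WQSym K) ⊗ₜ[K] M K (toPacked []) + M K (toPacked []) ⊗ₜ[K] (x : WQSym K) := by
  suffices h : comul K ∘ₗ (plus K).subtype =
      TensorProduct.map (plus K).subtype (plus K).subtype ∘ₗ halfComul K (fun _ _ => True) +
      (TensorProduct.mk K _ _).flip (M K (toPacked [])) ∘ₗ (plus K).subtype +
      TensorProduct.mk K _ _ (M K (toPacked [])) ∘ₗ (plus K).subtype from LinearMap.congr_fun h x
  refine hom_ext_MPlus fun w hw => ?_
  have h1 := sum_counit_lower K w
  have h2 := sum_counit_upper K w
  have h3 := congrArg (counit K) h1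
  rw [map_sum, counit_M, if_neg hw] at h3
  simp only [map_smul, smul_eq_mul] at h3
  have h0 : ((MPlus K w : plus K) : WQSym K) = M K w := coe_proj_M K hw
  simp only [LinearMap.add_apply, LinearMap.comp_apply, Submodule.subtype_apply, h0,
    LinearMap.flip_apply, TensorProduct.mk_apply, halfComul_MPlus, if_true, map_sum,
    TensorProduct.map_tmul, comul_M]
  simp only [MPlus, coe_proj]
  have e1 : ∑ k ∈ Finset.range (maxLetter w.1 + 1),
      (counit K (M K (lower w k)) • M K (toPacked [])) ⊗ₜ[K] M K (upper w k) =
      M K (toPacked []) ⊗ₜ[K] M K w := by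
    conv_rhs => rw [← h1, TensorProduct.tmul_sum]
    exact Finset.sum_congr rfl fun k _ => by rw [TensorProduct.smul_tmul]
  have e2 : ∑ k ∈ Finset.range (maxLetter w.1 + 1),
      M K (lower w k) ⊗ₜ[K] (counit K (M K (upper w k)) • M K (toPacked [])) =
      M K w ⊗ₜ[K] M K (toPacked []) := by
    conv_rhs => rw [← h2, TensorProduct.sum_tmul]
    exact Finset.sum_congr rfl fun k _ => by rw [← TensorProduct.smul_tmul]
  -- Applying the counit to both tensor factors of `Δ M_w` gives the counit of `M_w`, which is zero
  -- because `w` is nonempty.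
  have e3 : ∑ k ∈ Finset.range (maxLetter w.1 + 1),
      (counit K (M K (lower w k)) • M K (toPacked [])) ⊗ₜ[K]
        (counit K (M K (upper w k)) • M K (toPacked [])) = 0 := by
    simp only [TensorProduct.tmul_smul, ← TensorProduct.smul_tmul', smul_smul]
    rw [← Finset.sum_smul]
    simp only [mul_comm (counit K (M K (upper w _)))]
    rw [h3, zero_smul]
  have key : ∀ k, M K (lower w k) ⊗ₜ[K] M K (upper w k) +
      (counit K (M K (lower w k)) • M K (toPacked [])) ⊗ₜ[K]
        (counit K (M K (upper w k)) • M K (toPacked [])) =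
      (M K (lower w k) - counit K (M K (lower w k)) • M K (toPacked [])) ⊗ₜ[K]
        (M K (upper w k) - counit K (M K (upper w k)) • M K (toPacked [])) +
      M K (lower w k) ⊗ₜ[K] (counit K (M K (upper w k)) • M K (toPacked [])) +
      (counit K (M K (lower w k)) • M K (toPacked [])) ⊗ₜ[K] M K (upper w k) := by
    intro k
    rw [TensorProduct.sub_tmul, TensorProduct.tmul_sub, TensorProduct.tmul_sub]
    abel
  have hsum := Finset.sum_congr (rfl : Finset.range (maxLetter w.1 + 1) = _) fun k _ => key k
  rwa [Finset.sum_add_distrib, Finset.sum_add_distrib, Finset.sum_add_distrib, e1, e2, e3,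
    add_zero] at hsum

theorem comul_one' : (ops K).comul (ops K).one = (ops K).one ⊗ₜ[K] (ops K).one := by
  change comul K (M K (toPacked [])) = M K (toPacked []) ⊗ₜ[K] M K (toPacked [])
  rw [comul_M]
  have h : maxLetter (toPacked []).1 = 0 := rfl
  rw [h, Finset.sum_range_one, upper_zero]
  rfl

end WQSym

/-! ### Sums over shuffles -/

section ShuffleSum

variable {A : Type*} [AddCommMonoid A]

/-- The sum of `F r` over all shuffles `r` of two words. -/
def shuffleSum (F : List ℕ → A) : List ℕ → List ℕ → A
  | [], q => F q
  | a :: p, [] => F (a :: p)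
  | a :: p, b :: q => shuffleSum (fun w => F (a :: w)) p (b :: q) +
      shuffleSum (fun w => F (b :: w)) (a :: p) q
termination_by p q => p.length + q.length

theorem shuffleSum_nil_left (F : List ℕ → A) (q : List ℕ) : shuffleSum F [] q = F q := by
  rw [shuffleSum]

theorem shuffleSum_nil_right (F : List ℕ → A) (p : List ℕ) : shuffleSum F p [] = F p := by
  cases p <;> rw [shuffleSum]

theorem shuffleSum_cons_cons (F : List ℕ → A) (a b : ℕ) (p q : List ℕ) :
    shuffleSum F (a :: p) (b :: q) = shuffleSum (fun w => F (a :: w)) p (b :: q) +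
      shuffleSum (fun w => F (b :: w)) (a :: p) q := by
  rw [shuffleSum]

/-- Induction on a pair of words along the recursion that defines shuffles. -/
theorem shuffle_induction {P : List ℕ → List ℕ → Prop} (nil_left : ∀ q, P [] q)
    (nil_right : ∀ p, P p [])
    (cons_cons : ∀ a p b q, P p (b :: q) → P (a :: p) q → P (a :: p) (b :: q)) (p q : List ℕ) :
    P p q := by
  induction p generalizing q with
  | nil => exact nil_left q
  | cons a p ihp =>
    induction q with
    | nil => exact nil_right _
    | cons b q ihq => exact cons_cons a p b q (ihp _) ihq

theorem shuffleSum_add (F G : List ℕ → A) (p q : List ℕ) :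
    shuffleSum (fun w => F w + G w) p q = shuffleSum F p q + shuffleSum G p q := by
  induction p, q using shuffle_induction generalizing F G with
  | nil_left q => simp only [shuffleSum_nil_left]
  | nil_right p => simp only [shuffleSum_nil_right]
  | cons_cons a p b q ih ih' =>
    simp only [shuffleSum_cons_cons, ih, ih']
    exact add_add_add_comm _ _ _ _

theorem shuffleSum_zero (p q : List ℕ) : shuffleSum (fun _ => (0 : A)) p q = 0 := by
  induction p, q using shuffle_induction with
  | nil_left q => simp only [shuffleSum_nil_left]
  | nil_right p => simp only [shuffleSum_nil_right]
  | cons_cons a p b q ih ih' => rw [shuffleSum_cons_cons, ih, ih', add_zero]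

theorem shuffleSum_smul {R : Type*} [DistribSMul R A] (k : R) (F : List ℕ → A)
    (p q : List ℕ) : k • shuffleSum F p q = shuffleSum (fun w => k • F w) p q := by
  induction p, q using shuffle_induction generalizing F with
  | nil_left q => simp only [shuffleSum_nil_left]
  | nil_right p => simp only [shuffleSum_nil_right]
  | cons_cons a p b q ih ih' => rw [shuffleSum_cons_cons, shuffleSum_cons_cons, smul_add, ih, ih']

theorem shuffleSum_mul_right {K : Type*} [Semiring K] (F : List ℕ → K) (k : K) (p q : List ℕ) :
    shuffleSum F p q * k = shuffleSum (fun w => F w * k) p q := by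
  induction p, q using shuffle_induction generalizing F with
  | nil_left q => simp only [shuffleSum_nil_left]
  | nil_right p => simp only [shuffleSum_nil_right]
  | cons_cons a p b q ih ih' => rw [shuffleSum_cons_cons, shuffleSum_cons_cons, add_mul, ih, ih']

/-- Cutting a shuffle of `p` and `q` also cuts `p` and `q`, and leaves a shuffle of the two initial
pieces and a shuffle of the two final pieces. This compatibility of shuffling with deconcatenation
is the source of all the bialgebra relations. -/
theorem shuffleSum_splitSum (G : List ℕ → List ℕ → A) (p q : List ℕ) :
    shuffleSum (splitSum G) p q = splitSum (fun p₁ p₂ => splitSum (fun q₁ q₂ =>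
      shuffleSum (fun w₁ => shuffleSum (fun w₂ => G w₁ w₂) p₂ q₂) p₁ q₁) q) p := by
  induction p, q using shuffle_induction generalizing G with
  | nil_left q => simp only [shuffleSum_nil_left, splitSum]
  | nil_right p => simp only [shuffleSum_nil_right, splitSum]
  | cons_cons a p b q ih ih' =>
    have h1 := ih (fun x y => G (a :: x) y)
    have h2 := ih' (fun x y => G (b :: x) y)
    simp only [splitSum, splitSum_add, shuffleSum_nil_left, shuffleSum_nil_right,
      shuffleSum_cons_cons, shuffleSum_add] at h1 h2 ⊢
    rw [h1, h2]
    abel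

/-- All letters of `p` are `≤ N`, and all letters of `q` are `> N`. -/
def Separated (N : ℕ) (p q : List ℕ) : Prop := (∀ a ∈ p, a ≤ N) ∧ ∀ b ∈ q, N < b

/-- `r` is a shuffle of `p` and `q`, for words `p`, `q` separated by `N`. -/
def IsShuffle (N : ℕ) (p q r : List ℕ) : Prop :=
  r.filter (fun a => a ≤ N) = p ∧ r.filter (fun a => N < a) = q

theorem isShuffle_nil_left {N : ℕ} {q : List ℕ} (h : Separated N [] q) : IsShuffle N [] q q := by
  refine ⟨List.filter_eq_nil_iff.2 fun a ha => ?_, List.filter_eq_self.2 fun a ha => ?_⟩ <;>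
    have := h.2 a ha <;> simp only [decide_eq_true_eq] <;> omega

theorem isShuffle_nil_right {N : ℕ} {p : List ℕ} (h : Separated N p []) : IsShuffle N p [] p := by
  refine ⟨List.filter_eq_self.2 fun a ha => ?_, List.filter_eq_nil_iff.2 fun a ha => ?_⟩ <;>
    have := h.1 a ha <;> simp only [decide_eq_true_eq] <;> omega

theorem IsShuffle.cons_left {N a : ℕ} {p q r : List ℕ} (ha : a ≤ N) (h : IsShuffle N p q r) :
    IsShuffle N (a :: p) q (a :: r) := by
  refine ⟨?_, ?_⟩
  · rw [List.filter_cons_of_pos (by simpa using ha), h.1]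
  · rw [List.filter_cons_of_neg (by simpa using ha), h.2]

theorem IsShuffle.cons_right {N b : ℕ} {p q r : List ℕ} (hb : N < b) (h : IsShuffle N p q r) :
    IsShuffle N p (b :: q) (b :: r) := by
  refine ⟨?_, ?_⟩
  · rw [List.filter_cons_of_neg (by simpa using hb), h.1]
  · rw [List.filter_cons_of_pos (by simpa using hb), h.2]

theorem IsShuffle.mem_iff {N : ℕ} {p q r : List ℕ} (h : IsShuffle N p q r) (a : ℕ) :
    a ∈ r ↔ a ∈ p ∨ a ∈ q := by
  rw [← h.1, ← h.2, List.mem_filter, List.mem_filter]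
  simp only [decide_eq_true_eq]
  have := le_or_gt a N
  tauto

theorem IsShuffle.ne_nil {N : ℕ} {p q r : List ℕ} (h : IsShuffle N p q r) (hp : p ≠ []) :
    r ≠ [] := by
  rintro rfl
  exact hp h.1.symm

theorem shuffleSum_congr {N : ℕ} {p q : List ℕ} (hpq : Separated N p q) {F G : List ℕ → A}
    (h : ∀ r, IsShuffle N p q r → F r = G r) : shuffleSum F p q = shuffleSum G p q := by
  induction p, q using shuffle_induction generalizing F G with
  | nil_left q => simpa only [shuffleSum_nil_left] using h q (isShuffle_nil_left hpq)
  | nil_right p => simpa only [shuffleSum_nil_right] using h p (isShuffle_nil_right hpq)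
  | cons_cons a p b q ih ih' =>
    rw [shuffleSum_cons_cons, shuffleSum_cons_cons]
    congr 1
    · refine ih ⟨fun x hx => hpq.1 x (by simp [hx]), hpq.2⟩ fun r hr => h _ ?_
      exact hr.cons_left (hpq.1 a (by simp))
    · refine ih' ⟨hpq.1, fun x hx => hpq.2 x (by simp [hx])⟩ fun r hr => h _ ?_
      exact hr.cons_right (hpq.2 b (by simp))

/-- Comparison with `N` tells from which of the two words each letter of `s` must have been taken,
so `s` arises exactly once. -/
theorem shuffleSum_single {N : ℕ} {p q s : List ℕ} (hpq : Separated N p q)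
    (hs : IsShuffle N p q s) (y : A) : shuffleSum (fun r => if r = s then y else 0) p q = y := by
  induction s generalizing p q with
  | nil =>
    obtain ⟨rfl, rfl⟩ := hs
    simp [shuffleSum_nil_left]
  | cons c s ih =>
    by_cases hc : c ≤ N
    · have hp : p = c :: s.filter (fun a => a ≤ N) := by
        rw [← hs.1, List.filter_cons_of_pos (by simpa using hc)]
      have hq : q = s.filter (fun a => N < a) := by
        rw [← hs.2, List.filter_cons_of_neg (by simpa using hc)]
      have key := ih (p := s.filter (fun a => a ≤ N)) (q := q)
        ⟨fun x hx => hpq.1 x (by rw [hp]; simp [hx]), hpq.2⟩ ⟨rfl, hq.symm⟩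
      rw [hp]
      cases q with
      | nil =>
        rw [shuffleSum_nil_right] at key ⊢
        simpa using key
      | cons b q =>
        -- The shuffles that begin with the large letter `b` cannot equal `s`, whose first letter is
        -- small.
        have hb : b ≠ c := by
          have := hpq.2 b (by simp)
          omega
        rw [shuffleSum_cons_cons]
        simp only [List.cons.injEq, true_and, hb, false_and, if_false, shuffleSum_zero, add_zero]
        exact key
    · have hp : p = s.filter (fun a => a ≤ N) := by
        rw [← hs.1, List.filter_cons_of_neg (by simpa using hc)]
      have hq : q = c :: s.filter (fun a => N < a) := by
        rw [← hs.2, List.filter_cons_of_pos (by simpa using hc)]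
      have key := ih (p := p) (q := s.filter (fun a => N < a))
        ⟨hpq.1, fun x hx => hpq.2 x (by rw [hq]; simp [hx])⟩ ⟨hp.symm, rfl⟩
      rw [hq]
      cases p with
      | nil =>
        rw [shuffleSum_nil_left] at key ⊢
        simpa using key
      | cons a p =>
        have ha : a ≠ c := by
          have := hpq.1 a (by simp)
          omega
        rw [shuffleSum_cons_cons]
        simp only [List.cons.injEq, true_and, ha, false_and, if_false, shuffleSum_zero, zero_add]
        exact key

end ShuffleSum

/-! ### The coproduct as a sum over shuffles -/

theorem letterRank_eq_card_filter (r : List ℕ) (N : ℕ) :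
    letterRank r N = (r.filter (fun a => a ≤ N)).toFinset.card := by
  rw [letterRank, List.toFinset_filter]
  congr 1
  ext a
  simp

/-- The threshold `N` in a shuffle becomes a cut of its packed word, and the place of this cut
depends on `p` alone. -/
theorem IsShuffle.letterRank_eq {N : ℕ} {p q r : List ℕ} (h : IsShuffle N p q r) :
    letterRank r N = maxLetter (pack p) := by
  rw [letterRank_eq_card_filter, h.1, maxLetter_pack]

theorem IsShuffle.map_unrank_left {N : ℕ} {p q r : List ℕ} (h : IsShuffle N p q r) :
    ((pack r).filter (fun a => a ≤ letterRank r N)).map (unrank r) = p := by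
  rw [filter_pack, List.map_map, ← h.1]
  have : r.filter (fun a => decide (letterRank r a ≤ letterRank r N)) =
      r.filter (fun a => a ≤ N) :=
    List.filter_congr fun a ha => by simp [letterRank_le_letterRank_iff ha]
  rw [this]
  conv_rhs => rw [← List.map_id (r.filter _)]
  exact List.map_congr_left fun a ha => unrank_letterRank (List.mem_of_mem_filter ha)

theorem IsShuffle.map_unrank_right {N : ℕ} {p q r : List ℕ} (h : IsShuffle N p q r) :
    ((pack r).filter (fun a => letterRank r N < a)).map (unrank r) = q := by
  rw [filter_pack, List.map_map, ← h.2]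
  have : r.filter (fun a => decide (letterRank r N < letterRank r a)) =
      r.filter (fun a => N < a) :=
    List.filter_congr fun a ha => by
      simp only [decide_eq_decide]
      rw [← not_le, letterRank_le_letterRank_iff ha, not_le]
  rw [this]
  conv_rhs => rw [← List.map_id (r.filter _)]
  exact List.map_congr_left fun a ha => unrank_letterRank (List.mem_of_mem_filter ha)

/-- Both words are cut at the same rank, and `unrank` restores `p` below the cut and `q` above it.
So the two relabellings agree on every letter of the common packed word. -/
theorem IsShuffle.eq_of_pack_eq {N : ℕ} {p q r s : List ℕ} (hr : IsShuffle N p q r)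
    (hs : IsShuffle N p q s) (h : pack r = pack s) : r = s := by
  have h1 := hr.map_unrank_left.trans hs.map_unrank_left.symm
  have h2 := hr.map_unrank_right.trans hs.map_unrank_right.symm
  rw [h, hr.letterRank_eq, ← hs.letterRank_eq] at h1 h2
  rw [← map_unrank_pack r, ← map_unrank_pack s, h]
  refine List.map_congr_left fun a ha => ?_
  rcases le_or_gt a (letterRank s N) with hk | hk
  · exact List.map_inj_left.1 h1 a (List.mem_filter.2 ⟨ha, by simpa using hk⟩)
  · exact List.map_inj_left.1 h2 a (List.mem_filter.2 ⟨ha, by simpa using hk⟩)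

theorem unrank_mem {w : List ℕ} {a : ℕ} (ha : a ∈ pack w) : unrank w a ∈ w := by
  simp only [pack, List.mem_map] at ha
  obtain ⟨b, hb, rfl⟩ := ha
  rwa [unrank_letterRank hb]

theorem WQSym.exists_isShuffle {N : ℕ} {p q : List ℕ} (hpq : Separated N p q) {w : PackedWord}
    {k : ℕ} (hp : pack p = (WQSym.lower w k).1) (hq : pack q = (WQSym.upper w k).1) :
    ∃ r, IsShuffle N p q r ∧ pack r = w.1 := by
  rw [WQSym.lower_val] at hp
  rw [WQSym.upper_val] at hq
  -- Letters below the cut are relabelled by those of `p`, letters above it by those of `q`.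
  -- Separation by `N` makes the glued map increasing, so the relabelled word still packs to `w`.
  let f : ℕ → ℕ := fun a => if a ≤ k then unrank p a else unrank q (a - k)
  have hmp : ∀ a ∈ w.1, a ≤ k → a ∈ pack p := fun a ha hk => by
    rw [hp]; exact List.mem_filter.2 ⟨ha, by simpa using hk⟩
  have hmq : ∀ a ∈ w.1, k < a → a - k ∈ pack q := fun a ha hk => by
    rw [hq]; exact List.mem_map.2 ⟨a, List.mem_filter.2 ⟨ha, by simpa using hk⟩, rfl⟩
  have hf1 : ∀ a ∈ w.1, (f a ≤ N ↔ a ≤ k) := by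
    intro a ha
    by_cases hk : a ≤ k
    · simp only [f, hk, if_true, iff_true]
      exact hpq.1 _ (unrank_mem (hmp a ha hk))
    · simp only [f, hk, if_false, iff_false, not_le]
      exact hpq.2 _ (unrank_mem (hmq a ha (by omega)))
  have hmono : StrictMonoOn f {a | a ∈ w.1} := by
    intro a ha b hb hab
    have h1 := hf1 a ha
    have h2 := hf1 b hb
    by_cases hbk : b ≤ k
    · have hak : a ≤ k := by omega
      simp only [f, hbk, hak, if_true]
      exact strictMonoOn_unrank p (hmp a ha hak) (hmp b hb hbk) hab
    · by_cases hak : a ≤ k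
      · have := h1.2 hak
        have := mt h2.1 hbk
        omega
      · simp only [f, hbk, hak, if_false]
        exact strictMonoOn_unrank q (hmq a ha (by omega)) (hmq b hb (by omega)) (by omega)
  refine ⟨w.1.map f, ⟨?_, ?_⟩, (pack_map _ _ hmono).trans w.2⟩
  · rw [List.filter_map]
    have : w.1.filter ((fun a => decide (a ≤ N)) ∘ f) = w.1.filter (fun a => a ≤ k) :=
      List.filter_congr fun a ha => by simp [hf1 a ha]
    rw [this]
    conv_rhs => rw [← map_unrank_pack p, hp]
    refine List.map_congr_left fun a ha => ?_
    have : a ≤ k := by simpa using (List.mem_filter.1 ha).2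
    simp [f, this]
  · rw [List.filter_map]
    have : w.1.filter ((fun a => decide (N < a)) ∘ f) = w.1.filter (fun a => k < a) :=
      List.filter_congr fun a ha => by
        simp only [Function.comp, ← not_le, hf1 a ha]
    rw [this]
    conv_rhs => rw [← map_unrank_pack q, hq, List.map_map]
    refine List.map_congr_left fun a ha => ?_
    have : ¬ a ≤ k := by simpa using (List.mem_filter.1 ha).2
    simp [f, this]

namespace WQSym

variable (K : Type u) [Field K]

/-- Each side has at most one nonzero term. The cut is determined by the maximum of its lower piece,
the shuffle by `IsShuffle.eq_of_pack_eq`, and `exists_isShuffle` shows that one exists when the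
other does. The hypothesis `hc` carries the condition over from the threshold `N` to the cut of the
packed word. -/
theorem sum_cut_eq_shuffleSum {N : ℕ} {p q : List ℕ} (hpq : Separated N p q) (c : ℕ → ℕ → Prop)
    [DecidableRel c]
    (hc : ∀ r, IsShuffle N p q r →
      (c (r.getLastD 0) N ↔ c ((pack r).getLastD 0) (letterRank r N))) (w : PackedWord) :
    ∑ k ∈ Finset.range (maxLetter w.1 + 1), (if c (w.1.getLastD 0) k then
      realize K (M K (lower w k)) p * realize K (M K (upper w k)) q else 0) =
      shuffleSum (fun r => if c (r.getLastD 0) N then realize K (M K w) r else 0) p q := by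
  simp only [realize_M]
  by_cases h : ∃ s, IsShuffle N p q s ∧ pack s = w.1
  · obtain ⟨s, hs, hw⟩ := h
    have hp : pack p = (lower w (letterRank s N)).1 := by
      rw [← hs.1, ← pack_filter_pack_le, hw]; rfl
    have hq : pack q = (upper w (letterRank s N)).1 := by
      rw [← hs.2, ← pack_filter_pack_gt, hw]; rfl
    have hle : letterRank s N ≤ maxLetter w.1 := by
      rw [← hw, maxLetter_pack]
      exact Finset.card_le_card (Finset.filter_subset _ _)
    have hR : shuffleSum (fun r => if c (r.getLastD 0) N then
        (if pack r = w.1 then (1 : K) else 0) else 0) p q =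
        shuffleSum (fun r => if r = s then (if c (s.getLastD 0) N then 1 else 0) else 0) p q := by
      refine shuffleSum_congr hpq fun r hr => ?_
      by_cases hrs : r = s
      · subst hrs; simp [hw]
      · have : pack r ≠ w.1 := fun h => hrs (hr.eq_of_pack_eq hs (h.trans hw.symm))
        simp [hrs, this]
    rw [hR, shuffleSum_single hpq hs, Finset.sum_eq_single (letterRank s N)]
    · rw [if_pos hp, if_pos hq, mul_one, if_congr (hc s hs) rfl rfl, hw]
    · intro k hk hne
      rw [Finset.mem_range] at hk
      have : pack p ≠ (lower w k).1 := by
        intro h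
        have h' := congrArg maxLetter h
        rw [maxLetter_lower w (by omega), ← hs.letterRank_eq] at h'
        exact hne h'.symm
      simp [this]
    · intro h
      rw [Finset.mem_range] at h
      omega
  · push Not at h
    rw [Finset.sum_eq_zero]
    · rw [shuffleSum_congr hpq (G := fun _ => 0), shuffleSum_zero]
      intro r hr
      simp [h r hr]
    · intro k _
      by_cases h1 : pack p = (lower w k).1
      · by_cases h2 : pack q = (upper w k).1
        · obtain ⟨r, hr, hrw⟩ := exists_isShuffle hpq h1 h2
          exact absurd hrw (h r hr)
        · simp [h2]
      · simp [h1]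

/-- The coefficient of a pair of words in an element of `WQSym ⊗ WQSym`. -/
def coeff₂ (p q : List ℕ) : WQSym K ⊗[K] WQSym K →ₗ[K] K :=
  TensorProduct.lift ((LinearMap.mul K K).compl₁₂
    (LinearMap.proj p ∘ₗ realize K) (LinearMap.proj q ∘ₗ realize K))

theorem coeff₂_tmul (p q : List ℕ) (x y : WQSym K) :
    coeff₂ K p q (x ⊗ₜ[K] y) = realize K x p * realize K y q := rfl

theorem coeff₂_congr {p p' q q' : List ℕ} (hp : pack p = pack p') (hq : pack q = pack q') :
    coeff₂ K p q = coeff₂ K p' q' := by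
  ext x y
  simp only [TensorProduct.AlgebraTensorModule.curry_apply, LinearMap.coe_comp, LinearMap.coe_restrictScalars,
    Function.comp_apply, TensorProduct.curry_apply, coeff₂_tmul, Finsupp.lsingle_apply]
  rw [realize_congr K _ hp, realize_congr K _ hq]

variable {K} in
-- Coefficients depend only on the packings of the two words, so the second word can be shifted
-- above the first. This makes the shuffle description available for every coefficient.
theorem ext_coeff₂ {z z' : WQSym K ⊗[K] WQSym K}
    (h : ∀ N p q, Separated N p q → coeff₂ K p q z = coeff₂ K p q z') : z = z' := by
  have key : ∀ (u v : PackedWord) (z : WQSym K ⊗[K] WQSym K),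
      finsuppTensorFinsupp' K PackedWord PackedWord z (u, v) = coeff₂ K u.1 v.1 z := by
    intro u v z
    induction z with
    | zero => simp
    | add x y hx hy => simp [hx, hy]
    | tmul x y =>
      rw [finsuppTensorFinsupp'_apply_apply, coeff₂_tmul, realize_apply, realize_apply,
        toPacked_val_self, toPacked_val_self]
  apply (finsuppTensorFinsupp' K PackedWord PackedWord).injective
  ext ⟨u, v⟩
  rw [key, key]
  have hmono : StrictMonoOn (fun a => a + (maxLetter u.1 + 1)) {a | a ∈ v.1} :=
    fun a _ b _ hab => Nat.add_lt_add_right hab _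
  have hv := pack_map v.1 _ hmono
  rw [← coeff₂_congr K rfl hv]
  refine h (maxLetter u.1) _ _ ⟨fun a ha => le_maxLetter ha, fun b hb => ?_⟩
  obtain ⟨a, -, rfl⟩ := List.mem_map.1 hb
  omega

theorem coeff₂_comul {N : ℕ} {p q : List ℕ} (hpq : Separated N p q) (x : WQSym K) :
    coeff₂ K p q (comul K x) = shuffleSum (realize K x) p q := by
  induction x using Finsupp.induction_linear with
  | zero =>
    rw [map_zero, map_zero, map_zero]
    exact (shuffleSum_zero p q).symm
  | add x y hx hy =>
    rw [map_add, map_add, map_add, hx, hy, ← shuffleSum_add]; rfl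
  | single u k =>
    have h : (Finsupp.single u k : WQSym K) = k • M K u := by simp [M]
    have := sum_cut_eq_shuffleSum K hpq (fun _ _ => True) (fun _ _ => Iff.rfl) u
    simp only [if_true] at this
    rw [h, map_smul, map_smul, map_smul, comul_M, map_sum]
    simp only [coeff₂_tmul]
    rw [this, shuffleSum_smul]; rfl

theorem coeff₂_map₂_mul (p q : List ℕ) (z z' : WQSym K ⊗[K] WQSym K) :
    coeff₂ K p q (TensorProduct.map₂ (ops K).mul (ops K).mul z z') =
      splitSum (fun p₁ p₂ => splitSum (fun q₁ q₂ => coeff₂ K p₁ q₁ z * coeff₂ K p₂ q₂ z') q) p := by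
  induction z with
  | zero => simp [splitSum_zero]
  | add x y hx hy => simp only [map_add, LinearMap.add_apply, hx, hy, add_mul, splitSum_add]
  | tmul a b =>
    induction z' with
    | zero => simp [splitSum_zero]
    | add x y hx hy => simp only [map_add, hx, hy, mul_add, splitSum_add]
    | tmul a' b' =>
      rw [TensorProduct.map₂_apply_tmul, TensorProduct.map_tmul, coeff₂_tmul, realize_mul_apply, realize_mul_apply,
        splitSum_mul_right]
      simp only [splitSum_mul_left, coeff₂_tmul]
      refine splitSum_congr fun _ _ _ => splitSum_congr fun _ _ _ => ?_
      ring

theorem separated_of_append {N : ℕ} {p q p' q' p₂ q₂ : List ℕ} (h : Separated N p q)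
    (hp : p' ++ p₂ = p) (hq : q' ++ q₂ = q) : Separated N p' q' ∧ Separated N p₂ q₂ := by
  subst hp hq
  exact ⟨⟨fun a ha => h.1 a (by simp [ha]), fun a ha => h.2 a (by simp [ha])⟩,
    ⟨fun a ha => h.1 a (by simp [ha]), fun a ha => h.2 a (by simp [ha])⟩⟩

theorem shuffleSum_mul_shuffleSum (F G : List ℕ → K) (p q p' q' : List ℕ) :
    shuffleSum (fun v => shuffleSum (fun w => F v * G w) p' q') p q =
      shuffleSum F p q * shuffleSum G p' q' := by
  rw [shuffleSum_mul_right]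
  congr 1
  funext v
  exact (shuffleSum_smul (F v) G p' q').symm

/-- On coefficients: the left side factorizes shuffles, the right side shuffles factors, and
`shuffleSum_splitSum` equates the two. -/
theorem comul_mul' (x y : WQSym K) : (ops K).comul ((ops K).mul x y) =
    TensorProduct.map₂ (ops K).mul (ops K).mul ((ops K).comul x) ((ops K).comul y) := by
  refine ext_coeff₂ fun N p q hpq => ?_
  rw [coeff₂_map₂_mul]
  refine (coeff₂_comul K hpq _).trans ?_
  rw [show realize K ((ops K).mul x y) = _ from funext (realize_mul_apply K x y),
    shuffleSum_splitSum]
  refine splitSum_congr fun p₁ p₂ hp => splitSum_congr fun q₁ q₂ hq => ?_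
  obtain ⟨h1, h2⟩ := separated_of_append hpq hp hq
  rw [shuffleSum_mul_shuffleSum]
  congr 1
  · exact (coeff₂_comul K h1 x).symm
  · exact (coeff₂_comul K h2 y).symm

end WQSym

/-! ### Comparing the maxima of shuffles -/

theorem IsOrderCond.iff_of_lt {c : ℕ → ℕ → Prop} (hc : IsOrderCond c) {a b a' b' : ℕ} (h : a < b)
    (h' : a' < b') : c a b ↔ c a' b' := by
  have hf : StrictMonoOn (fun x => if x = a then a' else b') {a, b} := by
    rintro x (rfl | rfl) y (rfl | rfl) hxy
    · omega
    · simp only [if_true]; rw [if_neg (by omega)]; exact h'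
    · omega
    · omega
  have := hc _ _ hf a (by simp) b (by simp)
  simp only [if_true] at this
  rw [if_neg (by omega)] at this
  exact this.symm

theorem IsOrderCond.iff_of_gt {c : ℕ → ℕ → Prop} (hc : IsOrderCond c) {a b a' b' : ℕ} (h : b < a)
    (h' : b' < a') : c a b ↔ c a' b' := by
  have hc' : IsOrderCond (fun a b => c b a) := fun f s hf a ha b hb => hc f s hf b hb a ha
  exact hc'.iff_of_lt h h'

theorem IsShuffle.maxLetter_eq {N : ℕ} {p q r : List ℕ} (hpq : Separated N p q)
    (h : IsShuffle N p q r) (hq : q ≠ []) : maxLetter r = maxLetter q := by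
  have hN : N < maxLetter q := hpq.2 _ (maxLetter_mem hq)
  apply le_antisymm
  · refine maxLetter_le_iff.2 fun a ha => ?_
    rcases (h.mem_iff a).1 ha with h' | h'
    · exact (hpq.1 a h').trans hN.le
    · exact le_maxLetter h'
  · exact le_maxLetter ((h.mem_iff _).2 (Or.inr (maxLetter_mem hq)))

theorem IsShuffle.maxLetter_le {N : ℕ} {p r : List ℕ} (hpq : Separated N p [])
    (h : IsShuffle N p [] r) : maxLetter r ≤ N := by
  refine maxLetter_le_iff.2 fun a ha => ?_
  rcases (h.mem_iff a).1 ha with h' | h'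
  · exact hpq.1 a h'
  · simp at h'

/-- The maximum of a shuffle is that of its large part, when this is nonempty. If just one large
part is empty, the true maximum there is at most `N` and the default maximum is `0`; either way it
lies below the other maximum, which is all that an order condition sees. If both were empty the
small parts would decide, hence `hne`. -/
theorem IsShuffle.cond_maxLetter {c : ℕ → ℕ → Prop} (hc : IsOrderCond c) {N : ℕ}
    {p q r p' q' r' : List ℕ} (hpq : Separated N p q) (hpq' : Separated N p' q')
    (h : IsShuffle N p q r) (h' : IsShuffle N p' q' r') (hne : q ++ q' ≠ []) :
    c (maxLetter r) (maxLetter r') ↔ c (maxLetter q) (maxLetter q') := by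
  by_cases hq : q = []
  · subst hq
    have hq' : q' ≠ [] := by simpa using hne
    have h1 := h.maxLetter_le hpq
    have h2 := hpq'.2 _ (maxLetter_mem hq')
    rw [h'.maxLetter_eq hpq' hq', maxLetter_nil]
    exact hc.iff_of_lt (by omega) (by omega)
  · have h1 := hpq.2 _ (maxLetter_mem hq)
    rw [h.maxLetter_eq hpq hq]
    by_cases hq' : q' = []
    · subst hq'
      have h2 := h'.maxLetter_le hpq'
      rw [maxLetter_nil]
      exact hc.iff_of_gt (by omega) (by omega)
    · rw [h'.maxLetter_eq hpq' hq']

/-! ### Half-coproducts as restricted shuffle sums -/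

namespace WQSym

variable (K : Type u) [Field K]

/-- The coefficient of a pair of words in an element of `WQSym⁺ ⊗ WQSym⁺`. -/
def coeffPlus₂ (p q : List ℕ) : plus K ⊗[K] plus K →ₗ[K] K :=
  coeff₂ K p q ∘ₗ TensorProduct.map (plus K).subtype (plus K).subtype

theorem coeffPlus₂_tmul (p q : List ℕ) (x y : plus K) :
    coeffPlus₂ K p q (x ⊗ₜ[K] y) = realize K (x : WQSym K) p * realize K (y : WQSym K) q := rfl

theorem coeffPlus₂_nil_left (q : List ℕ) (z : plus K ⊗[K] plus K) : coeffPlus₂ K [] q z = 0 := by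
  induction z with
  | zero => simp
  | add x y hx hy => simp [hx, hy]
  | tmul x y => rw [coeffPlus₂_tmul, realize_plus_nil, zero_mul]

theorem coeffPlus₂_nil_right (p : List ℕ) (z : plus K ⊗[K] plus K) : coeffPlus₂ K p [] z = 0 := by
  induction z with
  | zero => simp
  | add x y hx hy => simp [hx, hy]
  | tmul x y => rw [coeffPlus₂_tmul, realize_plus_nil, mul_zero]

variable {K} in
theorem ext_coeffPlus₂ {z z' : plus K ⊗[K] plus K}
    (h : ∀ N p q, Separated N p q → p ≠ [] → q ≠ [] → coeffPlus₂ K p q z = coeffPlus₂ K p q z') :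
    z = z' := by
  have hinj : Function.Injective (TensorProduct.map (plus K).subtype (plus K).subtype) := by
    refine Function.LeftInverse.injective (g := TensorProduct.map (proj K) (proj K)) fun z => ?_
    rw [← LinearMap.comp_apply, ← TensorProduct.map_comp]
    have : proj K ∘ₗ (plus K).subtype = LinearMap.id := LinearMap.ext fun x => proj_coe K x
    rw [this, TensorProduct.map_id]
    rfl
  apply hinj
  refine ext_coeff₂ fun N p q hpq => ?_
  change coeffPlus₂ K p q z = coeffPlus₂ K p q z'
  by_cases hp : p = []
  · rw [hp, coeffPlus₂_nil_left, coeffPlus₂_nil_left]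
  by_cases hq : q = []
  · rw [hq, coeffPlus₂_nil_right, coeffPlus₂_nil_right]
  exact h N p q hpq hp hq

theorem coeffPlus₂_halfComul {N : ℕ} {p q : List ℕ} (hpq : Separated N p q) (hp : p ≠ [])
    (hq : q ≠ []) (c : ℕ → ℕ → Prop) [DecidableRel c]
    (hc : ∀ r, IsShuffle N p q r →
      (c (r.getLastD 0) N ↔ c ((pack r).getLastD 0) (letterRank r N))) (x : plus K) :
    coeffPlus₂ K p q (halfComul K c x) =
      shuffleSum (fun r => if c (r.getLastD 0) N then realize K (x : WQSym K) r else 0) p q := by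
  have hnil : ∀ {u : List ℕ}, u ≠ [] → ∀ v : PackedWord,
      realize K ((MPlus K v : plus K) : WQSym K) u = realize K (M K v) u := by
    intro u hu v
    have h0 : ¬ pack u = (toPacked []).1 := by
      rw [toPacked_val, pack_nil, pack_eq_nil]; exact hu
    rw [MPlus, coe_proj, map_sub, map_smul, Pi.sub_apply, Pi.smul_apply, realize_M K (toPacked []),
      if_neg h0, smul_zero, sub_zero]
  -- The restricted shuffle sum is packaged as a linear functional of `x`, so that it can be
  -- compared with the left side on basis elements.
  let R : plus K →ₗ[K] K :=
    { toFun := fun x =>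
        shuffleSum (fun r => if c (r.getLastD 0) N then realize K (x : WQSym K) r else 0) p q
      map_add' := fun x y => by
        rw [← shuffleSum_add]
        congr 1; funext r
        split_ifs <;> simp
      map_smul' := fun k x => by
        rw [RingHom.id_apply, shuffleSum_smul]
        congr 1; funext r
        split_ifs <;> simp }
  suffices h : coeffPlus₂ K p q ∘ₗ halfComul K c = R from LinearMap.congr_fun h x
  refine hom_ext_MPlus fun w hw => ?_
  have h := sum_cut_eq_shuffleSum K hpq c hc w
  rw [LinearMap.comp_apply, halfComul_MPlus, map_sum]
  refine Eq.trans (Finset.sum_congr rfl fun k _ => ?_) (h.trans ?_)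
  · split_ifs
    · rw [coeffPlus₂_tmul, hnil hp, hnil hq]
    · rw [map_zero]
  · change _ = shuffleSum _ p q
    rw [show ((MPlus K w : plus K) : WQSym K) = M K w from coe_proj_M K hw]

theorem getLastD_pack {r : List ℕ} (hr : r ≠ []) :
    (pack r).getLastD 0 = letterRank r (r.getLastD 0) := getLastD_map _ hr 0

theorem coeffPlus₂_halfComul_le {N : ℕ} {p q : List ℕ} (hpq : Separated N p q) (hp : p ≠ [])
    (hq : q ≠ []) (x : plus K) : coeffPlus₂ K p q (halfComul K (fun a k => a ≤ k) x) =
      shuffleSum (fun r => if r.getLastD 0 ≤ N then realize K (x : WQSym K) r else 0) p q := by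
  refine coeffPlus₂_halfComul K hpq hp hq _ (fun r hr => ?_) x
  have hr := hr.ne_nil hp
  rw [getLastD_pack hr, letterRank_le_letterRank_iff (getLastD_mem hr 0)]

theorem coeffPlus₂_halfComul_gt {N : ℕ} {p q : List ℕ} (hpq : Separated N p q) (hp : p ≠ [])
    (hq : q ≠ []) (x : plus K) : coeffPlus₂ K p q (halfComul K (fun a k => k < a) x) =
      shuffleSum (fun r => if N < r.getLastD 0 then realize K (x : WQSym K) r else 0) p q := by
  refine coeffPlus₂_halfComul K hpq hp hq _ (fun r hr => ?_) x
  have hr := hr.ne_nil hp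
  rw [getLastD_pack hr, ← not_le, ← not_le, letterRank_le_letterRank_iff (getLastD_mem hr 0)]

/-! ### The coefficients of the terms in the compatibility relations -/

open scoped Classical in
theorem coeffPlus₂_map₂ {c : ℕ → ℕ → Prop} (hc : IsOrderCond c) (p q : List ℕ) (z z' : plus K ⊗[K] plus K) :
    coeffPlus₂ K p q (TensorProduct.map₂ (partialProd K fun _ _ => True) (partialProd K c) z z') =
      splitSum (fun p₁ p₂ => splitSum (fun q₁ q₂ => if c (maxLetter q₁) (maxLetter q₂) then
        coeffPlus₂ K p₁ q₁ z * coeffPlus₂ K p₂ q₂ z' else 0) q) p := by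
  induction z with
  | zero => simp [splitSum_zero]
  | add x y hx hy =>
    simp only [map_add, LinearMap.add_apply, hx, hy, add_mul, ite_add_zero, splitSum_add]
  | tmul a b =>
    induction z' with
    | zero => simp [splitSum_zero]
    | add x y hx hy => simp only [map_add, hx, hy, mul_add, ite_add_zero, splitSum_add]
    | tmul a' b' =>
      rw [TensorProduct.map₂_apply_tmul, TensorProduct.map_tmul, coeffPlus₂_tmul,
        realize_partialProd_apply K isOrderCond_true, realize_partialProd_apply K hc,
        splitSum_mul_right]
      simp only [splitSum_mul_left, coeffPlus₂_tmul, if_true]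
      refine splitSum_congr fun _ _ _ => splitSum_congr fun _ _ _ => ?_
      split_ifs
      · ring
      · ring

open scoped Classical in
theorem coeffPlus₂_lTensor_flip {c : ℕ → ℕ → Prop} (hc : IsOrderCond c) (p q : List ℕ) (z : plus K ⊗[K] plus K) (b : plus K) :
    coeffPlus₂ K p q (((partialProd K c).flip b).lTensor (plus K) z) =
      splitSum (fun q₁ q₂ => if c (maxLetter q₁) (maxLetter q₂) then
        coeffPlus₂ K p q₁ z * realize K (b : WQSym K) q₂ else 0) q := by
  induction z with
  | zero => simp [splitSum_zero]
  | add x y hx hy => simp only [map_add, hx, hy, add_mul, ite_add_zero, splitSum_add]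
  | tmul a a' =>
    rw [LinearMap.lTensor_tmul, LinearMap.flip_apply, coeffPlus₂_tmul,
      realize_partialProd_apply K hc, splitSum_mul_left]
    refine splitSum_congr fun _ _ _ => ?_
    rw [coeffPlus₂_tmul]
    split_ifs
    · ring
    · ring

open scoped Classical in
theorem coeffPlus₂_lTensor {c : ℕ → ℕ → Prop} (hc : IsOrderCond c) (p q : List ℕ) (z : plus K ⊗[K] plus K) (a : plus K) :
    coeffPlus₂ K p q ((partialProd K c a).lTensor (plus K) z) =
      splitSum (fun q₁ q₂ => if c (maxLetter q₁) (maxLetter q₂) then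
        realize K (a : WQSym K) q₁ * coeffPlus₂ K p q₂ z else 0) q := by
  induction z with
  | zero => simp [splitSum_zero]
  | add x y hx hy => simp only [map_add, hx, hy, mul_add, ite_add_zero, splitSum_add]
  | tmul b b' =>
    rw [LinearMap.lTensor_tmul, coeffPlus₂_tmul,
      realize_partialProd_apply K hc, splitSum_mul_left]
    refine splitSum_congr fun _ _ _ => ?_
    rw [coeffPlus₂_tmul]
    split_ifs
    · ring
    · ring

theorem coeffPlus₂_rTensor (p q : List ℕ) (z : plus K ⊗[K] plus K) (a : plus K) :
    coeffPlus₂ K p q ((partialProd K (fun _ _ => True) a).rTensor (plus K) z) =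
      splitSum (fun p₁ p₂ => realize K (a : WQSym K) p₁ * coeffPlus₂ K p₂ q z) p := by
  induction z with
  | zero => simp [splitSum_zero]
  | add x y hx hy => simp only [map_add, hx, hy, mul_add, splitSum_add]
  | tmul b b' =>
    rw [LinearMap.rTensor_tmul, coeffPlus₂_tmul,
      realize_partialProd_apply K isOrderCond_true, splitSum_mul_right]
    refine splitSum_congr fun _ _ _ => ?_
    rw [coeffPlus₂_tmul, if_pos trivial]
    ring

theorem coeffPlus₂_rTensor_flip (p q : List ℕ) (z : plus K ⊗[K] plus K) (b : plus K) :
    coeffPlus₂ K p q (((partialProd K (fun _ _ => True)).flip b).rTensor (plus K) z) =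
      splitSum (fun p₁ p₂ => coeffPlus₂ K p₁ q z * realize K (b : WQSym K) p₂) p := by
  induction z with
  | zero => simp [splitSum_zero]
  | add x y hx hy => simp only [map_add, hx, hy, add_mul, splitSum_add]
  | tmul a a' =>
    rw [LinearMap.rTensor_tmul, LinearMap.flip_apply, coeffPlus₂_tmul,
      realize_partialProd_apply K isOrderCond_true, splitSum_mul_right]
    refine splitSum_congr fun _ _ _ => ?_
    rw [coeffPlus₂_tmul, if_pos trivial]
    ring

/-- The full coproduct is the reduced one plus `a ⊗ 1 + 1 ⊗ a`; the last two terms are visible only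
when `q`, respectively `p`, is empty. -/
theorem shuffleSum_realize {N : ℕ} {p q : List ℕ} (hpq : Separated N p q) (a : plus K) :
    shuffleSum (realize K (a : WQSym K)) p q =
      coeffPlus₂ K p q (halfComul K (fun _ _ => True) a) +
        (if q = [] then realize K (a : WQSym K) p else 0) +
        (if p = [] then realize K (a : WQSym K) q else 0) := by
  have h1 := realize_one K p
  have h2 := realize_one K q
  change realize K (M K (toPacked [])) p = _ at h1
  change realize K (M K (toPacked [])) q = _ at h2
  rw [← coeff₂_comul K hpq, comul_eq_halfComul, map_add, map_add, coeff₂_tmul, coeff₂_tmul, h1, h2]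
  simp only [mul_ite, mul_one, mul_zero, ite_mul, one_mul, zero_mul]
  rfl

/-- Of the two boundary terms only `b ⊗ 1` survives: for `p` empty the only shuffle is `q`, and a
nonempty `q` ends with a letter above `N`. -/
theorem shuffleSum_realize_le {N : ℕ} {p q : List ℕ} (hpq : Separated N p q) (b : plus K) :
    shuffleSum (fun r => if r.getLastD 0 ≤ N then realize K (b : WQSym K) r else 0) p q =
      coeffPlus₂ K p q (halfComul K (fun a k => a ≤ k) b) +
        (if q = [] then realize K (b : WQSym K) p else 0) := by
  by_cases hq : q = []
  · subst hq
    rw [shuffleSum_nil_right, coeffPlus₂_nil_right, zero_add, if_pos rfl]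
    by_cases hp : p = []
    · subst hp; rw [realize_plus_nil]; simp
    · rw [if_pos (hpq.1 _ (getLastD_mem hp 0))]
  · rw [if_neg hq, add_zero]
    by_cases hp : p = []
    · subst hp
      rw [shuffleSum_nil_left, coeffPlus₂_nil_left, if_neg]
      exact not_le.2 (hpq.2 _ (getLastD_mem hq 0))
    · exact (coeffPlus₂_halfComul_le K hpq hp hq b).symm

theorem shuffleSum_realize_gt {N : ℕ} {p q : List ℕ} (hpq : Separated N p q) (b : plus K) :
    shuffleSum (fun r => if N < r.getLastD 0 then realize K (b : WQSym K) r else 0) p q =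
      coeffPlus₂ K p q (halfComul K (fun a k => k < a) b) +
        (if p = [] then realize K (b : WQSym K) q else 0) := by
  by_cases hp : p = []
  · subst hp
    rw [shuffleSum_nil_left, coeffPlus₂_nil_left, zero_add, if_pos rfl]
    by_cases hq : q = []
    · subst hq; rw [realize_plus_nil]; simp
    · rw [if_pos (hpq.2 _ (getLastD_mem hq 0))]
  · rw [if_neg hp, add_zero]
    by_cases hq : q = []
    · subst hq
      rw [shuffleSum_nil_right, coeffPlus₂_nil_right, if_neg]
      exact not_lt.2 (hpq.1 _ (getLastD_mem hp 0))
    · exact (coeffPlus₂_halfComul_gt K hpq hp hq b).symm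

open scoped Classical in
-- An empty second factor contributes zero, so the last letter of the product is that of the second
-- factor and `d` constrains `b` alone. The comparison of maxima depends only on `q₁` and `q₂` by
-- `IsShuffle.cond_maxLetter`, for which `q` has to be nonempty.
theorem shuffleSum_partialProd {c : ℕ → ℕ → Prop} (hc : IsOrderCond c) (d : ℕ → Prop) [DecidablePred d]
    {N : ℕ} {p q : List ℕ} (hpq : Separated N p q) (hq : q ≠ []) (a b : plus K) :
    shuffleSum (fun r => if d (r.getLastD 0) then
      realize K (partialProd K c a b : WQSym K) r else 0) p q =
      splitSum (fun p₁ p₂ => splitSum (fun q₁ q₂ => if c (maxLetter q₁) (maxLetter q₂) then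
        shuffleSum (realize K (a : WQSym K)) p₁ q₁ *
          shuffleSum (fun r => if d (r.getLastD 0) then realize K (b : WQSym K) r else 0) p₂ q₂
        else 0) q) p := by
  have h : ∀ r, (if d (r.getLastD 0) then realize K (partialProd K c a b : WQSym K) r else 0) =
      splitSum (fun v v' => if c (maxLetter v) (maxLetter v') then realize K (a : WQSym K) v *
        (if d (v'.getLastD 0) then realize K (b : WQSym K) v' else 0) else 0) r := by
    intro r
    rw [realize_partialProd_apply K hc, splitSum_ite]
    refine splitSum_congr fun v v' hv => ?_
    by_cases hv' : v' = []
    · subst hv'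
      rw [realize_plus_nil]
      simp
    · rw [← hv, getLastD_append hv']
      split_ifs <;> simp
  rw [show (fun r => if d (r.getLastD 0) then realize K (partialProd K c a b : WQSym K) r else 0) = _
    from funext h, shuffleSum_splitSum]
  refine splitSum_congr fun p₁ p₂ hp => splitSum_congr fun q₁ q₂ hq' => ?_
  obtain ⟨h1, h2⟩ := separated_of_append hpq hp hq'
  rw [← shuffleSum_mul_shuffleSum]
  have key : ∀ r, IsShuffle N p₁ q₁ r → ∀ r', IsShuffle N p₂ q₂ r' →
      (c (maxLetter r) (maxLetter r') ↔ c (maxLetter q₁) (maxLetter q₂)) := fun r hr r' hr' =>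
    hr.cond_maxLetter hc h1 h2 hr' (by rw [hq']; exact hq)
  by_cases hcq : c (maxLetter q₁) (maxLetter q₂)
  · rw [if_pos hcq]
    exact shuffleSum_congr h1 fun r hr => shuffleSum_congr h2 fun r' hr' => by
      rw [if_pos ((key r hr r' hr').2 hcq)]
  · rw [if_neg hcq, shuffleSum_congr h1 (G := fun _ => 0), shuffleSum_zero]
    intro r hr
    rw [shuffleSum_congr h2 (G := fun _ => 0), shuffleSum_zero]
    intro r' hr'
    rw [if_neg (mt (key r hr r' hr').1 hcq)]

/-! ### The half-coproducts of the partial products -/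

open scoped Classical in
-- Multiply out the reduced coproduct of `a` plus its two boundary terms with the upper half of `b`
-- plus its one boundary term. Of the six products, one would require `p` to be empty. The terms
-- with `q₁` empty carry the condition on `0` and `max q`, which amounts to `c 0 1`. An arbitrary
-- `c` covers `≺`, `∘`, `≻` and `∘ + ≻` at once.
theorem halfComul_gt_partialProd {c : ℕ → ℕ → Prop} (hc : IsOrderCond c) (a b : plus K) :
    halfComul K (fun a k => k < a) (partialProd K c a b) =
      TensorProduct.map₂ (partialProd K fun _ _ => True) (partialProd K c)
          (halfComul K (fun _ _ => True) a) (halfComul K (fun a k => k < a) b) +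
        ((partialProd K c).flip b).lTensor (plus K) (halfComul K (fun _ _ => True) a) +
        (partialProd K c a).lTensor (plus K) (halfComul K (fun a k => k < a) b) +
        if c 0 1 then (partialProd K (fun _ _ => True) a).rTensor (plus K)
          (halfComul K (fun a k => k < a) b) + a ⊗ₜ[K] b else 0 := by
  refine ext_coeffPlus₂ fun N p q hpq hp hq => ?_
  rw [coeffPlus₂_halfComul_gt K hpq hp hq, shuffleSum_partialProd K hc (fun x => N < x) hpq hq,
    map_add, map_add, map_add, coeffPlus₂_map₂ K hc, coeffPlus₂_lTensor_flip K hc,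
    coeffPlus₂_lTensor K hc, apply_ite (coeffPlus₂ K p q), map_add, map_zero, coeffPlus₂_rTensor,
    coeffPlus₂_tmul]
  set A := halfComul K (fun _ _ => True) a
  set B := halfComul K (fun a k => k < a) b
  -- The letters of `q` exceed `N`, so `max q` is positive and `c` cannot tell it from `1`.
  have hq0 : c (maxLetter []) (maxLetter q) ↔ c 0 1 := by
    rw [maxLetter_nil]
    exact hc.iff_of_lt (Nat.zero_lt_of_lt (hpq.2 _ (maxLetter_mem hq))) Nat.zero_lt_one
  have hstep : ∀ p₁ p₂, p₁ ++ p₂ = p → ∀ q₁ q₂, q₁ ++ q₂ = q →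
      (if c (maxLetter q₁) (maxLetter q₂) then shuffleSum (realize K (a : WQSym K)) p₁ q₁ *
          shuffleSum (fun r => if N < r.getLastD 0 then realize K (b : WQSym K) r else 0) p₂ q₂
        else 0) =
      (if c (maxLetter q₁) (maxLetter q₂) then
        coeffPlus₂ K p₁ q₁ A * coeffPlus₂ K p₂ q₂ B else 0) +
      (if p₂ = [] then (if c (maxLetter q₁) (maxLetter q₂) then
        coeffPlus₂ K p₁ q₁ A * realize K (b : WQSym K) q₂ else 0) else 0) +
      (if p₁ = [] then (if c (maxLetter q₁) (maxLetter q₂) then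
        realize K (a : WQSym K) q₁ * coeffPlus₂ K p₂ q₂ B else 0) else 0) +
      (if q₁ = [] then (if c 0 1 then realize K (a : WQSym K) p₁ * coeffPlus₂ K p₂ q₂ B +
        (if p₂ = [] then realize K (a : WQSym K) p₁ * realize K (b : WQSym K) q₂ else 0)
          else 0) else 0) := by
    intro p₁ p₂ hp' q₁ q₂ hq'
    obtain ⟨h1, h2⟩ := separated_of_append hpq hp' hq'
    rw [shuffleSum_realize K h1, shuffleSum_realize_gt K h2]
    have hpp : ¬ (p₁ = [] ∧ p₂ = []) := by
      rintro ⟨rfl, rfl⟩; exact hp (by simpa using hp'.symm)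
    by_cases hq₁ : q₁ = []
    · subst hq₁
      rw [List.nil_append] at hq'
      subst hq'
      rw [if_congr hq0 rfl rfl, if_congr hq0 rfl rfl, if_congr hq0 rfl rfl, if_congr hq0 rfl rfl]
      rw [realize_plus_nil, coeffPlus₂_nil_right]
      split_ifs <;> first | (exfalso; tauto) | ring
    · split_ifs <;> first | (exfalso; tauto) | ring
  rw [splitSum_congr fun p₁ p₂ hp' => splitSum_congr (hstep p₁ p₂ hp')]
  simp only [splitSum_add, splitSum_ite_left, splitSum_ite_right, ← splitSum_ite]

open scoped Classical in
-- The same expansion, but the boundary term of `b` now requires `q₂` to be empty, where the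
-- condition on the maxima amounts to `c 1 0`. The product that is excluded is the one with both
-- `q₁` and `q₂` empty.
theorem halfComul_le_partialProd {c : ℕ → ℕ → Prop} (hc : IsOrderCond c) (a b : plus K) :
    halfComul K (fun a k => a ≤ k) (partialProd K c a b) =
      TensorProduct.map₂ (partialProd K fun _ _ => True) (partialProd K c)
          (halfComul K (fun _ _ => True) a) (halfComul K (fun a k => a ≤ k) b) +
        (partialProd K c a).lTensor (plus K) (halfComul K (fun a k => a ≤ k) b) +
        (if c 0 1 then (partialProd K (fun _ _ => True) a).rTensor (plus K)
          (halfComul K (fun a k => a ≤ k) b) else 0) +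
        if c 1 0 then ((partialProd K (fun _ _ => True)).flip b).rTensor (plus K)
          (halfComul K (fun _ _ => True) a) + b ⊗ₜ[K] a else 0 := by
  refine ext_coeffPlus₂ fun N p q hpq hp hq => ?_
  rw [coeffPlus₂_halfComul_le K hpq hp hq, shuffleSum_partialProd K hc (fun x => x ≤ N) hpq hq,
    map_add, map_add, map_add, coeffPlus₂_map₂ K hc, coeffPlus₂_lTensor K hc,
    apply_ite (coeffPlus₂ K p q), apply_ite (coeffPlus₂ K p q), map_add, map_zero,
    coeffPlus₂_rTensor, coeffPlus₂_rTensor_flip, coeffPlus₂_tmul]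
  set A := halfComul K (fun _ _ => True) a
  set B := halfComul K (fun a k => a ≤ k) b
  have hq0 : c (maxLetter []) (maxLetter q) ↔ c 0 1 := by
    rw [maxLetter_nil]
    exact hc.iff_of_lt (Nat.zero_lt_of_lt (hpq.2 _ (maxLetter_mem hq))) Nat.zero_lt_one
  have hq1 : c (maxLetter q) (maxLetter []) ↔ c 1 0 := by
    rw [maxLetter_nil]
    exact hc.iff_of_gt (Nat.zero_lt_of_lt (hpq.2 _ (maxLetter_mem hq))) Nat.zero_lt_one
  have hstep : ∀ p₁ p₂, p₁ ++ p₂ = p → ∀ q₁ q₂, q₁ ++ q₂ = q →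
      (if c (maxLetter q₁) (maxLetter q₂) then shuffleSum (realize K (a : WQSym K)) p₁ q₁ *
          shuffleSum (fun r => if r.getLastD 0 ≤ N then realize K (b : WQSym K) r else 0) p₂ q₂
        else 0) =
      (if c (maxLetter q₁) (maxLetter q₂) then
        coeffPlus₂ K p₁ q₁ A * coeffPlus₂ K p₂ q₂ B else 0) +
      (if p₁ = [] then (if c (maxLetter q₁) (maxLetter q₂) then
        realize K (a : WQSym K) q₁ * coeffPlus₂ K p₂ q₂ B else 0) else 0) +
      (if q₁ = [] then (if c 0 1 then
        realize K (a : WQSym K) p₁ * coeffPlus₂ K p₂ q₂ B else 0) else 0) +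
      (if q₂ = [] then (if c 1 0 then coeffPlus₂ K p₁ q₁ A * realize K (b : WQSym K) p₂ +
        (if p₁ = [] then realize K (b : WQSym K) p₂ * realize K (a : WQSym K) q₁ else 0)
          else 0) else 0) := by
    intro p₁ p₂ hp' q₁ q₂ hq'
    obtain ⟨h1, h2⟩ := separated_of_append hpq hp' hq'
    rw [shuffleSum_realize K h1, shuffleSum_realize_le K h2]
    by_cases hq₁ : q₁ = []
    · subst hq₁
      rw [List.nil_append] at hq'
      subst hq'
      rw [if_congr hq0 rfl rfl, if_congr hq0 rfl rfl, if_congr hq0 rfl rfl]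
      rw [realize_plus_nil, coeffPlus₂_nil_right]
      split_ifs <;> first | (exfalso; tauto) | ring
    · by_cases hq₂ : q₂ = []
      · subst hq₂
        rw [List.append_nil] at hq'
        subst hq'
        rw [if_congr hq1 rfl rfl, if_congr hq1 rfl rfl, if_congr hq1 rfl rfl]
        rw [coeffPlus₂_nil_right]
        split_ifs <;> first | (exfalso; tauto) | ring
      · split_ifs <;> first | (exfalso; tauto) | ring
  rw [splitSum_congr fun p₁ p₂ hp' => splitSum_congr (hstep p₁ p₂ hp')]
  simp only [splitSum_add, splitSum_ite_left, splitSum_ite_right, ← splitSum_ite]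

/-- For `≪` the condition is `b < a`, so `c 0 1` fails and `c 1 0` holds; for `≫` it is `a ≤ b`, and
the two are reversed. This decides which boundary terms occur in the four relations. -/
theorem isBidendriformBialgebra : IsBidendriformBialgebra (K := K) (V := plus K)
    (partialProd K fun a b => b < a) (partialProd K fun a b => a ≤ b)
    (halfComul K fun a k => a ≤ k) (halfComul K fun a k => k < a) where
  dendriform := isDendriformDialgebra K
  codendriform := isCodendriformCoalgebra K
  coright_right a b := by
    rw [partialProd_gt_add_le, halfComul_le_add_gt, halfComul_gt_partialProd K isOrderCond_le,
      if_pos (by omega), ← add_assoc]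
  coright_left a b := by
    rw [partialProd_gt_add_le, halfComul_le_add_gt, halfComul_gt_partialProd K isOrderCond_gt,
      if_neg (by omega), add_zero]
  coleft_right a b := by
    rw [partialProd_gt_add_le, halfComul_le_add_gt, halfComul_le_partialProd K isOrderCond_le,
      if_pos (by omega), if_neg (by omega), add_zero]
    exact add_right_comm _ _ _
  coleft_left a b := by
    rw [partialProd_gt_add_le, halfComul_le_add_gt, halfComul_le_partialProd K isOrderCond_gt,
      if_neg (by omega), if_pos (by omega), add_zero, ← add_assoc, add_right_comm _ _
      ((partialProd K fun a b => b < a) a |>.lTensor (plus K) _)]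

theorem isBidendriform : (ops K).IsBidendriform where
  laws := by
    have h := isBidendriformBialgebra K
    rw [← partialProd_eq_add_lt] at h
    exact h
  mul_eq x y := by
    have h := congrArg (fun f => ((f x y : plus K) : WQSym K)) (partialProd_gt_add_le K)
    rw [← partialProd_eq_add_lt] at h
    exact (coe_partialProd K _ x y).symm.trans h.symm
  comul_eq x := by
    have h := comul_eq_halfComul K x
    rw [← halfComul_le_add_gt] at h
    exact h

end WQSym

/-! ### Transfer of structure along linear maps -/

section Transfer

variable {K : Type u} [Field K] {V : Type v} [AddCommGroup V] [Module K V]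
variable {V' : Type w} [AddCommGroup V'] [Module K V']

theorem IsDendriformTrialgebra.of_surjective {l m r : V →ₗ[K] V →ₗ[K] V}
    {l' m' r' : V' →ₗ[K] V' →ₗ[K] V'} (h : IsDendriformTrialgebra l m r) (φ : V →ₗ[K] V')
    (hφ : Function.Surjective φ) (hl : ∀ x y, φ (l x y) = l' (φ x) (φ y))
    (hm : ∀ x y, φ (m x y) = m' (φ x) (φ y)) (hr : ∀ x y, φ (r x y) = r' (φ x) (φ y)) :
    IsDendriformTrialgebra l' m' r' := by
  have hmul : ∀ x y, φ ((l + m + r) x y) = (l' + m' + r') (φ x) (φ y) := fun x y => by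
    simp only [LinearMap.add_apply, map_add, hl, hm, hr]
  constructor <;> refine hφ.forall₃.2 fun x y z => ?_
  · rw [← hm, ← hm, ← hm, ← hm, h.mid_assoc]
  · rw [← hl, ← hl, ← hmul, ← hl, h.left_left]
  · rw [← hr, ← hl, ← hl, ← hr, h.right_left]
  · rw [← hmul, ← hr, ← hr, ← hr, h.mul_right]
  · rw [← hr, ← hm, ← hm, ← hr, h.right_mid]
  · rw [← hl, ← hm, ← hr, ← hm, h.left_mid]
  · rw [← hm, ← hl, ← hl, ← hm, h.mid_left]

theorem IsDendriformDialgebra.of_surjective {l r : V →ₗ[K] V →ₗ[K] V}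
    {l' r' : V' →ₗ[K] V' →ₗ[K] V'} (h : IsDendriformDialgebra l r) (φ : V →ₗ[K] V')
    (hφ : Function.Surjective φ) (hl : ∀ x y, φ (l x y) = l' (φ x) (φ y))
    (hr : ∀ x y, φ (r x y) = r' (φ x) (φ y)) : IsDendriformDialgebra l' r' := by
  have hmul : ∀ x y, φ ((l + r) x y) = (l' + r') (φ x) (φ y) := fun x y => by
    simp only [LinearMap.add_apply, map_add, hl, hr]
  constructor <;> refine hφ.forall₃.2 fun x y z => ?_
  · rw [← hl, ← hl, ← hmul, ← hl, h.left_left]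
  · rw [← hr, ← hl, ← hl, ← hr, h.right_left]
  · rw [← hmul, ← hr, ← hr, ← hr, h.mul_right]

theorem TensorProduct.rTensor_map_of_comm {d : V →ₗ[K] V ⊗[K] V} {d' : V' →ₗ[K] V' ⊗[K] V'}
    {φ : V →ₗ[K] V'} (hd : ∀ x, TensorProduct.map φ φ (d x) = d' (φ x)) (z : V ⊗[K] V) :
    TensorProduct.assoc K V' V' V' (d'.rTensor V' (TensorProduct.map φ φ z)) =
      TensorProduct.map φ (TensorProduct.map φ φ)
        (TensorProduct.assoc K V V V (d.rTensor V z)) := by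
  have h : ∀ (t : V ⊗[K] V) (y : V),
      TensorProduct.assoc K V' V' V' (TensorProduct.map φ φ t ⊗ₜ[K] φ y) =
      TensorProduct.map φ (TensorProduct.map φ φ) (TensorProduct.assoc K V V V (t ⊗ₜ[K] y)) := by
    intro t y
    induction t with
    | zero => simp
    | add a b ha hb => simp only [map_add, TensorProduct.add_tmul, ha, hb]
    | tmul a b => simp
  induction z with
  | zero => simp
  | add a b ha hb => simp only [map_add, ha, hb]
  | tmul a b => rw [TensorProduct.map_tmul, LinearMap.rTensor_tmul, LinearMap.rTensor_tmul, ← hd, h]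

theorem TensorProduct.lTensor_map_of_comm {d : V →ₗ[K] V ⊗[K] V} {d' : V' →ₗ[K] V' ⊗[K] V'}
    {φ : V →ₗ[K] V'} (hd : ∀ x, TensorProduct.map φ φ (d x) = d' (φ x)) (z : V ⊗[K] V) :
    d'.lTensor V' (TensorProduct.map φ φ z) =
      TensorProduct.map φ (TensorProduct.map φ φ) (d.lTensor V z) := by
  induction z with
  | zero => simp
  | add a b ha hb => simp only [map_add, ha, hb]
  | tmul a b => simp [hd]

theorem IsCodendriformCoalgebra.of_surjective {dl dr : V →ₗ[K] V ⊗[K] V}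
    {dl' dr' : V' →ₗ[K] V' ⊗[K] V'} (h : IsCodendriformCoalgebra dl dr) (φ : V →ₗ[K] V')
    (hφ : Function.Surjective φ) (hl : ∀ x, TensorProduct.map φ φ (dl x) = dl' (φ x))
    (hr : ∀ x, TensorProduct.map φ φ (dr x) = dr' (φ x)) : IsCodendriformCoalgebra dl' dr' := by
  have hd : ∀ x, TensorProduct.map φ φ ((dl + dr) x) = (dl' + dr') (φ x) := fun x => by
    simp only [LinearMap.add_apply, map_add, hl, hr]
  constructor <;> refine hφ.forall.2 fun x => ?_
  · rw [← hl, TensorProduct.rTensor_map_of_comm hl, TensorProduct.lTensor_map_of_comm hd,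
      h.left_left]
  · rw [← hl, ← hr, TensorProduct.rTensor_map_of_comm hr, TensorProduct.lTensor_map_of_comm hl,
      h.right_left]
  · rw [← hr, TensorProduct.rTensor_map_of_comm hd, TensorProduct.lTensor_map_of_comm hr,
      h.mul_right]

theorem TensorProduct.map_map₂_of_comm {f g : V →ₗ[K] V →ₗ[K] V} {f' g' : V' →ₗ[K] V' →ₗ[K] V'}
    {φ : V →ₗ[K] V'} (hf : ∀ x y, φ (f x y) = f' (φ x) (φ y))
    (hg : ∀ x y, φ (g x y) = g' (φ x) (φ y)) (z t : V ⊗[K] V) :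
    TensorProduct.map φ φ (TensorProduct.map₂ f g z t) =
      TensorProduct.map₂ f' g' (TensorProduct.map φ φ z) (TensorProduct.map φ φ t) := by
  induction z with
  | zero => simp
  | add a b ha hb => simp only [map_add, LinearMap.add_apply, ha, hb]
  | tmul a b =>
    induction t with
    | zero => simp
    | add a b ha hb => simp only [map_add, ha, hb]
    | tmul c d => simp [hf, hg]

theorem TensorProduct.map_lTensor_of_comm {f : V →ₗ[K] V} {f' : V' →ₗ[K] V'} {φ : V →ₗ[K] V'}
    (hf : ∀ x, φ (f x) = f' (φ x)) (z : V ⊗[K] V) :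
    TensorProduct.map φ φ (f.lTensor V z) = f'.lTensor V' (TensorProduct.map φ φ z) := by
  induction z with
  | zero => simp
  | add a b ha hb => simp only [map_add, ha, hb]
  | tmul a b => simp [hf]

theorem TensorProduct.map_rTensor_of_comm {f : V →ₗ[K] V} {f' : V' →ₗ[K] V'} {φ : V →ₗ[K] V'}
    (hf : ∀ x, φ (f x) = f' (φ x)) (z : V ⊗[K] V) :
    TensorProduct.map φ φ (f.rTensor V z) = f'.rTensor V' (TensorProduct.map φ φ z) := by
  induction z with
  | zero => simp
  | add a b ha hb => simp only [map_add, ha, hb]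
  | tmul a b => simp [hf]

theorem IsBidendriformBialgebra.of_surjective {l r : V →ₗ[K] V →ₗ[K] V}
    {dl dr : V →ₗ[K] V ⊗[K] V} {l' r' : V' →ₗ[K] V' →ₗ[K] V'} {dl' dr' : V' →ₗ[K] V' ⊗[K] V'}
    (h : IsBidendriformBialgebra l r dl dr) (φ : V →ₗ[K] V') (hφ : Function.Surjective φ)
    (hl : ∀ x y, φ (l x y) = l' (φ x) (φ y)) (hr : ∀ x y, φ (r x y) = r' (φ x) (φ y))
    (hdl : ∀ x, TensorProduct.map φ φ (dl x) = dl' (φ x))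
    (hdr : ∀ x, TensorProduct.map φ φ (dr x) = dr' (φ x)) :
    IsBidendriformBialgebra l' r' dl' dr' := by
  have hmul : ∀ x y, φ ((l + r) x y) = (l' + r') (φ x) (φ y) := fun x y => by
    simp only [LinearMap.add_apply, map_add, hl, hr]
  have hd : ∀ x, TensorProduct.map φ φ ((dl + dr) x) = (dl' + dr') (φ x) := fun x => by
    simp only [LinearMap.add_apply, map_add, hdl, hdr]
  refine ⟨h.dendriform.of_surjective φ hφ hl hr, h.codendriform.of_surjective φ hφ hdl hdr,
    ?_, ?_, ?_, ?_⟩ <;> refine hφ.forall₂.2 fun a b => ?_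
  · rw [← hr, ← hdr, h.coright_right]
    simp only [map_add]
    rw [TensorProduct.map_map₂_of_comm hmul hr,
      TensorProduct.map_lTensor_of_comm (f := r.flip b) (f' := r'.flip (φ b)) (hr · b),
      TensorProduct.map_lTensor_of_comm (hr a), TensorProduct.map_rTensor_of_comm (hmul a),
      TensorProduct.map_tmul, hd, hdr]
  · rw [← hl, ← hdr, h.coright_left]
    simp only [map_add]
    rw [TensorProduct.map_map₂_of_comm hmul hl,
      TensorProduct.map_lTensor_of_comm (f := l.flip b) (f' := l'.flip (φ b)) (hl · b),
      TensorProduct.map_lTensor_of_comm (hl a), hd, hdr]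
  · rw [← hr, ← hdl, h.coleft_right]
    simp only [map_add]
    rw [TensorProduct.map_map₂_of_comm hmul hr, TensorProduct.map_lTensor_of_comm (hr a),
      TensorProduct.map_rTensor_of_comm (hmul a), hd, hdl]
  · rw [← hl, ← hdl, h.coleft_left]
    simp only [map_add]
    rw [TensorProduct.map_map₂_of_comm hmul hl,
      TensorProduct.map_rTensor_of_comm (f := (l + r).flip b) (f' := (l' + r').flip (φ b))
        (hmul · b), TensorProduct.map_lTensor_of_comm (hl a), TensorProduct.map_tmul, hd, hdl]

/-- Over a field `φ` has a linear section `s`, through which the operation is defined. Since the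
operation sends the kernel of `φ` into itself in either argument, the choice of lifts does not
matter. -/
theorem exists_bilinear_of_surjective {φ : V →ₗ[K] V'} (hφ : Function.Surjective φ)
    (f : V →ₗ[K] V →ₗ[K] V) (h₁ : ∀ x y, φ x = 0 → φ (f x y) = 0)
    (h₂ : ∀ x y, φ y = 0 → φ (f x y) = 0) :
    ∃ g : V' →ₗ[K] V' →ₗ[K] V', ∀ x y, φ (f x y) = g (φ x) (φ y) := by
  obtain ⟨s, hs⟩ := φ.exists_rightInverse_of_surjective (LinearMap.range_eq_top.2 hφ)
  have hs' : ∀ x, φ (s x) = x := LinearMap.congr_fun hs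
  refine ⟨(f.compr₂ φ).compl₁₂ s s, fun x y => ?_⟩
  change φ (f x y) = φ (f (s (φ x)) (s (φ y)))
  have e1 : φ (f (x - s (φ x)) y) = 0 := h₁ _ _ (by rw [map_sub, hs', sub_self])
  have e2 : φ (f (s (φ x)) (y - s (φ y))) = 0 := h₂ _ _ (by rw [map_sub, hs', sub_self])
  rw [map_sub, LinearMap.sub_apply, map_sub, sub_eq_zero] at e1
  rw [map_sub, map_sub, sub_eq_zero] at e2
  rw [e1, e2]

theorem exists_colinear_of_surjective {φ : V →ₗ[K] V'} (hφ : Function.Surjective φ)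
    (d : V →ₗ[K] V ⊗[K] V) (h : ∀ x, φ x = 0 → TensorProduct.map φ φ (d x) = 0) :
    ∃ g : V' →ₗ[K] V' ⊗[K] V', ∀ x, TensorProduct.map φ φ (d x) = g (φ x) := by
  obtain ⟨s, hs⟩ := φ.exists_rightInverse_of_surjective (LinearMap.range_eq_top.2 hφ)
  have hs' : ∀ x, φ (s x) = x := LinearMap.congr_fun hs
  refine ⟨TensorProduct.map φ φ ∘ₗ d ∘ₗ s, fun x => ?_⟩
  have e1 := h (x - s (φ x)) (by rw [map_sub, hs', sub_self])
  rw [map_sub, map_sub, sub_eq_zero] at e1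
  exact e1

/-- Dually, values are pulled back along a linear retraction of `ι`, which loses nothing because
they lie in its range. -/
theorem exists_bilinear_of_injective {ι : V' →ₗ[K] V} (hι : Function.Injective ι)
    (f : V →ₗ[K] V →ₗ[K] V) (h : ∀ x y, f (ι x) (ι y) ∈ LinearMap.range ι) :
    ∃ g : V' →ₗ[K] V' →ₗ[K] V', ∀ x y, ι (g x y) = f (ι x) (ι y) := by
  obtain ⟨r, hr⟩ := ι.exists_leftInverse_of_injective (LinearMap.ker_eq_bot.2 hι)
  have hr' : ∀ x, r (ι x) = x := LinearMap.congr_fun hr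
  refine ⟨(f.compr₂ r).compl₁₂ ι ι, fun x y => ?_⟩
  obtain ⟨z, hz⟩ := h x y
  change ι (r (f (ι x) (ι y))) = _
  rw [← hz, hr']

theorem exists_colinear_of_injective {ι : V' →ₗ[K] V} (hι : Function.Injective ι)
    (d : V →ₗ[K] V ⊗[K] V) (h : ∀ x, d (ι x) ∈ LinearMap.range (TensorProduct.map ι ι)) :
    ∃ g : V' →ₗ[K] V' ⊗[K] V', ∀ x, TensorProduct.map ι ι (g x) = d (ι x) := by
  obtain ⟨r, hr⟩ := ι.exists_leftInverse_of_injective (LinearMap.ker_eq_bot.2 hι)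
  refine ⟨TensorProduct.map r r ∘ₗ d ∘ₗ ι, fun x => ?_⟩
  obtain ⟨z, hz⟩ := h x
  change TensorProduct.map ι ι (TensorProduct.map r r (d (ι x))) = _
  rw [← hz, ← LinearMap.comp_apply (TensorProduct.map r r), ← TensorProduct.map_comp, hr,
    TensorProduct.map_id]
  rfl

theorem TensorProduct.map_self_injective {ι : V' →ₗ[K] V} (hι : Function.Injective ι) :
    Function.Injective (TensorProduct.map ι ι) := by
  obtain ⟨r, hr⟩ := ι.exists_leftInverse_of_injective (LinearMap.ker_eq_bot.2 hι)
  refine Function.LeftInverse.injective (g := TensorProduct.map r r) fun z => ?_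
  rw [← LinearMap.comp_apply, ← TensorProduct.map_comp, hr, TensorProduct.map_id]
  rfl

end Transfer

/-! ### Morphisms, quotients and restrictions of the whole structure -/

namespace TriOps

variable {K : Type u} [Field K]
variable {H : Type v} [AddCommGroup H] [Module K H]
variable {H' : Type w} [AddCommGroup H'] [Module K H']
variable {H'' : Type*} [AddCommGroup H''] [Module K H'']
variable {D : TriOps K H} {D' : TriOps K H'} {D'' : TriOps K H''}

theorem coe_plusMap {f : H →ₗ[K] H'} (hf : ∀ x, D'.counit (f x) = D.counit x) (x : D.plus) :
    (plusMap D D' f hf x : H') = f x := rfl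

theorem plusMap_surjective {f : H →ₗ[K] H'} (hf : ∀ x, D'.counit (f x) = D.counit x)
    (hs : Function.Surjective f) : Function.Surjective (plusMap D D' f hf) := by
  rintro ⟨y, hy⟩
  obtain ⟨x, rfl⟩ := hs y
  exact ⟨⟨x, (hf x).symm.trans hy⟩, rfl⟩

theorem plusMap_injective {f : H →ₗ[K] H'} (hf : ∀ x, D'.counit (f x) = D.counit x)
    (hi : Function.Injective f) : Function.Injective (plusMap D D' f hf) := fun _ _ h =>
  Subtype.ext (hi (congrArg Subtype.val h))

theorem IsHom.isTridendriform {f : H →ₗ[K] H'} (hf : IsHom D D' f) (hs : Function.Surjective f)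
    (h : D.IsTridendriform) : D'.IsTridendriform where
  laws := h.laws.of_surjective (plusMap D D' f hf.map_counit) (plusMap_surjective _ hs)
    hf.map_left hf.map_mid hf.map_right
  mul_eq := by
    refine (plusMap_surjective hf.map_counit hs).forall₂.2 fun x y => ?_
    rw [← hf.map_left, ← hf.map_mid, ← hf.map_right, coe_plusMap, coe_plusMap, ← hf.map_mul,
      h.mul_eq]
    simp only [map_add, coe_plusMap]

theorem IsHom.isBidendriform {f : H →ₗ[K] H'} (hf : IsHom D D' f) (hs : Function.Surjective f)
    (h : D.IsBidendriform) : D'.IsBidendriform where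
  laws := h.laws.of_surjective (plusMap D D' f hf.map_counit) (plusMap_surjective _ hs)
    hf.map_left (fun x y => by
      simp only [LinearMap.add_apply, map_add, hf.map_mid, hf.map_right])
    hf.map_coleft hf.map_coright
  mul_eq := by
    refine (plusMap_surjective hf.map_counit hs).forall₂.2 fun x y => ?_
    rw [LinearMap.add_apply, LinearMap.add_apply, ← hf.map_left, ← hf.map_mid, ← hf.map_right,
      coe_plusMap, coe_plusMap, ← hf.map_mul, h.mul_eq]
    simp only [map_add, LinearMap.add_apply, coe_plusMap, Submodule.coe_add]
  comul_eq := by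
    refine (plusMap_surjective hf.map_counit hs).forall.2 fun x => ?_
    rw [← hf.map_coleft, ← hf.map_coright, coe_plusMap, ← hf.map_comul, h.comul_eq, ← hf.map_one,
      ← map_add, ← LinearMap.comp_apply (TensorProduct.map _ _), ← TensorProduct.map_comp]
    simp only [map_add, TensorProduct.map_tmul]
    rw [← LinearMap.comp_apply (TensorProduct.map f f), ← TensorProduct.map_comp,
      ← LinearMap.comp_apply (TensorProduct.map f f), ← TensorProduct.map_comp]
    rfl

theorem IsHom.comp {f : H →ₗ[K] H'} {g : H' →ₗ[K] H''} (hg : IsHom D' D'' g) (hf : IsHom D D' f) :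
    IsHom D D'' (g ∘ₗ f) := by
  have hc : ∀ x, D''.counit ((g ∘ₗ f) x) = D.counit x := fun x =>
    (hg.map_counit (f x)).trans (hf.map_counit x)
  have hp : plusMap D D'' (g ∘ₗ f) hc =
      plusMap D' D'' g hg.map_counit ∘ₗ plusMap D D' f hf.map_counit := rfl
  refine ⟨fun x y => ?_, ?_, fun x => ?_, hc, fun x y => ?_, fun x y => ?_, fun x y => ?_,
    fun x => ?_, fun x => ?_⟩
  · simp only [LinearMap.comp_apply, hf.map_mul, hg.map_mul]
  · simp only [LinearMap.comp_apply, hf.map_one, hg.map_one]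
  · rw [TensorProduct.map_comp, LinearMap.comp_apply, LinearMap.comp_apply, hf.map_comul,
      hg.map_comul]
  · simp only [hp, LinearMap.comp_apply, hf.map_left, hg.map_left]
  · simp only [hp, LinearMap.comp_apply, hf.map_mid, hg.map_mid]
  · simp only [hp, LinearMap.comp_apply, hf.map_right, hg.map_right]
  · rw [hp, TensorProduct.map_comp, LinearMap.comp_apply, LinearMap.comp_apply, hf.map_coleft,
      hg.map_coleft]
  · rw [hp, TensorProduct.map_comp, LinearMap.comp_apply, LinearMap.comp_apply, hf.map_coright,
      hg.map_coright]

theorem IsHom.symm {e : H ≃ₗ[K] H'} (he : IsHom D D' e.toLinearMap) :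
    IsHom D' D e.symm.toLinearMap := by
  have hc : ∀ x, D.counit (e.symm.toLinearMap x) = D'.counit x := fun x => by
    have := he.map_counit (e.symm x)
    simpa using this.symm
  set p := plusMap D D' e.toLinearMap he.map_counit
  set q := plusMap D' D e.symm.toLinearMap hc
  have hpq : p ∘ₗ q = LinearMap.id :=
    LinearMap.ext fun x => Subtype.ext (e.apply_symm_apply (x : H'))
  have hqp : q ∘ₗ p = LinearMap.id :=
    LinearMap.ext fun x => Subtype.ext (e.symm_apply_apply (x : H))
  have hpq' : ∀ x, p (q x) = x := LinearMap.congr_fun hpq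
  have hp : Function.Injective p := plusMap_injective _ e.injective
  have hpp := TensorProduct.map_self_injective hp
  refine ⟨fun x y => e.injective ?_, e.injective ?_, fun x =>
    TensorProduct.map_self_injective (ι := e.toLinearMap) e.injective ?_, hc, fun x y => hp ?_,
    fun x y => hp ?_, fun x y => hp ?_, fun x => hpp ?_, fun x => hpp ?_⟩
  · have := he.map_mul (e.symm x) (e.symm y)
    simpa using this.symm
  · have := he.map_one
    simpa using this.symm
  · rw [he.map_comul, ← LinearMap.comp_apply, ← TensorProduct.map_comp]
    simp
  · exact (hpq' _).trans (by rw [he.map_left, hpq', hpq'])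
  · exact (hpq' _).trans (by rw [he.map_mid, hpq', hpq'])
  · exact (hpq' _).trans (by rw [he.map_right, hpq', hpq'])
  · rw [he.map_coleft, ← LinearMap.comp_apply, ← TensorProduct.map_comp, hpq, hpq',
      TensorProduct.map_id]
    rfl
  · rw [he.map_coright, ← LinearMap.comp_apply, ← TensorProduct.map_comp, hpq, hpq',
      TensorProduct.map_id]
    rfl

theorem exists_quotient (D : TriOps K H) (I : Submodule K H) (hI : I ≤ D.plus)
    (hmul : ∀ x ∈ I, ∀ y, D.mul x y ∈ I ∧ D.mul y x ∈ I)
    (hcomul : ∀ x ∈ I, TensorProduct.map I.mkQ I.mkQ (D.comul x) = 0)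
    (hleft : ∀ x y : D.plus, (x : H) ∈ I → (D.left x y : H) ∈ I ∧ (D.left y x : H) ∈ I)
    (hmid : ∀ x y : D.plus, (x : H) ∈ I → (D.mid x y : H) ∈ I ∧ (D.mid y x : H) ∈ I)
    (hright : ∀ x y : D.plus, (x : H) ∈ I → (D.right x y : H) ∈ I ∧ (D.right y x : H) ∈ I)
    (hcoleft : ∀ x : D.plus, (x : H) ∈ I → TensorProduct.map (I.mkQ ∘ₗ D.plus.subtype)
      (I.mkQ ∘ₗ D.plus.subtype) (D.coleft x) = 0)
    (hcoright : ∀ x : D.plus, (x : H) ∈ I → TensorProduct.map (I.mkQ ∘ₗ D.plus.subtype)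
      (I.mkQ ∘ₗ D.plus.subtype) (D.coright x) = 0) :
    ∃ S : TriOps K (H ⧸ I), IsHom D S I.mkQ := by
  let ε : (H ⧸ I) →ₗ[K] K := I.liftQ D.counit hI
  let π : D.plus →ₗ[K] LinearMap.ker ε := I.mkQ.restrict fun x hx => hx
  have hπ : Function.Surjective π := by
    rintro ⟨y, hy⟩
    obtain ⟨x, rfl⟩ := I.mkQ_surjective y
    exact ⟨⟨x, hy⟩, rfl⟩
  have hπ0 : ∀ x : D.plus, π x = 0 ↔ (x : H) ∈ I := by
    intro x
    rw [← Submodule.Quotient.mk_eq_zero I]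
    exact Subtype.ext_iff
  have hI0 : ∀ x : H, I.mkQ x = 0 ↔ x ∈ I := fun x => Submodule.Quotient.mk_eq_zero I
  have hsub := TensorProduct.map_self_injective (ι := (LinearMap.ker ε).subtype)
    Subtype.val_injective
  -- The tensor square of the inclusion `ker ε → H ⧸ I` is injective, so vanishing may be tested in
  -- the larger tensor product.
  have htens : ∀ z : D.plus ⊗[K] D.plus, TensorProduct.map (I.mkQ ∘ₗ D.plus.subtype)
      (I.mkQ ∘ₗ D.plus.subtype) z = 0 → TensorProduct.map π π z = 0 := by
    intro z hz
    apply hsub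
    rw [map_zero, ← hz, ← LinearMap.comp_apply, ← TensorProduct.map_comp]
    rfl
  obtain ⟨mul, hmul'⟩ := exists_bilinear_of_surjective I.mkQ_surjective D.mul
    (fun x y hx => (hI0 _).2 (hmul x ((hI0 x).1 hx) y).1)
    (fun x y hy => (hI0 _).2 (hmul y ((hI0 y).1 hy) x).2)
  obtain ⟨comul, hcomul'⟩ := exists_colinear_of_surjective I.mkQ_surjective D.comul
    (fun x hx => hcomul x ((hI0 x).1 hx))
  obtain ⟨left, hleft'⟩ := exists_bilinear_of_surjective hπ D.left
    (fun x y hx => (hπ0 _).2 (hleft x y ((hπ0 x).1 hx)).1)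
    (fun x y hy => (hπ0 _).2 (hleft y x ((hπ0 y).1 hy)).2)
  obtain ⟨mid, hmid'⟩ := exists_bilinear_of_surjective hπ D.mid
    (fun x y hx => (hπ0 _).2 (hmid x y ((hπ0 x).1 hx)).1)
    (fun x y hy => (hπ0 _).2 (hmid y x ((hπ0 y).1 hy)).2)
  obtain ⟨right, hright'⟩ := exists_bilinear_of_surjective hπ D.right
    (fun x y hx => (hπ0 _).2 (hright x y ((hπ0 x).1 hx)).1)
    (fun x y hy => (hπ0 _).2 (hright y x ((hπ0 y).1 hy)).2)
  obtain ⟨coleft, hcoleft'⟩ := exists_colinear_of_surjective hπ D.coleft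
    (fun x hx => htens _ (hcoleft x ((hπ0 x).1 hx)))
  obtain ⟨coright, hcoright'⟩ := exists_colinear_of_surjective hπ D.coright
    (fun x hx => htens _ (hcoright x ((hπ0 x).1 hx)))
  exact ⟨⟨mul, I.mkQ D.one, comul, ε, left, mid, right, coleft, coright⟩,
    hmul', rfl, hcomul', fun _ => rfl, hleft', hmid', hright', hcoleft', hcoright'⟩

theorem exists_restrict (D : TriOps K H) (W : Submodule K H) (hone : D.one ∈ W)
    (hmul : ∀ x ∈ W, ∀ y ∈ W, D.mul x y ∈ W)
    (hcomul : ∀ x ∈ W, D.comul x ∈ LinearMap.range (TensorProduct.map W.subtype W.subtype))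
    (hleft : ∀ x y : D.plus, (x : H) ∈ W → (y : H) ∈ W → (D.left x y : H) ∈ W)
    (hmid : ∀ x y : D.plus, (x : H) ∈ W → (y : H) ∈ W → (D.mid x y : H) ∈ W)
    (hright : ∀ x y : D.plus, (x : H) ∈ W → (y : H) ∈ W → (D.right x y : H) ∈ W)
    (hcoleft : ∀ x : D.plus, (x : H) ∈ W → D.coleft x ∈ LinearMap.range
      (TensorProduct.map (W.comap D.plus.subtype).subtype (W.comap D.plus.subtype).subtype))
    (hcoright : ∀ x : D.plus, (x : H) ∈ W → D.coright x ∈ LinearMap.range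
      (TensorProduct.map (W.comap D.plus.subtype).subtype (W.comap D.plus.subtype).subtype)) :
    ∃ T : TriOps K W, IsHom T D W.subtype := by
  let ε : W →ₗ[K] K := D.counit ∘ₗ W.subtype
  let ι : LinearMap.ker ε →ₗ[K] D.plus := W.subtype.restrict fun x hx => hx
  have hι : Function.Injective ι := fun x y h =>
    Subtype.ext (Subtype.ext (congrArg (Subtype.val : D.plus → H) h))
  have hrange : ∀ x : D.plus, (x : H) ∈ W → x ∈ LinearMap.range ι := fun x hx =>
    ⟨⟨⟨x, hx⟩, x.2⟩, rfl⟩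
  -- The vectors of the augmentation ideal that lie in `W` and the kernel of the counit on `W` are
  -- the same vectors in differently nested subtypes; `j` translates between them.
  let j : W.comap D.plus.subtype →ₗ[K] LinearMap.ker ε :=
    { toFun := fun x => ⟨⟨x.1.1, x.2⟩, x.1.2⟩
      map_add' := fun _ _ => rfl
      map_smul' := fun _ _ => rfl }
  have hj : (W.comap D.plus.subtype).subtype = ι ∘ₗ j := rfl
  have htens : ∀ z ∈ LinearMap.range (TensorProduct.map (W.comap D.plus.subtype).subtype
      (W.comap D.plus.subtype).subtype), z ∈ LinearMap.range (TensorProduct.map ι ι) := by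
    rintro _ ⟨z, rfl⟩
    rw [hj, TensorProduct.map_comp]
    exact ⟨_, rfl⟩
  have hW : ∀ x : LinearMap.ker ε, ((ι x : D.plus) : H) ∈ W := fun x => x.1.2
  obtain ⟨mul, hmul'⟩ := exists_bilinear_of_injective W.injective_subtype D.mul
    (fun x y => ⟨⟨_, hmul x x.2 y y.2⟩, rfl⟩)
  obtain ⟨comul, hcomul'⟩ := exists_colinear_of_injective W.injective_subtype D.comul
    (fun x => hcomul x x.2)
  obtain ⟨left, hleft'⟩ := exists_bilinear_of_injective hι D.left
    (fun x y => hrange _ (hleft _ _ (hW x) (hW y)))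
  obtain ⟨mid, hmid'⟩ := exists_bilinear_of_injective hι D.mid
    (fun x y => hrange _ (hmid _ _ (hW x) (hW y)))
  obtain ⟨right, hright'⟩ := exists_bilinear_of_injective hι D.right
    (fun x y => hrange _ (hright _ _ (hW x) (hW y)))
  obtain ⟨coleft, hcoleft'⟩ := exists_colinear_of_injective hι D.coleft
    (fun x => htens _ (hcoleft _ (hW x)))
  obtain ⟨coright, hcoright'⟩ := exists_colinear_of_injective hι D.coright
    (fun x => htens _ (hcoright _ (hW x)))
  exact ⟨⟨mul, ⟨D.one, hone⟩, comul, ε, left, mid, right, coleft, coright⟩,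
    hmul', rfl, hcomul', fun _ => rfl, hleft', hmid', hright', hcoleft', hcoright'⟩

end TriOps

/-! ### Conilpotent bialgebras are Hopf algebras -/

section Hopf

variable {K : Type u} [Field K]

open WithConv in
-- In the convolution algebra the identity map is `1 + J`, so its inverse should be the geometric
-- series of `-J`. By hypothesis this series is finite on each element, though with no uniform
-- bound; the antipode is the pointwise eventual value of the partial sums `σ`.
theorem Bialgebra.exists_antipode {A : Type v} [Ring A] [Bialgebra K A]
    (h : ∀ x : A, ∃ n, ∀ N ≥ n,
      ((toConv LinearMap.id - 1 : WithConv (A →ₗ[K] A)) ^ N).ofConv x = 0) :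
    ∃ s : A →ₗ[K] A,
      LinearMap.mul' K A ∘ₗ s.rTensor A ∘ₗ Coalgebra.comul =
        Algebra.linearMap K A ∘ₗ Coalgebra.counit ∧
      LinearMap.mul' K A ∘ₗ s.lTensor A ∘ₗ Coalgebra.comul =
        Algebra.linearMap K A ∘ₗ Coalgebra.counit := by
  set J : WithConv (A →ₗ[K] A) := toConv LinearMap.id - 1 with hJ
  let σ : ℕ → WithConv (A →ₗ[K] A) := fun n => ∑ i ∈ Finset.range n, (-J) ^ i
  have hneg : ∀ x : A, ∃ n, ∀ N ≥ n, ((-J) ^ N).ofConv x = 0 := by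
    intro x
    obtain ⟨n, hn⟩ := h x
    refine ⟨n, fun N hN => ?_⟩
    rcases N.even_or_odd with h' | h'
    · rw [h'.neg_pow, hn N hN]
    · rw [h'.neg_pow]
      change -((J ^ N).ofConv x) = 0
      rw [hn N hN, neg_zero]
  have hstab : ∀ x : A, ∃ n, ∀ N ≥ n, (σ N).ofConv x = (σ n).ofConv x := by
    intro x
    obtain ⟨n, hn⟩ := hneg x
    refine ⟨n, fun N hN => ?_⟩
    induction N, hN using Nat.le_induction with
    | base => rfl
    | succ N hN ih =>
      have : σ (N + 1) = σ N + (-J) ^ N := Finset.sum_range_succ _ _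
      rw [this]
      change (σ N).ofConv x + ((-J) ^ N).ofConv x = _
      rw [hn N hN, add_zero, ih]
  choose n hn using hstab
  -- Linearity follows by comparing the values at a common index beyond all the stabilization points
  -- involved.
  let s : A →ₗ[K] A :=
    { toFun := fun x => (σ (n x)).ofConv x
      map_add' := fun x y => by
        have h1 := hn x (max (n (x + y)) (max (n x) (n y))) (by omega)
        have h2 := hn y (max (n (x + y)) (max (n x) (n y))) (by omega)
        have h3 := hn (x + y) (max (n (x + y)) (max (n x) (n y))) (by omega)
        rw [← h1, ← h2, ← h3, map_add]
      map_smul' := fun k x => by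
        have h1 := hn x (max (n (k • x)) (n x)) (by omega)
        have h3 := hn (k • x) (max (n (k • x)) (n x)) (by omega)
        rw [RingHom.id_apply, ← h1, ← h3, map_smul] }
  have hs : ∀ x, ∃ m, ∀ N ≥ m, s x = (σ N).ofConv x := fun x => ⟨n x, fun N hN => (hn x N hN).symm⟩
  -- A tensor is a finite sum of pure tensors, so a single partial sum computes `s ⊗ id` on it; the
  -- telescoping identity for `σ N` then applies.
  have hr : ∀ t : A ⊗[K] A, ∃ m, ∀ N ≥ m, s.rTensor A t = (σ N).ofConv.rTensor A t := by
    intro t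
    induction t with
    | zero => exact ⟨0, fun N _ => by simp⟩
    | add a b ha hb =>
      obtain ⟨m, hm⟩ := ha
      obtain ⟨m', hm'⟩ := hb
      exact ⟨max m m', fun N hN => by rw [map_add, map_add, hm N (by omega), hm' N (by omega)]⟩
    | tmul a b =>
      obtain ⟨m, hm⟩ := hs a
      exact ⟨m, fun N hN => by rw [LinearMap.rTensor_tmul, LinearMap.rTensor_tmul, hm N hN]⟩
  have hl : ∀ t : A ⊗[K] A, ∃ m, ∀ N ≥ m, s.lTensor A t = (σ N).ofConv.lTensor A t := by
    intro t
    induction t with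
    | zero => exact ⟨0, fun N _ => by simp⟩
    | add a b ha hb =>
      obtain ⟨m, hm⟩ := ha
      obtain ⟨m', hm'⟩ := hb
      exact ⟨max m m', fun N hN => by rw [map_add, map_add, hm N (by omega), hm' N (by omega)]⟩
    | tmul a b =>
      obtain ⟨m, hm⟩ := hs b
      exact ⟨m, fun N hN => by rw [LinearMap.lTensor_tmul, LinearMap.lTensor_tmul, hm N hN]⟩
  have hid : (toConv LinearMap.id : WithConv (A →ₗ[K] A)) = 1 - -J := by rw [hJ]; abel
  refine ⟨s, LinearMap.ext fun x => ?_, LinearMap.ext fun x => ?_⟩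
  · obtain ⟨m, hm⟩ := hr (Coalgebra.comul x)
    obtain ⟨m', hm'⟩ := hneg x
    have key : σ (max m m') * toConv LinearMap.id = 1 - (-J) ^ (max m m') := by
      rw [hid]; exact geom_sum_mul_neg _ _
    have key' := congrArg (fun f : WithConv (A →ₗ[K] A) => f.ofConv x) key
    change LinearMap.mul' K A ((σ (max m m')).ofConv.rTensor A (Coalgebra.comul x)) =
      (Algebra.linearMap K A ∘ₗ Coalgebra.counit) x - ((-J) ^ (max m m')).ofConv x at key'
    rw [hm' _ (by omega), sub_zero, ← hm _ (by omega)] at key'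
    exact key'
  · obtain ⟨m, hm⟩ := hl (Coalgebra.comul x)
    obtain ⟨m', hm'⟩ := hneg x
    have key : toConv LinearMap.id * σ (max m m') = 1 - (-J) ^ (max m m') := by
      rw [hid]; exact mul_neg_geom_sum _ _
    have key' := congrArg (fun f : WithConv (A →ₗ[K] A) => f.ofConv x) key
    change LinearMap.mul' K A ((σ (max m m')).ofConv.lTensor A (Coalgebra.comul x)) =
      (Algebra.linearMap K A ∘ₗ Coalgebra.counit) x - ((-J) ^ (max m m')).ofConv x at key'
    rw [hm' _ (by omega), sub_zero, ← hm _ (by omega)] at key'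
    exact key'

variable {V : Type v} [AddCommGroup V] [Module K V]

/-- The convolution powers of `id - η ε`, where `η` is the unit and `ε` the counit. -/
def reducedConvPow (mul : V →ₗ[K] V →ₗ[K] V) (one : V) (comul : V →ₗ[K] V ⊗[K] V)
    (counit : V →ₗ[K] K) : ℕ → V →ₗ[K] V
  | 0 => counit.smulRight one
  | n + 1 => TensorProduct.lift mul ∘ₗ TensorProduct.map (reducedConvPow mul one comul counit n)
      (LinearMap.id - counit.smulRight one) ∘ₗ comul

open WithConv in
theorem isHopfAlgebra_of_conilpotent (mul : V →ₗ[K] V →ₗ[K] V) (one : V)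
    (comul : V →ₗ[K] V ⊗[K] V) (counit : V →ₗ[K] K)
    (mul_assoc : ∀ x y z, mul (mul x y) z = mul x (mul y z)) (one_mul : ∀ x, mul one x = x)
    (mul_one : ∀ x, mul x one = x)
    (coassoc : ∀ x, TensorProduct.assoc K V V V (comul.rTensor V (comul x)) =
      comul.lTensor V (comul x))
    (rTensor_counit : ∀ x, counit.rTensor V (comul x) = 1 ⊗ₜ[K] x)
    (lTensor_counit : ∀ x, counit.lTensor V (comul x) = x ⊗ₜ[K] 1)
    (counit_one : counit one = 1) (counit_mul : ∀ x y, counit (mul x y) = counit x * counit y)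
    (comul_one : comul one = one ⊗ₜ[K] one)
    (comul_mul : ∀ x y, comul (mul x y) = TensorProduct.map₂ mul mul (comul x) (comul y))
    (conil : ∀ x, ∃ n, ∀ N ≥ n, reducedConvPow mul one comul counit N x = 0) :
    IsHopfAlgebra mul one comul counit := by
  let ring : Ring V :=
    { (inferInstance : AddCommGroup V) with
      mul := fun x y => mul x y
      one := one
      mul_assoc := mul_assoc
      one_mul := one_mul
      mul_one := mul_one
      left_distrib := fun x y z => map_add (mul x) y z
      right_distrib := fun x y z => LinearMap.map_add₂ mul x y z
      zero_mul := fun x => LinearMap.map_zero₂ mul x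
      mul_zero := fun x => map_zero (mul x) }
  let alg : Algebra K V := Algebra.ofModule (fun k x y => LinearMap.map_smul₂ mul k x y)
    (fun k x y => map_smul (mul x) k y)
  let coalg : Coalgebra K V :=
    { comul := comul
      counit := counit
      coassoc := LinearMap.ext coassoc
      rTensor_counit_comp_comul := LinearMap.ext rTensor_counit
      lTensor_counit_comp_comul := LinearMap.ext lTensor_counit }
  have hmap₂ : ∀ z t : V ⊗[K] V, TensorProduct.map₂ mul mul z t = z * t := by
    intro z t
    induction z with
    | zero => simp
    | add a b ha hb => rw [map_add, LinearMap.add_apply, ha, hb, add_mul]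
    | tmul a b =>
      induction t with
      | zero => simp
      | add a b ha hb => rw [map_add, ha, hb, mul_add]
      | tmul c d =>
        rw [TensorProduct.map₂_apply_tmul, TensorProduct.map_tmul,
          Algebra.TensorProduct.tmul_mul_tmul]
        rfl
  let bialg : Bialgebra K V := Bialgebra.mk' K V counit_one (fun {a b} => counit_mul a b) comul_one
    (fun {a b} => (comul_mul a b).trans (hmap₂ _ _))
  -- `reducedConvPow` uses the bare operations, so `conil` makes sense before any algebra instance
  -- exists. With the instances in place it is a genuine convolution power.
  have hpow : ∀ n, ((toConv LinearMap.id - 1 : WithConv (V →ₗ[K] V)) ^ n).ofConv =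
      reducedConvPow mul one comul counit n := by
    intro n
    induction n with
    | zero => rfl
    | succ n ih =>
      rw [pow_succ, reducedConvPow, ← ih]
      rfl
  obtain ⟨s, hs, hs'⟩ := Bialgebra.exists_antipode (K := K) (A := V) fun x => by
    obtain ⟨n, hn⟩ := conil x
    exact ⟨n, fun N hN => by rw [hpow]; exact hn N hN⟩
  let hopf : HopfAlgebra K V :=
    { bialg with
      antipode := s
      mul_antipode_rTensor_comul := hs
      mul_antipode_lTensor_comul := hs' }
  exact ⟨V, ring, hopf, LinearEquiv.refl K V, fun _ _ => rfl, rfl,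
    fun x => by simp; rfl, fun _ => rfl⟩

theorem TriOps.IsHom.isHopf {V' : Type v} [AddCommGroup V'] [Module K V'] {D : TriOps K V}
    {D' : TriOps K V'} {e : V ≃ₗ[K] V'} (he : TriOps.IsHom D D' e.toLinearMap) (h : D.IsHopf) :
    D'.IsHopf := by
  obtain ⟨A, hA, hHopf, i, hmul, hone, hcomul, hcounit⟩ := h
  have he' := he.symm
  refine ⟨A, hA, hHopf, e.symm.trans i, fun x y => ?_, ?_, fun x => ?_, fun x => ?_⟩
  · have := he'.map_mul x y
    simp only [LinearEquiv.coe_coe] at this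
    rw [LinearEquiv.trans_apply, this, hmul]; rfl
  · have := he'.map_one
    simp only [LinearEquiv.coe_coe] at this
    rw [LinearEquiv.trans_apply, this, hone]
  · have := he'.map_comul x
    rw [LinearEquiv.coe_trans, TensorProduct.map_comp, LinearMap.comp_apply, this, hcomul]
    rfl
  · exact (hcounit _).trans (he'.map_counit x)

end Hopf

/-! ### The sylvester quotient -/

namespace WQSym

theorem mem_convolution {c : ℕ → ℕ → Prop} {u v p : PackedWord} :
    p ∈ convolution c u v ↔ p.1.length = u.1.length + v.1.length ∧
      pack (p.1.take u.1.length) = u.1 ∧ pack (p.1.drop u.1.length) = v.1 ∧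
      c (maxLetter (p.1.take u.1.length)) (maxLetter (p.1.drop u.1.length)) := by
  simp only [convolution, Finset.mem_filter, mem_packedWords]

theorem mem_convolution_iff_exists {c : ℕ → ℕ → Prop} {u v p : PackedWord} :
    p ∈ convolution c u v ↔ ∃ x y, p.1 = x ++ y ∧ pack x = u.1 ∧ pack y = v.1 ∧
      c (maxLetter x) (maxLetter y) := by
  rw [mem_convolution]
  constructor
  · rintro ⟨-, h⟩
    exact ⟨_, _, (List.take_append_drop _ _).symm, h⟩
  · rintro ⟨x, y, hp, hx, hy, h⟩
    have h1 : u.1.length = x.length := by rw [← hx, length_pack]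
    have h2 : v.1.length = y.length := by rw [← hy, length_pack]
    rw [hp, h1, h2, List.take_left, List.drop_left, List.length_append]
    exact ⟨rfl, hx, hy, h⟩

/-- Replace the first factor of `p` by the word with the same letters that packs to `u`. -/
def replaceLeft (u p : PackedWord) : PackedWord :=
  toPacked (u.1.map (unrank (p.1.take u.1.length)) ++ p.1.drop u.1.length)

/-- Replace the second factor of `p` by the word with the same letters that packs to `v`. -/
def replaceRight (n : ℕ) (v p : PackedWord) : PackedWord :=
  toPacked (p.1.take n ++ v.1.map (unrank (p.1.drop n)))

theorem congr_map_unrank {u u' x : List ℕ} (h : SylvesterCongr u u') (hx : pack x = u) :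
    SylvesterCongr x (u'.map (unrank x)) := by
  subst hx
  have := h.map (strictMonoOn_unrank x)
  rwa [map_unrank_pack] at this

theorem pack_map_unrank {u u' x : List ℕ} (h : SylvesterCongr u u') (hx : pack x = u)
    (hu' : pack u' = u') : pack (u'.map (unrank x)) = u' := by
  subst hx
  rw [pack_map, hu']
  have := strictMonoOn_unrank x
  simpa only [h.mem_iff] using this

theorem pack_eq_of_congr {p p' : List ℕ} (h : SylvesterCongr p p') (hp : pack p = p) :
    pack p' = p' := by
  rw [pack_eq_self_iff] at hp ⊢
  intro a ha
  rw [← letterRank_congr h.mem_iff]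
  exact hp a ((h.mem_iff a).2 ha)

/-- The new first factor is congruent to the old one and uses the same letters. So the word stays
packed and congruent to `p`, the maxima and hence `c` are unaffected, and the replacement can be
undone. This yields a bijection between the convolutions of `u` and of `u'` with `v`. -/
theorem replaceLeft_spec {c : ℕ → ℕ → Prop} {u u' v p : PackedWord} (h : SylvesterCongr u.1 u'.1)
    (hp : p ∈ convolution c u v) :
    replaceLeft u' p ∈ convolution c u' v ∧ SylvesterCongr p.1 (replaceLeft u' p).1 ∧
      replaceLeft u (replaceLeft u' p) = p := by
  obtain ⟨x, y, hxy, hx, hy, hc⟩ := mem_convolution_iff_exists.1 hp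
  have hlen : u.1.length = x.length := by rw [← hx, length_pack]
  have hlen' : u'.1.length = x.length := by rw [← hlen, h.perm.length_eq]
  have hcx := congr_map_unrank h hx
  have hcp : SylvesterCongr p.1 (u'.1.map (unrank x) ++ y) := by
    rw [hxy]; exact hcx.append_right y
  have hval : (replaceLeft u' p).1 = u'.1.map (unrank x) ++ y := by
    rw [replaceLeft, toPacked_val, hxy, hlen', List.take_left, List.drop_left]
    rw [hxy] at hcp
    exact pack_eq_of_congr hcp (hxy ▸ p.2)
  refine ⟨mem_convolution_iff_exists.2 ⟨_, y, hval, pack_map_unrank h hx u'.2, hy, ?_⟩,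
    hval ▸ hcp, ?_⟩
  · rwa [← maxLetter_congr hcx.mem_iff]
  · apply Subtype.ext
    have h1 : u.1.length = (u'.1.map (unrank x)).length := by rw [List.length_map, hlen, hlen']
    rw [replaceLeft, toPacked_val, hval, h1, List.take_left, List.drop_left,
      ← unrank_congr hcx.mem_iff, ← hx, map_unrank_pack, ← hxy, p.2]

theorem replaceRight_spec {c : ℕ → ℕ → Prop} {u v v' p : PackedWord} (h : SylvesterCongr v.1 v'.1)
    (hp : p ∈ convolution c u v) :
    replaceRight u.1.length v' p ∈ convolution c u v' ∧
      SylvesterCongr p.1 (replaceRight u.1.length v' p).1 ∧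
      replaceRight u.1.length v (replaceRight u.1.length v' p) = p := by
  obtain ⟨x, y, hxy, hx, hy, hc⟩ := mem_convolution_iff_exists.1 hp
  have hlen : u.1.length = x.length := by rw [← hx, length_pack]
  have hcy := congr_map_unrank h hy
  have hcp : SylvesterCongr p.1 (x ++ v'.1.map (unrank y)) := by
    rw [hxy]; exact hcy.append_left x
  have hval : (replaceRight u.1.length v' p).1 = x ++ v'.1.map (unrank y) := by
    rw [replaceRight, toPacked_val, hxy, hlen, List.take_left, List.drop_left]
    rw [hxy] at hcp
    exact pack_eq_of_congr hcp (hxy ▸ p.2)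
  refine ⟨mem_convolution_iff_exists.2 ⟨x, _, hval, hx, pack_map_unrank h hy v'.2, ?_⟩,
    hval ▸ hcp, ?_⟩
  · rwa [← maxLetter_congr hcy.mem_iff]
  · apply Subtype.ext
    rw [replaceRight, toPacked_val, hval, hlen, List.take_left, List.drop_left,
      ← unrank_congr hcy.mem_iff, ← hy, map_unrank_pack, ← hxy, p.2]

variable (K : Type u) [Field K]

theorem mkQ_M_eq {u v : PackedWord} (h : SylvesterCongr u.1 v.1) :
    (sylvesterIdeal K).mkQ (M K u) = (sylvesterIdeal K).mkQ (M K v) := by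
  rw [← sub_eq_zero, ← map_sub, Submodule.mkQ_apply, Submodule.Quotient.mk_eq_zero]
  exact Submodule.subset_span ⟨u, v, h, rfl⟩

variable {K} in
theorem eq_zero_of_mem_sylvesterIdeal {V : Type*} [AddCommGroup V] [Module K V]
    (f : WQSym K →ₗ[K] V) (hf : ∀ u v : PackedWord, SylvesterCongr u.1 v.1 → f (M K u) = f (M K v))
    {x : WQSym K} (hx : x ∈ sylvesterIdeal K) : f x = 0 := by
  have : sylvesterIdeal K ≤ LinearMap.ker f := by
    refine Submodule.span_le.2 ?_
    rintro _ ⟨u, v, h, rfl⟩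
    rw [SetLike.mem_coe, LinearMap.mem_ker, map_sub, hf u v h, sub_self]
  exact this hx

theorem convProd_M (c : ℕ → ℕ → Prop) (u v : PackedWord) :
    convProd K c (M K u) (M K v) = ∑ p ∈ convolution c u v, M K p := by
  rw [convProd, lift_M, lift_M]

/-- Replacing a factor by a congruent one permutes the terms of the product up to congruence,
whatever the condition on the maxima. -/
theorem convProd_mem_sylvesterIdeal (c : ℕ → ℕ → Prop) {x : WQSym K} (hx : x ∈ sylvesterIdeal K)
    (y : WQSym K) : convProd K c x y ∈ sylvesterIdeal K ∧ convProd K c y x ∈ sylvesterIdeal K := by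
  constructor
  · rw [← Submodule.Quotient.mk_eq_zero]
    refine eq_zero_of_mem_sylvesterIdeal
      ((sylvesterIdeal K).mkQ ∘ₗ (convProd K c).flip y) (fun u u' h => ?_) hx
    suffices key : (sylvesterIdeal K).mkQ ∘ₗ convProd K c (M K u) =
        (sylvesterIdeal K).mkQ ∘ₗ convProd K c (M K u') from LinearMap.congr_fun key y
    refine hom_ext_M fun v => ?_
    rw [LinearMap.comp_apply, LinearMap.comp_apply, convProd_M, convProd_M, map_sum, map_sum]
    exact Finset.sum_nbij' (replaceLeft u') (replaceLeft u) (fun p hp => (replaceLeft_spec h hp).1)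
      (fun p hp => (replaceLeft_spec h.symm hp).1) (fun p hp => (replaceLeft_spec h hp).2.2)
      (fun p hp => (replaceLeft_spec h.symm hp).2.2)
      (fun p hp => mkQ_M_eq K (replaceLeft_spec h hp).2.1)
  · rw [← Submodule.Quotient.mk_eq_zero]
    refine eq_zero_of_mem_sylvesterIdeal
      ((sylvesterIdeal K).mkQ ∘ₗ convProd K c y) (fun v v' h => ?_) hx
    suffices key : (sylvesterIdeal K).mkQ ∘ₗ (convProd K c).flip (M K v) =
        (sylvesterIdeal K).mkQ ∘ₗ (convProd K c).flip (M K v') from LinearMap.congr_fun key y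
    refine hom_ext_M fun u => ?_
    rw [LinearMap.comp_apply, LinearMap.comp_apply, LinearMap.flip_apply, LinearMap.flip_apply,
      convProd_M, convProd_M, map_sum, map_sum]
    exact Finset.sum_nbij' (replaceRight u.1.length v') (replaceRight u.1.length v)
      (fun p hp => (replaceRight_spec h hp).1)
      (fun p hp => (replaceRight_spec h.symm hp).1) (fun p hp => (replaceRight_spec h hp).2.2)
      (fun p hp => (replaceRight_spec h.symm hp).2.2)
      (fun p hp => mkQ_M_eq K (replaceRight_spec h hp).2.1)

theorem mkQ_M_lower {u v : PackedWord} (h : SylvesterCongr u.1 v.1) (k : ℕ) :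
    (sylvesterIdeal K).mkQ (M K (lower u k)) = (sylvesterIdeal K).mkQ (M K (lower v k)) :=
  mkQ_M_eq K (h.filter_le k).pack

theorem mkQ_M_upper {u v : PackedWord} (h : SylvesterCongr u.1 v.1) (k : ℕ) :
    (sylvesterIdeal K).mkQ (M K (upper u k)) = (sylvesterIdeal K).mkQ (M K (upper v k)) :=
  mkQ_M_eq K (h.filter_gt k).pack

theorem counit_M_congr {u v : PackedWord} (h : SylvesterCongr u.1 v.1) :
    counit K (M K u) = counit K (M K v) := by
  rw [counit_M, counit_M]
  refine if_congr ?_ rfl rfl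
  rw [← List.length_eq_zero_iff, h.perm.length_eq, List.length_eq_zero_iff]

theorem sylvesterIdeal_le_plus : sylvesterIdeal K ≤ plus K := fun _ hx =>
  eq_zero_of_mem_sylvesterIdeal (counit K) (fun _ _ h => counit_M_congr K h) hx

theorem map_mkQ_comul {x : WQSym K} (hx : x ∈ sylvesterIdeal K) :
    TensorProduct.map (sylvesterIdeal K).mkQ (sylvesterIdeal K).mkQ (comul K x) = 0 := by
  refine eq_zero_of_mem_sylvesterIdeal
    (TensorProduct.map (sylvesterIdeal K).mkQ (sylvesterIdeal K).mkQ ∘ₗ comul K)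
    (fun u v h => ?_) hx
  rw [LinearMap.comp_apply, LinearMap.comp_apply, comul_M, comul_M, map_sum, map_sum,
    maxLetter_congr h.mem_iff]
  refine Finset.sum_congr rfl fun k _ => ?_
  rw [TensorProduct.map_tmul, TensorProduct.map_tmul, mkQ_M_lower K h, mkQ_M_upper K h]

/-- Congruent words have the same last letter and the same maximum, so the same cuts are selected,
and the pieces are congruent one by one. -/
theorem map_mkQ_halfComul (c : ℕ → ℕ → Prop) [DecidableRel c] {x : plus K}
    (hx : (x : WQSym K) ∈ sylvesterIdeal K) :
    TensorProduct.map ((sylvesterIdeal K).mkQ ∘ₗ (plus K).subtype)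
      ((sylvesterIdeal K).mkQ ∘ₗ (plus K).subtype) (halfComul K c x) = 0 := by
  have key := eq_zero_of_mem_sylvesterIdeal
    (TensorProduct.map ((sylvesterIdeal K).mkQ ∘ₗ (plus K).subtype)
      ((sylvesterIdeal K).mkQ ∘ₗ (plus K).subtype) ∘ₗ halfComul K c ∘ₗ proj K)
    (fun u v h => ?_) hx
  · rwa [LinearMap.comp_apply, LinearMap.comp_apply, proj_coe] at key
  · have hM : ∀ u v : PackedWord, SylvesterCongr u.1 v.1 →
        (sylvesterIdeal K).mkQ (MPlus K u : WQSym K) =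
          (sylvesterIdeal K).mkQ (MPlus K v : WQSym K) := by
      intro u v h
      rw [MPlus, MPlus, coe_proj, coe_proj, map_sub, map_sub, mkQ_M_eq K h, counit_M_congr K h]
    change TensorProduct.map _ _ (halfComul K c (MPlus K u)) =
      TensorProduct.map _ _ (halfComul K c (MPlus K v))
    rw [halfComul_MPlus, halfComul_MPlus, map_sum, map_sum, maxLetter_congr h.mem_iff,
      h.getLastD_eq]
    refine Finset.sum_congr rfl fun k _ => ?_
    split_ifs
    · rw [TensorProduct.map_tmul, TensorProduct.map_tmul, LinearMap.comp_apply,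
        LinearMap.comp_apply, LinearMap.comp_apply, LinearMap.comp_apply]
      exact congrArg₂ (· ⊗ₜ[K] ·) (hM _ _ (h.filter_le k).pack) (hM _ _ (h.filter_gt k).pack)
    · rfl

theorem exists_sylvesterQuotient_ops :
    ∃ S : TriOps K (SylvesterQuotient K), TriOps.IsHom (ops K) S (sylvesterIdeal K).mkQ := by
  have hpart : ∀ (c : ℕ → ℕ → Prop) (x y : plus K), (x : WQSym K) ∈ sylvesterIdeal K →
      (partialProd K c x y : WQSym K) ∈ sylvesterIdeal K ∧
        (partialProd K c y x : WQSym K) ∈ sylvesterIdeal K := by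
    intro c x y hx
    rw [coe_partialProd, coe_partialProd]
    exact convProd_mem_sylvesterIdeal K c hx y
  refine TriOps.exists_quotient (ops K) (sylvesterIdeal K) (sylvesterIdeal_le_plus K)
    ?_ ?_ ?_ ?_ ?_ ?_ ?_
  · exact fun x hx y => convProd_mem_sylvesterIdeal K (fun _ _ => True) hx y
  · exact fun x hx => map_mkQ_comul K hx
  · exact hpart fun a b => b < a
  · exact hpart fun a b => b = a
  · exact hpart fun a b => a < b
  · exact fun x hx => map_mkQ_halfComul K (fun a k => a ≤ k) hx
  · exact fun x hx => map_mkQ_halfComul K (fun a k => k < a) hx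

variable {K} in
-- Each convolution factor splits off an upper piece. If that piece is empty, it is killed by `id -
-- η ε`; otherwise the lower piece misses the maximal letter and is strictly shorter. So the length
-- bounds the number of steps.
theorem reducedConvPow_mkQ_M {S : TriOps K (SylvesterQuotient K)}
    (hS : TriOps.IsHom (ops K) S (sylvesterIdeal K).mkQ) (N : ℕ) (w : PackedWord)
    (hw : w.1.length < N) :
    reducedConvPow S.mul S.one S.comul S.counit N ((sylvesterIdeal K).mkQ (M K w)) = 0 := by
  have hcomul : ∀ w : PackedWord, S.comul ((sylvesterIdeal K).mkQ (M K w)) =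
      ∑ k ∈ Finset.range (maxLetter w.1 + 1),
        (sylvesterIdeal K).mkQ (M K (lower w k)) ⊗ₜ[K]
          (sylvesterIdeal K).mkQ (M K (upper w k)) := by
    intro w
    rw [← hS.map_comul]
    change TensorProduct.map _ _ (comul K (M K w)) = _
    rw [comul_M, map_sum]
    rfl
  have hone : S.one = (sylvesterIdeal K).mkQ (M K (toPacked [])) := hS.map_one.symm
  have hc1 : S.counit S.one = 1 := by
    rw [← hS.map_one, hS.map_counit]; exact counit_one' K
  induction N generalizing w with
  | zero => omega
  | succ N ih =>
    rw [reducedConvPow, LinearMap.comp_apply, LinearMap.comp_apply, hcomul, map_sum, map_sum]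
    refine Finset.sum_eq_zero fun k hk => ?_
    rw [Finset.mem_range] at hk
    rw [TensorProduct.map_tmul, TensorProduct.lift.tmul]
    by_cases hk' : k = maxLetter w.1
    · have : upper w k = toPacked [] := Subtype.ext ((upper_eq_nil_iff (by omega)).2 hk')
      rw [this, ← hone, LinearMap.sub_apply, LinearMap.smulRight_apply, hc1, one_smul,
        LinearMap.id_apply, sub_self, map_zero]
    · rw [ih (lower w k), LinearMap.map_zero₂]
      rw [lower_val]
      have hne : w.1 ≠ [] := by
        intro h
        rw [h, maxLetter_nil] at hk hk'
        omega
      have : (w.1.filter (fun a => a ≤ k)).length < w.1.length :=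
        List.length_filter_lt_length_iff_exists.2
          ⟨maxLetter w.1, maxLetter_mem hne, by simp; omega⟩
      omega

variable {K} in
theorem isHopf_of_isHom_mkQ {S : TriOps K (SylvesterQuotient K)}
    (hS : TriOps.IsHom (ops K) S (sylvesterIdeal K).mkQ) : S.IsHopf := by
  have hsurj := (sylvesterIdeal K).mkQ_surjective
  have hc1 : S.counit S.one = 1 := by
    rw [← hS.map_one, hS.map_counit]; exact counit_one' K
  refine isHopfAlgebra_of_conilpotent _ _ _ _ (hsurj.forall₃.2 fun x y z => ?_)
    (hsurj.forall.2 fun x => ?_) (hsurj.forall.2 fun x => ?_) (hsurj.forall.2 fun x => ?_)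
    (hsurj.forall.2 fun x => ?_) (hsurj.forall.2 fun x => ?_) hc1
    (hsurj.forall₂.2 fun x y => ?_) ?_ (hsurj.forall₂.2 fun x y => ?_) (hsurj.forall.2 fun x => ?_)
  · rw [← hS.map_mul, ← hS.map_mul, ← hS.map_mul, ← hS.map_mul, mul_assoc']
  · rw [← hS.map_one, ← hS.map_mul, one_mul']
  · rw [← hS.map_one, ← hS.map_mul, mul_one']
  · rw [← hS.map_comul, TensorProduct.rTensor_map_of_comm hS.map_comul,
      TensorProduct.lTensor_map_of_comm hS.map_comul]
    exact congrArg _ (coassoc K x)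
  · have h := rTensor_counit_comul K x
    rw [← hS.map_comul, ← LinearMap.comp_apply, LinearMap.rTensor_comp_map,
      show S.counit ∘ₗ (sylvesterIdeal K).mkQ = counit K from LinearMap.ext hS.map_counit,
      ← LinearMap.lTensor_comp_rTensor, LinearMap.comp_apply]
    exact (congrArg _ h).trans (LinearMap.lTensor_tmul _ _ _ _)
  · have h := lTensor_counit_comul K x
    rw [← hS.map_comul, ← LinearMap.comp_apply, LinearMap.lTensor_comp_map,
      show S.counit ∘ₗ (sylvesterIdeal K).mkQ = counit K from LinearMap.ext hS.map_counit,
      ← LinearMap.rTensor_comp_lTensor, LinearMap.comp_apply]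
    exact (congrArg _ h).trans (LinearMap.rTensor_tmul _ _ _ _)
  · rw [← hS.map_mul, hS.map_counit, hS.map_counit, hS.map_counit, counit_mul']
  · rw [← hS.map_one, ← hS.map_comul, comul_one', TensorProduct.map_tmul]
  · rw [← hS.map_mul, ← hS.map_comul, ← hS.map_comul, ← hS.map_comul, comul_mul',
      TensorProduct.map_map₂_of_comm hS.map_mul hS.map_mul]
  · induction x using Finsupp.induction_linear with
    | zero => exact ⟨0, fun N _ => by rw [map_zero, map_zero]⟩
    | add x y hx hy =>
      obtain ⟨m, hm⟩ := hx
      obtain ⟨m', hm'⟩ := hy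
      exact ⟨max m m', fun N hN => by
        rw [map_add, map_add, hm N (by omega), hm' N (by omega), add_zero]⟩
    | single w k =>
      refine ⟨w.1.length + 1, fun N hN => ?_⟩
      have h : (Finsupp.single w k : WQSym K) = k • M K w := by simp [M]
      rw [h, map_smul, map_smul, reducedConvPow_mkQ_M hS N w (by omega), smul_zero]

end WQSym

/-! ### Stability of `TD` under the operations -/

section TensorSquare

variable {K : Type u} [Field K] {V : Type v} [AddCommMonoid V] [Module K V]

/-- The image of `G ⊗ G` in `V ⊗ V`. -/
def tensorSquare (G : Submodule K V) : Submodule K (V ⊗[K] V) :=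
  LinearMap.range (TensorProduct.map G.subtype G.subtype)

theorem tmul_mem_tensorSquare {G : Submodule K V} {x y : V} (hx : x ∈ G) (hy : y ∈ G) :
    x ⊗ₜ[K] y ∈ tensorSquare G := ⟨⟨x, hx⟩ ⊗ₜ[K] ⟨y, hy⟩, rfl⟩

theorem map_mem_of_mem_tensorSquare {Z : Type*} [AddCommMonoid Z] [Module K Z] {G : Submodule K V}
    (f : V ⊗[K] V →ₗ[K] Z) {Q : Submodule K Z} (h : ∀ x ∈ G, ∀ y ∈ G, f (x ⊗ₜ[K] y) ∈ Q)
    {z : V ⊗[K] V} (hz : z ∈ tensorSquare G) : f z ∈ Q := by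
  obtain ⟨z, rfl⟩ := hz
  induction z with
  | zero => simp
  | add a b ha hb => rw [map_add, map_add]; exact Q.add_mem ha hb
  | tmul a b => exact h a a.2 b b.2

theorem lTensor_mem_tensorSquare {G : Submodule K V} {f : V →ₗ[K] V} (hf : ∀ x ∈ G, f x ∈ G)
    {z : V ⊗[K] V} (hz : z ∈ tensorSquare G) : f.lTensor V z ∈ tensorSquare G :=
  map_mem_of_mem_tensorSquare _ (fun _ hx y hy => tmul_mem_tensorSquare hx (hf y hy)) hz

theorem rTensor_mem_tensorSquare {G : Submodule K V} {f : V →ₗ[K] V} (hf : ∀ x ∈ G, f x ∈ G)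
    {z : V ⊗[K] V} (hz : z ∈ tensorSquare G) : f.rTensor V z ∈ tensorSquare G :=
  map_mem_of_mem_tensorSquare _ (fun x hx _ hy => tmul_mem_tensorSquare (hf x hx) hy) hz

theorem map₂_mem_tensorSquare {G : Submodule K V} {f g : V →ₗ[K] V →ₗ[K] V}
    (hf : ∀ x ∈ G, ∀ y ∈ G, f x y ∈ G) (hg : ∀ x ∈ G, ∀ y ∈ G, g x y ∈ G) {z z' : V ⊗[K] V}
    (hz : z ∈ tensorSquare G) (hz' : z' ∈ tensorSquare G) :
    TensorProduct.map₂ f g z z' ∈ tensorSquare G := by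
  refine map_mem_of_mem_tensorSquare ((TensorProduct.map₂ f g).flip z') (fun x hx y hy => ?_) hz
  refine map_mem_of_mem_tensorSquare (TensorProduct.map₂ f g (x ⊗ₜ[K] y)) (fun a ha b hb => ?_) hz'
  rw [TensorProduct.map₂_apply_tmul, TensorProduct.map_tmul]
  exact tmul_mem_tensorSquare (hf x hx a ha) (hg y hy b hb)

end TensorSquare

namespace WQSym

variable (K : Type u) [Field K]

/-- The sub-trialgebra of the augmentation ideal generated by `M_1`. -/
def TDPlus : Submodule K (plus K) := (ops K).generatedSubtrialgebra (MOne K)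

theorem MOne_eq : MOne K = MPlus K (toPacked [1]) := rfl

theorem MOne_mem_TDPlus : MOne K ∈ TDPlus K :=
  (Submodule.mem_sInf (R := K) (M := plus K)).2 fun _ hP => hP.1

theorem ops_mem_TDPlus {x y : plus K} (hx : x ∈ TDPlus K) (hy : y ∈ TDPlus K) :
    partialProd K (fun a b => b < a) x y ∈ TDPlus K ∧
      partialProd K (fun a b => b = a) x y ∈ TDPlus K ∧
      partialProd K (fun a b => a < b) x y ∈ TDPlus K := by
  replace hx := (Submodule.mem_sInf (R := K) (M := plus K)).1 hx
  replace hy := (Submodule.mem_sInf (R := K) (M := plus K)).1 hy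
  have h : ∀ P ∈ {P : Submodule K (plus K) | MOne K ∈ P ∧ ∀ y ∈ P, ∀ z ∈ P,
      (ops K).left y z ∈ P ∧ (ops K).mid y z ∈ P ∧ (ops K).right y z ∈ P},
      (ops K).left x y ∈ P ∧ (ops K).mid x y ∈ P ∧ (ops K).right x y ∈ P :=
    fun P hP => hP.2 x (hx P hP) y (hy P hP)
  exact ⟨(Submodule.mem_sInf (R := K) (M := plus K)).2 fun P hP => (h P hP).1,
    (Submodule.mem_sInf (R := K) (M := plus K)).2 fun P hP => (h P hP).2.1, (Submodule.mem_sInf (R := K) (M := plus K)).2 fun P hP => (h P hP).2.2⟩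

theorem TDPlus_le {P : Submodule K (plus K)} (h1 : MOne K ∈ P)
    (h2 : ∀ x ∈ P, ∀ y ∈ P, partialProd K (fun a b => b < a) x y ∈ P ∧
      partialProd K (fun a b => b = a) x y ∈ P ∧ partialProd K (fun a b => a < b) x y ∈ P) :
    TDPlus K ≤ P := sInf_le ⟨h1, h2⟩

theorem partialProd_true_mem_TDPlus {x y : plus K} (hx : x ∈ TDPlus K) (hy : y ∈ TDPlus K) :
    partialProd K (fun _ _ => True) x y ∈ TDPlus K := by
  obtain ⟨h1, h2, h3⟩ := ops_mem_TDPlus K hx hy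
  rw [← partialProd_gt_add_eq_add_lt]
  exact add_mem (add_mem h1 h2) h3

theorem halfComul_MOne (c : ℕ → ℕ → Prop) [DecidableRel c] : halfComul K c (MOne K) = 0 := by
  have h1 : maxLetter (toPacked [1]).1 = 1 := by decide
  have h2 : lower (toPacked [1]) 0 = toPacked [] := by decide
  have h3 : upper (toPacked [1]) 1 = toPacked [] := by decide
  rw [MOne_eq, halfComul_MPlus, h1, Finset.sum_range_succ, Finset.sum_range_one, h2, h3]
  simp only [MPlus, proj_one, TensorProduct.zero_tmul, TensorProduct.tmul_zero, ite_self, add_zero]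

/-- The elements of TD⁺ whose two halves lie in the tensor square form a sub-trialgebra, by the
formulas for half-coproducts of partial products, and it contains `M_1`, on which both halves
vanish. -/
theorem halfComul_mem_tensorSquare {x : plus K} (hx : x ∈ TDPlus K) :
    halfComul K (fun a k => a ≤ k) x ∈ tensorSquare (TDPlus K) ∧
      halfComul K (fun a k => k < a) x ∈ tensorSquare (TDPlus K) := by
  let P : Submodule K (plus K) := TDPlus K ⊓
    ((tensorSquare (TDPlus K)).comap (halfComul K fun a k => a ≤ k) ⊓
      (tensorSquare (TDPlus K)).comap (halfComul K fun a k => k < a))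
  suffices h : TDPlus K ≤ P from (h hx).2
  have hstep : ∀ c : ℕ → ℕ → Prop, IsOrderCond c →
      (∀ x ∈ TDPlus K, ∀ y ∈ TDPlus K, partialProd K c x y ∈ TDPlus K) →
      ∀ x ∈ P, ∀ y ∈ P, partialProd K c x y ∈ P := by
    intro c hc hmem x ⟨hx, hxl, hxr⟩ y ⟨hy, hyl, hyr⟩
    have hmul : ∀ x ∈ TDPlus K, ∀ y ∈ TDPlus K,
        partialProd K (fun _ _ => True) x y ∈ TDPlus K :=
      fun _ hx _ hy => partialProd_true_mem_TDPlus K hx hy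
    have hxt : halfComul K (fun _ _ => True) x ∈ tensorSquare (TDPlus K) := by
      rw [← halfComul_le_add_gt]
      exact add_mem hxl hxr
    refine ⟨hmem x hx y hy, ?_, ?_⟩
    · change halfComul K (fun a k => a ≤ k) (partialProd K c x y) ∈ tensorSquare (TDPlus K)
      rw [halfComul_le_partialProd K hc]
      refine add_mem (add_mem (add_mem (map₂_mem_tensorSquare hmul hmem hxt hyl)
        (lTensor_mem_tensorSquare (hmem x hx) hyl)) ?_) ?_
      · split_ifs
        · exact rTensor_mem_tensorSquare (hmul x hx) hyl
        · exact zero_mem _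
      · split_ifs
        · exact add_mem (rTensor_mem_tensorSquare (fun z hz => hmul z hz y hy) hxt)
            (tmul_mem_tensorSquare hy hx)
        · exact zero_mem _
    · change halfComul K (fun a k => k < a) (partialProd K c x y) ∈ tensorSquare (TDPlus K)
      rw [halfComul_gt_partialProd K hc]
      refine add_mem (add_mem (add_mem (map₂_mem_tensorSquare hmul hmem hxt hyr)
        (lTensor_mem_tensorSquare (fun z hz => hmem z hz y hy) hxt))
        (lTensor_mem_tensorSquare (hmem x hx) hyr)) ?_
      split_ifs
      · exact add_mem (rTensor_mem_tensorSquare (hmul x hx) hyr) (tmul_mem_tensorSquare hx hy)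
      · exact zero_mem _
  refine TDPlus_le K ⟨MOne_mem_TDPlus K, ?_, ?_⟩ fun x hx y hy => ⟨?_, ?_, ?_⟩
  · change halfComul K (fun a k => a ≤ k) (MOne K) ∈ tensorSquare (TDPlus K)
    rw [halfComul_MOne]
    exact zero_mem _
  · change halfComul K (fun a k => k < a) (MOne K) ∈ tensorSquare (TDPlus K)
    rw [halfComul_MOne]
    exact zero_mem _
  · exact hstep _ isOrderCond_gt (fun x hx y hy => (ops_mem_TDPlus K hx hy).1) x hx y hy
  · exact hstep _ isOrderCond_eq (fun x hx y hy => (ops_mem_TDPlus K hx hy).2.1) x hx y hy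
  · exact hstep _ isOrderCond_lt (fun x hx y hy => (ops_mem_TDPlus K hx hy).2.2) x hx y hy

theorem mem_TD_iff {x : WQSym K} :
    x ∈ TD K ↔ ∃ (k : K) (y : plus K), y ∈ TDPlus K ∧ x = k • (ops K).one + y := by
  rw [TD, Submodule.mem_sup]
  constructor
  · rintro ⟨a, ha, _, ⟨y, hy, rfl⟩, rfl⟩
    obtain ⟨k, rfl⟩ := Submodule.mem_span_singleton.1 ha
    exact ⟨k, y, hy, rfl⟩
  · rintro ⟨k, y, hy, rfl⟩
    exact ⟨_, Submodule.smul_mem _ k (Submodule.mem_span_singleton_self _), _, ⟨y, hy, rfl⟩, rfl⟩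

theorem one_mem_TD : (ops K).one ∈ TD K :=
  (mem_TD_iff K).2 ⟨1, 0, zero_mem _, by simp⟩

/-- The counit reads off the coefficient of the unit, which must therefore vanish. -/
theorem coe_mem_TD_iff {x : plus K} : (x : WQSym K) ∈ TD K ↔ x ∈ TDPlus K := by
  rw [mem_TD_iff]
  constructor
  · rintro ⟨k, y, hy, h⟩
    have h' := congrArg (ops K).counit h
    rw [map_add, map_smul, counit_one'] at h'
    have hx : (ops K).counit (x : WQSym K) = 0 := x.2
    have hy' : (ops K).counit (y : WQSym K) = 0 := y.2
    rw [hx, hy', add_zero, smul_eq_mul, mul_one] at h'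
    rw [← h', zero_smul, zero_add] at h
    rwa [Subtype.ext h]
  · intro hx
    exact ⟨0, x, hx, by rw [zero_smul, zero_add]⟩

theorem mul_mem_TD {x y : WQSym K} (hx : x ∈ TD K) (hy : y ∈ TD K) : (ops K).mul x y ∈ TD K := by
  obtain ⟨k, a, ha, rfl⟩ := (mem_TD_iff K).1 hx
  obtain ⟨k', b, hb, rfl⟩ := (mem_TD_iff K).1 hy
  have hab : (ops K).mul a b ∈ TD K := by
    have := (coe_mem_TD_iff K).2 (partialProd_true_mem_TDPlus K ha hb)
    rwa [coe_partialProd] at this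
  simp only [map_add, map_smul, LinearMap.add_apply, LinearMap.smul_apply, one_mul', mul_one']
  have ha' := (coe_mem_TD_iff K).2 ha
  have hb' := (coe_mem_TD_iff K).2 hb
  have h1 := one_mem_TD K
  exact add_mem (Submodule.smul_mem _ _ (add_mem (Submodule.smul_mem _ _ h1) ha'))
    (add_mem (Submodule.smul_mem _ _ hb') hab)

theorem comul_mem_tensorSquare_TD {x : WQSym K} (hx : x ∈ TD K) :
    (ops K).comul x ∈ tensorSquare (TD K) := by
  obtain ⟨k, a, ha, rfl⟩ := (mem_TD_iff K).1 hx
  have h1 := one_mem_TD K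
  have ha' := (coe_mem_TD_iff K).2 ha
  rw [map_add, map_smul, comul_one']
  refine add_mem (Submodule.smul_mem _ _ (tmul_mem_tensorSquare h1 h1)) ?_
  change comul K (a : WQSym K) ∈ _
  rw [comul_eq_halfComul, ← halfComul_le_add_gt]
  obtain ⟨hl, hr⟩ := halfComul_mem_tensorSquare K ha
  refine add_mem (add_mem ?_ (tmul_mem_tensorSquare ha' h1)) (tmul_mem_tensorSquare h1 ha')
  exact map_mem_of_mem_tensorSquare (TensorProduct.map (plus K).subtype (plus K).subtype)
    (fun x hx y hy => tmul_mem_tensorSquare ((coe_mem_TD_iff K).2 hx) ((coe_mem_TD_iff K).2 hy))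
    (add_mem hl hr)

theorem exists_TD_ops : ∃ T : TriOps K (TD K), TriOps.IsHom T (ops K) (TD K).subtype := by
  have hcomap : (TD K).comap (plus K).subtype = TDPlus K := by
    ext x
    exact coe_mem_TD_iff K
  refine TriOps.exists_restrict (ops K) (TD K) (one_mem_TD K) ?_ ?_ ?_ ?_ ?_ ?_ ?_
  · exact fun x hx y hy => mul_mem_TD K hx hy
  · exact fun x hx => comul_mem_tensorSquare_TD K hx
  · exact fun x y hx hy => (coe_mem_TD_iff K).2
      (ops_mem_TDPlus K ((coe_mem_TD_iff K).1 hx) ((coe_mem_TD_iff K).1 hy)).1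
  · exact fun x y hx hy => (coe_mem_TD_iff K).2
      (ops_mem_TDPlus K ((coe_mem_TD_iff K).1 hx) ((coe_mem_TD_iff K).1 hy)).2.1
  · exact fun x y hx hy => (coe_mem_TD_iff K).2
      (ops_mem_TDPlus K ((coe_mem_TD_iff K).1 hx) ((coe_mem_TD_iff K).1 hy)).2.2
  · intro x hx
    change halfComul K (fun a k => a ≤ k) x ∈ tensorSquare ((TD K).comap (plus K).subtype)
    rw [hcomap]
    exact (halfComul_mem_tensorSquare K ((coe_mem_TD_iff K).1 hx)).1
  · intro x hx
    change halfComul K (fun a k => k < a) x ∈ tensorSquare ((TD K).comap (plus K).subtype)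
    rw [hcomap]
    exact (halfComul_mem_tensorSquare K ((coe_mem_TD_iff K).1 hx)).2

end WQSym

/-! ### Normal forms -/

/-- The letters before the last letter of `w` that do not exceed it. -/
def smallPart (w : List ℕ) : List ℕ := w.dropLast.filter (fun a => a ≤ w.getLastD 0)

/-- The letters before the last letter of `w` that exceed it. -/
def largePart (w : List ℕ) : List ℕ := w.dropLast.filter (fun a => w.getLastD 0 < a)

theorem length_smallPart_lt {w : List ℕ} (hw : w ≠ []) : (smallPart w).length < w.length := by
  have h1 := List.length_filter_le (fun a => decide (a ≤ w.getLastD 0)) w.dropLast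
  have h2 := List.length_pos_iff.2 hw
  rw [List.length_dropLast] at h1
  unfold smallPart
  omega

theorem length_largePart_lt {w : List ℕ} (hw : w ≠ []) : (largePart w).length < w.length := by
  have h1 := List.length_filter_le (fun a => decide (w.getLastD 0 < a)) w.dropLast
  have h2 := List.length_pos_iff.2 hw
  rw [List.length_dropLast] at h1
  unfold largePart
  omega

theorem smallPart_concat (w : List ℕ) (r : ℕ) :
    smallPart (w ++ [r]) = w.filter (fun a => a ≤ r) := by
  rw [smallPart, getLastD_append_singleton, List.dropLast_concat]

theorem largePart_concat (w : List ℕ) (r : ℕ) :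
    largePart (w ++ [r]) = w.filter (fun a => r < a) := by
  rw [largePart, getLastD_append_singleton, List.dropLast_concat]

theorem smallPart_map {w : List ℕ} {f : ℕ → ℕ} (hf : StrictMonoOn f {a | a ∈ w}) :
    smallPart (w.map f) = (smallPart w).map f := by
  rcases List.eq_nil_or_concat w with rfl | ⟨v, r, rfl⟩
  · rfl
  · rw [List.concat_eq_append] at hf ⊢
    rw [List.map_append, List.map_singleton, smallPart_concat, smallPart_concat, List.filter_map]
    congr 1
    refine List.filter_congr fun a ha => ?_
    simp only [Function.comp_apply, decide_eq_decide]
    exact hf.le_iff_le (by simp [ha]) (by simp)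

theorem largePart_map {w : List ℕ} {f : ℕ → ℕ} (hf : StrictMonoOn f {a | a ∈ w}) :
    largePart (w.map f) = (largePart w).map f := by
  rcases List.eq_nil_or_concat w with rfl | ⟨v, r, rfl⟩
  · rfl
  · rw [List.concat_eq_append] at hf ⊢
    rw [List.map_append, List.map_singleton, largePart_concat, largePart_concat, List.filter_map]
    congr 1
    refine List.filter_congr fun a ha => ?_
    simp only [Function.comp_apply, decide_eq_decide]
    exact hf.lt_iff_lt (by simp) (by simp [ha])

theorem mem_of_mem_smallPart {w : List ℕ} {a : ℕ} (h : a ∈ smallPart w) : a ∈ w :=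
  List.mem_of_mem_dropLast (List.mem_of_mem_filter h)

theorem mem_of_mem_largePart {w : List ℕ} {a : ℕ} (h : a ∈ largePart w) : a ∈ w :=
  List.mem_of_mem_dropLast (List.mem_of_mem_filter h)

section Span

variable {K : Type u} [Field K] {V : Type v} [AddCommMonoid V] [Module K V] {s : Set V}
  {Q : Submodule K V}

theorem apply_right_mem_of_mem_span (f : V →ₗ[K] V →ₗ[K] V) {x y : V} (h : ∀ z ∈ s, f x z ∈ Q)
    (hy : y ∈ Submodule.span K s) : f x y ∈ Q :=
  (Submodule.span_le (p := Q.comap (f x))).2 h hy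

theorem apply_left_mem_of_mem_span (f : V →ₗ[K] V →ₗ[K] V) {x y : V} (h : ∀ z ∈ s, f z y ∈ Q)
    (hx : x ∈ Submodule.span K s) : f x y ∈ Q :=
  apply_right_mem_of_mem_span f.flip h hx

end Span

namespace WQSym

variable (K : Type u) [Field K]

/-- The partial product `≺`. -/
abbrev prodGT : plus K →ₗ[K] plus K →ₗ[K] plus K := partialProd K (fun a b => b < a)

/-- The partial product `∘`. -/
abbrev prodEQ : plus K →ₗ[K] plus K →ₗ[K] plus K := partialProd K (fun a b => b = a)

/-- The partial product `≻`. -/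
abbrev prodLT : plus K →ₗ[K] plus K →ₗ[K] plus K := partialProd K (fun a b => a < b)

/-- The normal form of a word: a trialgebra monomial in `M_1`. Writing `w = v · r`, it is
`nf U ≺ P` where `U` consists of the letters of `v` that exceed `r`, and `P` is `nf L ∘ M_1` or
`nf L ≻ M_1`, where `L` consists of the letters of `v` that do not, according to whether `r`
occurs in `L`; empty factors are omitted. -/
def nf (w : List ℕ) : plus K :=
  if _h : w = [] then 0 else
    if largePart w = [] then
      if smallPart w = [] then MOne K else
        if w.getLastD 0 ∈ smallPart w then prodEQ K (nf (smallPart w)) (MOne K) else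
          prodLT K (nf (smallPart w)) (MOne K)
    else prodGT K (nf (largePart w))
      (if smallPart w = [] then MOne K else
        if w.getLastD 0 ∈ smallPart w then prodEQ K (nf (smallPart w)) (MOne K) else
          prodLT K (nf (smallPart w)) (MOne K))
termination_by w.length
decreasing_by all_goals first | exact length_smallPart_lt _h | exact length_largePart_lt _h

theorem nf_nil : nf K [] = 0 := by rw [nf, dif_pos rfl]

theorem nf_of_ne_nil {w : List ℕ} (hw : w ≠ []) : nf K w =
    if largePart w = [] then
      if smallPart w = [] then MOne K else
        if w.getLastD 0 ∈ smallPart w then prodEQ K (nf K (smallPart w)) (MOne K) else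
          prodLT K (nf K (smallPart w)) (MOne K)
    else prodGT K (nf K (largePart w))
      (if smallPart w = [] then MOne K else
        if w.getLastD 0 ∈ smallPart w then prodEQ K (nf K (smallPart w)) (MOne K) else
          prodLT K (nf K (smallPart w)) (MOne K)) := by
  rw [nf, dif_neg hw]

/-- The recursion only compares letters with the last one, so it sees their relative order and
nothing else. -/
theorem nf_map {w : List ℕ} {f : ℕ → ℕ} (hf : StrictMonoOn f {a | a ∈ w}) :
    nf K (w.map f) = nf K w := by
  induction hn : w.length using Nat.strong_induction_on generalizing w with
  | _ n ih =>
    subst hn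
    by_cases hw : w = []
    · rw [hw]; rfl
    have hS := ih _ (length_smallPart_lt hw) (hf.mono fun a => mem_of_mem_smallPart) rfl
    have hL := ih _ (length_largePart_lt hw) (hf.mono fun a => mem_of_mem_largePart) rfl
    have hmem : f (w.getLastD 0) ∈ (smallPart w).map f ↔ w.getLastD 0 ∈ smallPart w := by
      refine ⟨fun h => ?_, List.mem_map_of_mem⟩
      obtain ⟨a, ha, h⟩ := List.mem_map.1 h
      rwa [← hf.injOn (mem_of_mem_smallPart ha) (getLastD_mem hw 0) h]
    rw [nf_of_ne_nil K hw, nf_of_ne_nil K (by simpa using hw : w.map f ≠ []), smallPart_map hf, largePart_map hf, hS, hL, getLastD_map (d := 0) f hw]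
    simp only [List.map_eq_nil_iff, hmem]

theorem nf_pack (w : List ℕ) : nf K (pack w) = nf K w := nf_map K (letterRank_strictMonoOn w)

/-- By `SylvesterCongr.filter_dropLast` congruent words have congruent small and large parts. They
also share the last letter and the set of small letters, so the recursion takes the same branch on
both. -/
theorem nf_congr {u v : List ℕ} (h : SylvesterCongr u v) : nf K u = nf K v := by
  induction hn : u.length using Nat.strong_induction_on generalizing u v with
  | _ n ih =>
    subst hn
    by_cases hu : u = []
    · rw [hu] at h ⊢
      rw [List.nil_perm.1 h.perm]
    have hv : v ≠ [] := fun hv => hu (by rw [hv] at h; exact List.perm_nil.1 h.perm)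
    have hs : SylvesterCongr (smallPart u) (smallPart v) := h.filter_dropLast.1
    have hl : SylvesterCongr (largePart u) (largePart v) := h.filter_dropLast.2
    have hS := ih _ (length_smallPart_lt hu) hs rfl
    have hL := ih _ (length_largePart_lt hu) hl rfl
    have hs' : smallPart u = [] ↔ smallPart v = [] := by
      rw [← List.length_eq_zero_iff, hs.perm.length_eq, List.length_eq_zero_iff]
    have hl' : largePart u = [] ↔ largePart v = [] := by
      rw [← List.length_eq_zero_iff, hl.perm.length_eq, List.length_eq_zero_iff]
    rw [nf_of_ne_nil K hu, nf_of_ne_nil K hv, hS, hL, h.getLastD_eq]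
    simp only [hs', hl', hs.mem_iff]

/-- The inner case distinction in the recursion is itself the normal form of the small letters
followed by `r`, a word whose large part is empty. -/
theorem nf_concat (w : List ℕ) (r : ℕ) : nf K (w ++ [r]) =
    if w.filter (fun a => r < a) = [] then nf K (w.filter (fun a => a ≤ r) ++ [r])
    else prodGT K (nf K (w.filter (fun a => r < a))) (nf K (w.filter (fun a => a ≤ r) ++ [r])) := by
  have h1 : (w.filter (fun a => a ≤ r)).filter (fun a => r < a) = [] := by
    simp [List.filter_eq_nil_iff]
  have h2 : (w.filter (fun a => a ≤ r)).filter (fun a => a ≤ r) = w.filter (fun a => a ≤ r) := by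
    simp [List.filter_filter]
  rw [nf_of_ne_nil K (by simp : w ++ [r] ≠ []),
    nf_of_ne_nil K (by simp : w.filter (fun a => a ≤ r) ++ [r] ≠ []), largePart_concat, largePart_concat, smallPart_concat, smallPart_concat,
    h1, h2, if_pos rfl, getLastD_append_singleton, getLastD_append_singleton]

theorem nf_concat_of_le {w : List ℕ} {r : ℕ} (hw : ∀ a ∈ w, a ≤ r) : nf K (w ++ [r]) =
    if w = [] then MOne K else
      if r ∈ w then prodEQ K (nf K w) (MOne K) else prodLT K (nf K w) (MOne K) := by
  have h1 : w.filter (fun a => r < a) = [] := by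
    simpa [List.filter_eq_nil_iff] using hw
  have h2 : w.filter (fun a => a ≤ r) = w := by
    simpa [List.filter_eq_self] using hw
  rw [nf_of_ne_nil K (by simp), largePart_concat, smallPart_concat, h1, h2, if_pos rfl,
    getLastD_append_singleton]

theorem nf_append_concat {u w : List ℕ} {r : ℕ} (hu : u ≠ []) (hur : ∀ a ∈ u, r < a)
    (hw : ∀ a ∈ w, a ≤ r) :
    nf K (u ++ (w ++ [r])) = prodGT K (nf K u) (nf K (w ++ [r])) := by
  have h1 : (u ++ w).filter (fun a => r < a) = u := by
    have h : w.filter (fun a => r < a) = [] := List.filter_eq_nil_iff.2 (by simpa using hw)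
    rw [List.filter_append, h, List.append_nil]
    exact List.filter_eq_self.2 (by simpa using hur)
  have h2 : (u ++ w).filter (fun a => a ≤ r) = w := by
    have h : u.filter (fun a => a ≤ r) = [] := List.filter_eq_nil_iff.2 (by simpa using hur)
    rw [List.filter_append, h, List.nil_append]
    exact List.filter_eq_self.2 (by simpa using hw)
  rw [← List.append_assoc, nf_concat, h1, h2, if_neg hu]

theorem nf_mem_TDPlus (w : List ℕ) : nf K w ∈ TDPlus K := by
  induction hn : w.length using Nat.strong_induction_on generalizing w with
  | _ n ih =>
    subst hn
    by_cases hw : w = []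
    · rw [hw, nf_nil]; exact zero_mem _
    have hS := ops_mem_TDPlus K (ih _ (length_smallPart_lt hw) _ rfl) (MOne_mem_TDPlus K)
    have hL := ih _ (length_largePart_lt hw) _ rfl
    have h1 := MOne_mem_TDPlus K
    rw [nf_of_ne_nil K hw]
    split_ifs
    · exact h1
    · exact hS.2.1
    · exact hS.2.2
    · exact (ops_mem_TDPlus K hL h1).1
    · exact (ops_mem_TDPlus K hL hS.2.1).1
    · exact (ops_mem_TDPlus K hL hS.2.2).1

/-! ### The span of the normal forms is a sub-trialgebra -/

/-- The span of the normal forms of the nonempty words whose length is in `N`. -/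
def nfSpan (N : Set ℕ) : Submodule K (plus K) :=
  Submodule.span K (nf K '' {w | w ≠ [] ∧ w.length ∈ N})

/-- The span of the normal forms of the words whose length is in `N` and whose last letter is
maximal. -/
def nfMaxSpan (N : Set ℕ) : Submodule K (plus K) :=
  Submodule.span K (nf K '' {w | (∃ v m, (∀ a ∈ v, a ≤ m) ∧ w = v ++ [m]) ∧ w.length ∈ N})

theorem nfMaxSpan_le_nfSpan (N : Set ℕ) : nfMaxSpan K N ≤ nfSpan K N :=
  Submodule.span_mono (Set.image_mono fun _ ⟨⟨_, _, _, h⟩, hN⟩ => ⟨by simp [h], hN⟩)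

theorem nf_mem_nfSpan {w : List ℕ} {N : Set ℕ} (hw : w ≠ []) (hN : w.length ∈ N) :
    nf K w ∈ nfSpan K N := Submodule.subset_span ⟨w, ⟨hw, hN⟩, rfl⟩

theorem nf_concat_mem_nfMaxSpan {w : List ℕ} {m : ℕ} {N : Set ℕ} (hw : ∀ a ∈ w, a ≤ m)
    (hN : w.length + 1 ∈ N) : nf K (w ++ [m]) ∈ nfMaxSpan K N :=
  Submodule.subset_span ⟨_, ⟨⟨w, m, hw, rfl⟩, by simpa using hN⟩, rfl⟩

theorem MOne_mem_nfMaxSpan {N : Set ℕ} (hN : 1 ∈ N) : MOne K ∈ nfMaxSpan K N := by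
  have h := nf_concat_mem_nfMaxSpan K (w := []) (m := 0) (N := N) (by simp) (by simpa using hN)
  rwa [nf_concat_of_le K (by simp), if_pos rfl] at h

theorem prodEQ_MOne_mem {N N' : Set ℕ} (hN : ∀ n ∈ N, n + 1 ∈ N') {x : plus K}
    (hx : x ∈ nfSpan K N) : prodEQ K x (MOne K) ∈ nfMaxSpan K N' := by
  refine apply_left_mem_of_mem_span (prodEQ K) ?_ hx
  rintro _ ⟨w, ⟨hw, hwN⟩, rfl⟩
  have h : ∀ a ∈ w, a ≤ maxLetter w := fun a ha => le_maxLetter ha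
  have key := nf_concat_mem_nfMaxSpan K h (hN _ hwN)
  rw [nf_concat_of_le K h, if_neg hw, if_pos (maxLetter_mem hw)] at key
  exact key

theorem prodLT_MOne_mem {N N' : Set ℕ} (hN : ∀ n ∈ N, n + 1 ∈ N') {x : plus K}
    (hx : x ∈ nfSpan K N) : prodLT K x (MOne K) ∈ nfMaxSpan K N' := by
  refine apply_left_mem_of_mem_span (prodLT K) ?_ hx
  rintro _ ⟨w, ⟨hw, hwN⟩, rfl⟩
  -- Appending a new maximum corresponds to `≻ M_1`, just as repeating the old maximum corresponds
  -- to `∘ M_1`.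
  have h : ∀ a ∈ w, a ≤ maxLetter w + 1 := fun a ha => (le_maxLetter ha).trans (Nat.le_succ _)
  have key := nf_concat_mem_nfMaxSpan K h (hN _ hwN)
  rw [nf_concat_of_le K h, if_neg hw, if_neg fun h => (le_maxLetter h).not_gt (Nat.lt_succ_self _)]
    at key
  exact key

/-- When the last letter of the second word is maximal there, the first word can be shifted above
it. The concatenation then has the shifted word as its large part, so the product of two normal
forms is a single normal form. -/
theorem prodGT_mem {N N' N'' : Set ℕ} (hN : ∀ m ∈ N, ∀ n ∈ N', m + n ∈ N'') {x y : plus K}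
    (hx : x ∈ nfSpan K N) (hy : y ∈ nfMaxSpan K N') : prodGT K x y ∈ nfSpan K N'' := by
  refine apply_left_mem_of_mem_span (prodGT K) ?_ hx
  rintro _ ⟨w, ⟨hw, hwN⟩, rfl⟩
  refine apply_right_mem_of_mem_span (prodGT K) ?_ hy
  rintro _ ⟨_, ⟨⟨v, m, hv, rfl⟩, hvN⟩, rfl⟩
  have hmono : StrictMonoOn (fun a => a + (m + 1)) {a | a ∈ w} := fun a _ b _ hab => by
    simpa using hab
  rw [← nf_map K hmono, ← nf_append_concat K (by simpa using hw) (fun a ha => ?_) hv]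
  · refine nf_mem_nfSpan K (by simp) ?_
    rw [List.length_append, List.length_map]
    exact hN _ hwN _ hvN
  · obtain ⟨b, -, rfl⟩ := List.mem_map.1 ha
    omega

/-- The normal forms are stable under the partial products with right factor `b`. -/
def StableRight (b : plus K) : Prop := ∀ a ∈ nfSpan K Set.univ,
  prodGT K a b ∈ nfSpan K Set.univ ∧ prodEQ K a b ∈ nfSpan K Set.univ ∧
    prodLT K a b ∈ nfSpan K Set.univ

/-- `∘` and `≻` with right factor `b` take normal forms to normal forms of words whose last letter
is maximal. -/
def StableMaxRight (b : plus K) : Prop := ∀ a ∈ nfSpan K Set.univ,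
  prodEQ K a b ∈ nfMaxSpan K Set.univ ∧ prodLT K a b ∈ nfMaxSpan K Set.univ

theorem stableMaxRight_MOne : StableMaxRight K (MOne K) := fun _ ha =>
  ⟨prodEQ_MOne_mem K (fun _ _ => Set.mem_univ _) ha, prodLT_MOne_mem K (fun _ _ => Set.mem_univ _) ha⟩

/-- Uses `a ∘ (c ∘ M_1) = (a ∘ c) ∘ M_1` and `a ≻ (c ∘ M_1) = (a ≻ c) ∘ M_1`. -/
theorem StableRight.prodEQ_MOne {c : plus K} (hc : StableRight K c) :
    StableMaxRight K (prodEQ K c (MOne K)) := fun a ha => by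
  rw [← (isDendriformTrialgebra K).mid_assoc, ← (isDendriformTrialgebra K).right_mid]
  exact ⟨prodEQ_MOne_mem K (fun _ _ => Set.mem_univ _) (hc a ha).2.1,
    prodEQ_MOne_mem K (fun _ _ => Set.mem_univ _) (hc a ha).2.2⟩

/-- Uses `a ∘ (c ≻ M_1) = (a ≺ c) ∘ M_1` and `a ≻ (c ≻ M_1) = (a ⊙ c) ≻ M_1`. -/
theorem StableRight.prodLT_MOne {c : plus K} (hc : StableRight K c) :
    StableMaxRight K (prodLT K c (MOne K)) := fun a ha => by
  rw [← (isDendriformTrialgebra K).left_mid, ← (isDendriformTrialgebra K).mul_right]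
  exact ⟨prodEQ_MOne_mem K (fun _ _ => Set.mem_univ _) (hc a ha).1,
    prodLT_MOne_mem K (fun _ _ => Set.mem_univ _)
      (add_mem (add_mem (hc a ha).1 (hc a ha).2.1) (hc a ha).2.2)⟩

theorem StableMaxRight.stableRight {p : plus K} (hp : StableMaxRight K p)
    (hp' : p ∈ nfMaxSpan K Set.univ) : StableRight K p := fun a ha =>
  ⟨prodGT_mem K (fun _ _ _ _ => Set.mem_univ _) ha hp', nfMaxSpan_le_nfSpan K _ (hp a ha).1,
    nfMaxSpan_le_nfSpan K _ (hp a ha).2⟩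

/-- For `∘` and `≻` the left factor is absorbed into `c`. For `≺` no axiom rewrites `a ≺ (c ≺ p)`
alone; it is obtained by difference from `(a ≺ c) ≺ p = a ≺ (c ≺ p) + a ≺ (c ∘ p) + a ≺ (c ≻ p)`.
The last two terms are under control because `c ∘ p` and `c ≻ p` again have a maximal last letter.
-/
theorem StableRight.prodGT {c p : plus K} (hc : StableRight K c) (hc' : c ∈ nfSpan K Set.univ)
    (hp : StableMaxRight K p) (hp' : p ∈ nfMaxSpan K Set.univ) :
    StableRight K (prodGT K c p) := fun a ha => by
  have hmem : ∀ x ∈ nfSpan K Set.univ, ∀ y ∈ nfMaxSpan K Set.univ,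
      WQSym.prodGT K x y ∈ nfSpan K Set.univ :=
    fun _ hx _ hy => prodGT_mem K (fun _ _ _ _ => Set.mem_univ _) hx hy
  rw [← (isDendriformTrialgebra K).right_left, ← (isDendriformTrialgebra K).mid_left]
  refine ⟨?_, hmem _ (hc a ha).2.1 _ hp', hmem _ (hc a ha).2.2 _ hp'⟩
  have h := (isDendriformTrialgebra K).left_left a c p
  rw [LinearMap.add_apply, LinearMap.add_apply, LinearMap.add_apply, LinearMap.add_apply, map_add,
    map_add, add_assoc] at h
  have h1 := hmem _ (hc a ha).1 _ hp'
  have h2 := hmem a ha _ (hp c hc').1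
  have h3 := hmem a ha _ (hp c hc').2
  rw [WQSym.prodGT, h] at h1
  exact (Submodule.add_mem_iff_left (R := K) (M := plus K) _
    (Submodule.add_mem (R := K) (M := plus K) _ h2 h3)).1 h1

/-- Strong induction on the length, following the shape `nf U ≺ P` of a normal form. -/
theorem stableRight_nf {w : List ℕ} (hw : w ≠ []) : StableRight K (nf K w) := by
  induction hn : w.length using Nat.strong_induction_on generalizing w with
  | _ n ih =>
    subst hn
    obtain ⟨v, r, rfl⟩ := List.eq_nil_or_concat w |>.resolve_left hw
    rw [List.concat_eq_append] at ih ⊢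
    have hle : ∀ a ∈ v.filter (fun a => a ≤ r), a ≤ r := by simp
    have hS := length_smallPart_lt (w := v ++ [r]) (by simp)
    have hL := length_largePart_lt (w := v ++ [r]) (by simp)
    rw [smallPart_concat] at hS
    rw [largePart_concat] at hL
    have hp' := nf_concat_mem_nfMaxSpan K (N := Set.univ) hle (Set.mem_univ _)
    have hp : StableMaxRight K (nf K (v.filter (fun a => a ≤ r) ++ [r])) := by
      rw [nf_concat_of_le K hle]
      split_ifs with h0 h1
      · exact stableMaxRight_MOne K
      · exact (ih _ hS h0 rfl).prodEQ_MOne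
      · exact (ih _ hS h0 rfl).prodLT_MOne
    rw [nf_concat]
    split_ifs with h0
    · exact hp.stableRight K hp'
    · exact (ih _ hL h0 rfl).prodGT K (nf_mem_nfSpan K h0 (Set.mem_univ _)) hp hp'

theorem TDPlus_le_nfSpan : TDPlus K ≤ nfSpan K Set.univ := by
  refine TDPlus_le K (nfMaxSpan_le_nfSpan K _ (MOne_mem_nfMaxSpan K (Set.mem_univ _))) ?_
  intro x hx y hy
  have key : ∀ f : plus K →ₗ[K] plus K →ₗ[K] plus K,
      (∀ b, StableRight K b → f x b ∈ nfSpan K Set.univ) → f x y ∈ nfSpan K Set.univ := by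
    intro f hf
    refine apply_right_mem_of_mem_span f ?_ hy
    rintro _ ⟨w, ⟨hw, -⟩, rfl⟩
    exact hf _ (stableRight_nf K hw)
  exact ⟨key (prodGT K) fun b hb => (hb x hx).1, key (prodEQ K) fun b hb => (hb x hx).2.1,
    key (prodLT K) fun b hb => (hb x hx).2.2⟩

end WQSym

/-! ### Packed words of concatenations -/

theorem exists_map_of_pack_eq {x y : List ℕ} (h : pack x = pack y) :
    ∃ g : ℕ → ℕ, StrictMonoOn g {a | a ∈ x} ∧ y = x.map g := by
  refine ⟨fun a => unrank y (letterRank x a), fun a ha b hb hab => ?_, ?_⟩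
  · exact strictMonoOn_unrank y (h ▸ List.mem_map_of_mem ha) (h ▸ List.mem_map_of_mem hb)
      (letterRank_lt hb hab)
  · conv_lhs => rw [← map_unrank_pack y, ← h, pack, List.map_map]
    rfl

/-- The hypothesis `hgh` excludes common letters and preserves every comparison between the two
words, so `g` and `h` glue to one increasing relabelling. -/
theorem pack_map_append_map {x y : List ℕ} {g h : ℕ → ℕ} (hg : StrictMonoOn g {a | a ∈ x})
    (hh : StrictMonoOn h {a | a ∈ y})
    (hgh : ∀ a ∈ x, ∀ b ∈ y, (a < b ∧ g a < h b) ∨ (b < a ∧ h b < g a)) :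
    pack (x.map g ++ y.map h) = pack (x ++ y) := by
  have hy : ∀ b ∈ y, b ∉ x := fun b hb hb' => by
    have := hgh b hb' b hb
    omega
  have hmap : x.map g ++ y.map h = (x ++ y).map (fun a => if a ∈ x then g a else h a) := by
    rw [List.map_append]
    congr 1
    · exact List.map_congr_left fun a ha => by rw [if_pos ha]
    · exact List.map_congr_left fun a ha => by rw [if_neg (hy a ha)]
  rw [hmap]
  refine pack_map _ _ fun a ha b hb hab => ?_
  have ha' := List.mem_append.1 ha
  have hb' := List.mem_append.1 hb
  split_ifs with h1 h2 h2
  · exact hg h1 h2 hab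
  · have := hgh a h1 b (hb'.resolve_left h2)
    omega
  · have := hgh b h2 a (ha'.resolve_left h1)
    omega
  · exact hh (ha'.resolve_left h1) (hb'.resolve_left h2) hab

theorem pack_append_congr_of_lt {x x' y y' : List ℕ} (hx : pack x = pack x') (hy : pack y = pack y')
    (h : ∀ a ∈ x, ∀ b ∈ y, a < b) (h' : ∀ a ∈ x', ∀ b ∈ y', a < b) :
    pack (x ++ y) = pack (x' ++ y') := by
  obtain ⟨g, hg, rfl⟩ := exists_map_of_pack_eq hx
  obtain ⟨k, hk, rfl⟩ := exists_map_of_pack_eq hy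
  exact (pack_map_append_map hg hk fun a ha b hb => Or.inl
    ⟨h a ha b hb, h' _ (List.mem_map_of_mem ha) _ (List.mem_map_of_mem hb)⟩).symm

theorem pack_append_congr_of_gt {x x' y y' : List ℕ} (hx : pack x = pack x') (hy : pack y = pack y')
    (h : ∀ a ∈ x, ∀ b ∈ y, b < a) (h' : ∀ a ∈ x', ∀ b ∈ y', b < a) :
    pack (x ++ y) = pack (x' ++ y') := by
  obtain ⟨g, hg, rfl⟩ := exists_map_of_pack_eq hx
  obtain ⟨k, hk, rfl⟩ := exists_map_of_pack_eq hy
  exact (pack_map_append_map hg hk fun a ha b hb => Or.inr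
    ⟨h a ha b hb, h' _ (List.mem_map_of_mem ha) _ (List.mem_map_of_mem hb)⟩).symm

theorem pack_append_maxLetter_congr {x x' : List ℕ} (hx : pack x = pack x') (hne : x ≠ []) :
    pack (x ++ [maxLetter x]) = pack (x' ++ [maxLetter x']) := by
  obtain ⟨g, hg, rfl⟩ := exists_map_of_pack_eq hx
  rw [(WQSym.maxLetter_map hne g hg).2]
  refine (pack_map (x ++ [maxLetter x]) g (hg.mono fun a ha => ?_)).symm.trans (by simp)
  rcases List.mem_append.1 ha with ha | ha
  · exact ha
  · rw [List.mem_singleton.1 ha]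
    exact maxLetter_mem hne

theorem pack_singleton (a : ℕ) : pack [a] = [1] := by
  simp [pack, letterRank, Finset.filter_singleton]

/-! ### Products of basis elements with `M_1` -/

namespace WQSym

theorem toPacked_append_mem_convolution {c : ℕ → ℕ → Prop} (hc : IsOrderCond c) {x y : List ℕ}
    (hx : x ≠ []) (hy : y ≠ []) (h : c (maxLetter x) (maxLetter y)) :
    toPacked (x ++ y) ∈ convolution c (toPacked x) (toPacked y) := by
  have hmx := (letterRank_strictMonoOn (x ++ y)).mono
    (fun a (ha : a ∈ x) => List.mem_append_left y ha)
  have hmy := (letterRank_strictMonoOn (x ++ y)).mono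
    (fun a (ha : a ∈ y) => List.mem_append_right x ha)
  have ex := maxLetter_map hx _ hmx
  have ey := maxLetter_map hy _ hmy
  refine mem_convolution_iff_exists.2 ⟨x.map (letterRank (x ++ y)), y.map (letterRank (x ++ y)),
    List.map_append, pack_map _ _ hmx, pack_map _ _ hmy, ?_⟩
  rw [ex.2, ey.2]
  exact (hc _ _ (letterRank_strictMonoOn (x ++ y)) _ (List.mem_append_left y ex.1) _
    (List.mem_append_right x ey.1)).2 h

theorem ne_nil_of_mem_convolution {c : ℕ → ℕ → Prop} {u v p : PackedWord} (hu : u.1 ≠ [])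
    (hp : p ∈ convolution c u v) : p.1 ≠ [] := by
  have h := (mem_convolution.1 hp).1
  have h' := List.length_pos_iff.2 hu
  exact List.length_pos_iff.1 (by omega)

variable (K : Type u) [Field K]

theorem partialProd_MPlus (c : ℕ → ℕ → Prop) {u v : PackedWord} (hu : u.1 ≠ []) (hv : v.1 ≠ []) :
    partialProd K c (MPlus K u) (MPlus K v) = ∑ p ∈ convolution c u v, MPlus K p := by
  apply Subtype.ext
  rw [coe_partialProd, MPlus, MPlus, coe_proj_M K hu, coe_proj_M K hv, convProd_M,
    AddSubmonoidClass.coe_finsetSum]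
  exact Finset.sum_congr rfl fun p hp => (coe_proj_M K (ne_nil_of_mem_convolution hu hp)).symm

/-- The second factor is a single letter, and it has to equal the maximum of the first, so the
product has only one term. -/
theorem prodEQ_MPlus_MOne {w : List ℕ} (hw : w ≠ []) :
    prodEQ K (MPlus K (toPacked w)) (MOne K) = MPlus K (toPacked (w ++ [maxLetter w])) := by
  have h1 : toPacked [maxLetter w] = toPacked [1] :=
    toPacked_eq_toPacked_iff.2 (by rw [pack_singleton, pack_singleton])
  have hm : ∀ a, maxLetter [a] = a := fun a => by simp [maxLetter]
  rw [MOne_eq, partialProd_MPlus K _ (by rwa [toPacked_val, Ne, pack_eq_nil])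
    (by rw [toPacked_val, Ne, pack_eq_nil]; simp), ← h1, Finset.sum_eq_single_of_mem _
    (toPacked_append_mem_convolution isOrderCond_eq hw (by simp) (hm _))]
  intro p hp hne
  refine absurd ?_ hne
  obtain ⟨x, y, hxy, hx, hy, hc⟩ := mem_convolution_iff_exists.1 hp
  have hlen : y.length = 1 := by rw [← length_pack, hy, toPacked_val, length_pack]; rfl
  obtain ⟨b, rfl⟩ := List.length_eq_one_iff.1 hlen
  rw [hm] at hc
  rw [← toPacked_val_self p, hxy, toPacked_eq_toPacked_iff, hc]
  exact (pack_append_maxLetter_congr hx.symm hw).symm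

theorem prodLT_MPlus_MOne {w : List ℕ} (hw : w ≠ []) {b : ℕ} (hb : ∀ a ∈ w, a < b) :
    prodLT K (MPlus K (toPacked w)) (MOne K) = MPlus K (toPacked (w ++ [b])) := by
  have h1 : toPacked [b] = toPacked [1] :=
    toPacked_eq_toPacked_iff.2 (by rw [pack_singleton, pack_singleton])
  have hm : ∀ a, maxLetter [a] = a := fun a => by simp [maxLetter]
  rw [MOne_eq, partialProd_MPlus K _ (by rwa [toPacked_val, Ne, pack_eq_nil])
    (by rw [toPacked_val, Ne, pack_eq_nil]; simp), ← h1, Finset.sum_eq_single_of_mem _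
    (toPacked_append_mem_convolution isOrderCond_lt hw (by simp)
      (by rw [hm]; exact hb _ (maxLetter_mem hw)))]
  intro p hp hne
  refine absurd ?_ hne
  obtain ⟨x, y, hxy, hx, hy, hc⟩ := mem_convolution_iff_exists.1 hp
  have hlen : y.length = 1 := by rw [← length_pack, hy, toPacked_val, length_pack]; rfl
  obtain ⟨d, rfl⟩ := List.length_eq_one_iff.1 hlen
  rw [hm] at hc
  rw [← toPacked_val_self p, hxy, toPacked_eq_toPacked_iff]
  refine pack_append_congr_of_lt hx (by rw [pack_singleton, pack_singleton]) ?_ ?_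
  · intro a ha e he
    rw [List.mem_singleton.1 he]
    exact (le_maxLetter ha).trans_lt hc
  · intro a ha e he
    rw [List.mem_singleton.1 he]
    exact hb a ha

/-! ### The normal forms span the sylvester quotient -/

/-- The part of the kernel of `WQSym → SylvesterQuotient` in the augmentation ideal. -/
def plusIdeal : Submodule K (plus K) := (sylvesterIdeal K).comap (plus K).subtype

theorem mem_plusIdeal {x : plus K} : x ∈ plusIdeal K ↔ (x : WQSym K) ∈ sylvesterIdeal K := Iff.rfl

theorem partialProd_mem_plusIdeal_left (c : ℕ → ℕ → Prop) {x : plus K} (hx : x ∈ plusIdeal K)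
    (y : plus K) : partialProd K c x y ∈ plusIdeal K := by
  rw [mem_plusIdeal, coe_partialProd]
  exact (convProd_mem_sylvesterIdeal K c hx _).1

theorem partialProd_mem_plusIdeal_right (c : ℕ → ℕ → Prop) {x : plus K} (hx : x ∈ plusIdeal K)
    (y : plus K) : partialProd K c y x ∈ plusIdeal K := by
  rw [mem_plusIdeal, coe_partialProd]
  exact (convProd_mem_sylvesterIdeal K c hx _).2

theorem MPlus_sub_mem_plusIdeal {u v : List ℕ} (h : SylvesterCongr u v) :
    MPlus K (toPacked u) - MPlus K (toPacked v) ∈ plusIdeal K := by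
  have hc : SylvesterCongr (toPacked u).1 (toPacked v).1 := h.pack
  rw [mem_plusIdeal, Submodule.coe_sub, MPlus, MPlus, coe_proj, coe_proj, counit_M_congr K hc,
    sub_sub_sub_cancel_right]
  exact Submodule.subset_span ⟨_, _, hc, rfl⟩

/-- Such an `M` is exactly `M_v ∘ M_1` or `M_v ≻ M_1`, according to whether `r` repeats the maximum
of `v` or is a new one; no correction terms arise here. -/
theorem MPlus_concat_mem {v : List ℕ} {r : ℕ} (hv : ∀ a ∈ v, a ≤ r)
    (ih : v ≠ [] → MPlus K (toPacked v) ∈ nfSpan K {v.length} ⊔ plusIdeal K) :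
    MPlus K (toPacked (v ++ [r])) ∈ nfMaxSpan K {v.length + 1} ⊔ plusIdeal K := by
  by_cases h0 : v = []
  · subst h0
    refine Submodule.mem_sup_left ?_
    have h1 : toPacked [r] = toPacked [1] :=
      toPacked_eq_toPacked_iff.2 (by rw [pack_singleton, pack_singleton])
    rw [List.nil_append, h1, ← MOne_eq]
    exact MOne_mem_nfMaxSpan K rfl
  have hN : ∀ n ∈ ({v.length} : Set ℕ), n + 1 ∈ ({v.length + 1} : Set ℕ) := by simp
  obtain ⟨t, ht, i, hi, hti⟩ := Submodule.mem_sup.1 (ih h0)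
  by_cases hr : r ∈ v
  · have hmax : r = maxLetter v := le_antisymm (le_maxLetter hr) (maxLetter_le_iff.2 hv)
    rw [hmax, ← prodEQ_MPlus_MOne K h0, ← hti, map_add, LinearMap.add_apply]
    exact Submodule.add_mem_sup (prodEQ_MOne_mem K hN ht)
      (partialProd_mem_plusIdeal_left K _ hi _)
  · rw [← prodLT_MPlus_MOne K h0 fun a ha => lt_of_le_of_ne (hv a ha) fun h => hr (h ▸ ha), ← hti,
      map_add, LinearMap.add_apply]
    exact Submodule.add_mem_sup (prodLT_MOne_mem K hN ht)
      (partialProd_mem_plusIdeal_left K _ hi _)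

theorem prodGT_mem_sup {m n : ℕ} {x y : plus K} (hx : x ∈ nfSpan K {m} ⊔ plusIdeal K)
    (hy : y ∈ nfMaxSpan K {n} ⊔ plusIdeal K) :
    prodGT K x y ∈ nfSpan K {m + n} ⊔ plusIdeal K := by
  obtain ⟨t, ht, i, hi, rfl⟩ := Submodule.mem_sup.1 hx
  obtain ⟨t', ht', i', hi', rfl⟩ := Submodule.mem_sup.1 hy
  rw [map_add (prodGT K), LinearMap.add_apply, map_add (prodGT K t), add_assoc]
  refine Submodule.add_mem_sup (prodGT_mem K ?_ ht ht') (add_mem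
    (partialProd_mem_plusIdeal_right K _ hi' _) (partialProd_mem_plusIdeal_left K _ hi _))
  rintro _ rfl _ rfl
  rfl

/-- The triangularity behind the spanning argument. In a term `x · y` the letters of `y` never
exceed its last letter, so the large letters all come from `x`. If every letter of `x` is large, the
packing is forced; otherwise there are fewer large letters than letters of `v`. -/
theorem eq_or_length_largePart_lt {c : ℕ → ℕ → Prop} {v w : List ℕ} {r : ℕ} {p : PackedWord}
    (hv : ∀ a ∈ v, r < a) (hw : ∀ a ∈ w, a ≤ r)
    (hp : p ∈ convolution c (toPacked v) (toPacked (w ++ [r]))) :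
    p = toPacked (v ++ (w ++ [r])) ∨ (largePart p.1).length < v.length := by
  obtain ⟨x, y, hxy, hx, hy, -⟩ := mem_convolution_iff_exists.1 hp
  obtain ⟨g, hg, rfl⟩ := exists_map_of_pack_eq hy.symm
  rw [List.map_append, List.map_singleton] at hxy
  have hwg : ∀ a ∈ w, g a ≤ g r := fun a ha => hg.monotoneOn (by simp [ha]) (by simp) (hw a ha)
  have hlen : x.length = v.length := by rw [← length_pack, hx, toPacked_val, length_pack]
  have hlarge : largePart p.1 = x.filter (fun a => g r < a) := by
    have h : (w.map g).filter (fun a => g r < a) = [] := by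
      refine List.filter_eq_nil_iff.2 fun a ha => ?_
      obtain ⟨b, hb, rfl⟩ := List.mem_map.1 ha
      simpa using hwg b hb
    rw [hxy, ← List.append_assoc, largePart_concat, List.filter_append, h, List.append_nil]
  rcases (List.length_filter_le (fun a => decide (g r < a)) x).lt_or_eq with h | h
  · exact Or.inr (by rwa [hlarge, ← hlen])
  · left
    have hx' : ∀ a ∈ x, g r < a := by
      simpa using List.length_filter_eq_length_iff.1 h
    rw [← toPacked_val_self p, hxy, toPacked_eq_toPacked_iff]
    refine pack_append_congr_of_gt hx (by simpa [toPacked_val] using hy) ?_ ?_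
    · intro a ha b hb
      rcases List.mem_append.1 hb with hb | hb
      · obtain ⟨d, hd, rfl⟩ := List.mem_map.1 hb
        exact (hwg d hd).trans_lt (hx' a ha)
      · rw [List.mem_singleton.1 hb]
        exact hx' a ha
    · intro a ha b hb
      rcases List.mem_append.1 hb with hb | hb
      · exact (hw b hb).trans_lt (hv a ha)
      · rw [List.mem_singleton.1 hb]
        exact hv a ha

/-- Outer induction on the length, inner induction on the number of letters that exceed the last
one. Modulo the ideal, `w` may be replaced by `U · L · r`. The product `M_U ≺ M_{L r}` is covered by
the outer induction, and besides the wanted term it contains only words with fewer large letters,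
covered by the inner one. -/
theorem MPlus_mem_sup {w : List ℕ} (hw : w ≠ []) :
    MPlus K (toPacked w) ∈ nfSpan K {w.length} ⊔ plusIdeal K := by
  induction hn : w.length using Nat.strong_induction_on generalizing w with
  | _ n ih =>
    induction hj : (largePart w).length using Nat.strong_induction_on generalizing w with
    | _ j ihj =>
      subst hj
      obtain ⟨v, r, rfl⟩ := List.eq_nil_or_concat w |>.resolve_left hw
      rw [List.concat_eq_append] at hn ihj
      rw [List.concat_eq_append]
      have hS := length_smallPart_lt (w := v ++ [r]) (by simp)
      have hL := length_largePart_lt (w := v ++ [r]) (by simp)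
      rw [smallPart_concat, hn] at hS
      rw [largePart_concat, hn] at hL
      rw [largePart_concat] at ihj
      have hsum := (SylvesterCongr.sort_by_last v r).perm.length_eq
      set L := v.filter (fun a => a ≤ r) with hLdef
      set U := v.filter (fun a => r < a) with hUdef
      have hLr : ∀ a ∈ L, a ≤ r := by simp [hLdef]
      have hUr : ∀ a ∈ U, r < a := by simp [hUdef]
      have hcongr := MPlus_sub_mem_plusIdeal K (SylvesterCongr.sort_by_last v r)
      rw [← hLdef, ← hUdef, List.append_assoc] at hcongr
      rw [List.append_assoc, hn, List.length_append, List.length_append, List.length_singleton]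
        at hsum
      have hP := MPlus_concat_mem K hLr fun h => ih _ hS h rfl
      rw [← sub_add_cancel (MPlus K (toPacked (v ++ [r]))) (MPlus K (toPacked (U ++ (L ++ [r]))))]
      refine add_mem (Submodule.mem_sup_right hcongr) ?_
      by_cases hU : U = []
      · rw [hU, List.nil_append]
        rw [hU, List.length_nil, zero_add] at hsum
        rw [hsum]
        exact sup_le_sup_right (nfMaxSpan_le_nfSpan K _) _ hP
      · have hprod := prodGT_mem_sup K (ih _ hL hU rfl) hP
        have hmax : maxLetter (L ++ [r]) < maxLetter U := by
          refine lt_of_le_of_lt (maxLetter_le_iff.2 fun a ha => ?_) (hUr _ (maxLetter_mem hU))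
          rcases List.mem_append.1 ha with ha | ha
          · exact hLr a ha
          · exact (List.mem_singleton.1 ha).le
        rw [← hsum, partialProd_MPlus K _ (by rwa [toPacked_val, Ne, pack_eq_nil])
          (by rw [toPacked_val, Ne, pack_eq_nil]; simp), ← Finset.add_sum_erase _ _
          (toPacked_append_mem_convolution isOrderCond_gt hU (by simp) hmax)] at hprod
        -- The product lies in the submodule, and so does each of its other terms; hence the leading
        -- term does too.
        refine (Submodule.add_mem_iff_left (R := K) (M := plus K) _
          (Submodule.sum_mem (R := K) (M := plus K) _ fun p hp => ?_)).1 hprod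
        obtain ⟨hne, hp⟩ := Finset.mem_erase.1 hp
        have hlt := (eq_or_length_largePart_lt hUr hLr hp).resolve_left hne
        rw [← toPacked_val_self p]
        refine ihj _ hlt (ne_nil_of_mem_convolution (by rwa [toPacked_val, Ne, pack_eq_nil]) hp) ?_ rfl
        rw [(mem_convolution.1 hp).1, toPacked_val, toPacked_val, length_pack, length_pack, hsum,
          List.length_append, List.length_singleton]

end WQSym

/-! ### The isomorphism between `TD` and the sylvester quotient -/

namespace WQSym

variable (K : Type u) [Field K]

/-- The linear map that takes `M_u` to the normal form of `u`. -/
def nfMap : WQSym K →ₗ[K] plus K := lift K fun u => nf K u.1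

theorem nfMap_eq_zero {x : WQSym K} (hx : x ∈ sylvesterIdeal K) : nfMap K x = 0 :=
  Subtype.ext (eq_zero_of_mem_sylvesterIdeal ((plus K).subtype ∘ₗ nfMap K) (fun u v h => by
    rw [LinearMap.comp_apply, LinearMap.comp_apply, nfMap, lift_M, lift_M, nf_congr K h]) hx)

theorem nfMap_M_toPacked (w : List ℕ) : nfMap K (M K (toPacked w)) = nf K w := by
  rw [nfMap, lift_M, toPacked_val, nf_pack]

/-- The endomorphism of the sylvester quotient induced by `nfMap`. -/
def nfEnd : SylvesterQuotient K →ₗ[K] SylvesterQuotient K :=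
  (sylvesterIdeal K).liftQ ((sylvesterIdeal K).mkQ ∘ₗ (plus K).subtype ∘ₗ nfMap K) fun x hx => by
    rw [LinearMap.mem_ker, LinearMap.comp_apply, LinearMap.comp_apply, nfMap_eq_zero K hx, map_zero,
      map_zero]

theorem nfEnd_mkQ (x : WQSym K) :
    nfEnd K ((sylvesterIdeal K).mkQ x) = (sylvesterIdeal K).mkQ (nfMap K x : WQSym K) := rfl

/-- The span of the classes of the `M_u` with `u` nonempty of length at most `n`. -/
def quotientFiltration (n : ℕ) : Submodule K (SylvesterQuotient K) :=
  Submodule.span K ((fun u => (sylvesterIdeal K).mkQ (M K u)) '' {u | u.1 ≠ [] ∧ u.1.length ≤ n})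

theorem finite_quotientFiltration (n : ℕ) : Module.Finite K (quotientFiltration K n) := by
  refine Module.Finite.span_of_finite K (Set.Finite.image _ (Set.Finite.subset
    ((Finset.range (n + 1)).biUnion packedWords).finite_toSet fun u hu => ?_))
  rw [Finset.mem_coe, Finset.mem_biUnion]
  exact ⟨u.1.length, Finset.mem_range.2 (Nat.lt_succ_of_le hu.2), (mem_packedWords _ _).2 rfl⟩

theorem exists_nf_mkQ_M_eq {u : PackedWord} (hu : u.1 ≠ []) : ∃ t ∈ nfSpan K {u.1.length},
    (sylvesterIdeal K).mkQ (M K u) = (sylvesterIdeal K).mkQ (t : WQSym K) := by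
  obtain ⟨t, ht, i, hi, h⟩ := Submodule.mem_sup.1 (MPlus_mem_sup K hu)
  refine ⟨t, ht, ?_⟩
  rw [toPacked_val_self] at h
  have h' := congrArg (fun x : plus K => (sylvesterIdeal K).mkQ (x : WQSym K)) h
  simp only [Submodule.coe_add, map_add] at h'
  have hi' : (sylvesterIdeal K).mkQ (i : WQSym K) = 0 := (Submodule.Quotient.mk_eq_zero _).2 hi
  rw [← coe_proj_M K hu, ← MPlus, ← h', hi', add_zero]

/-- The class of `M_u` is a combination of classes of normal forms of words of the same length, and
the class of `nf w` is the image under `nfEnd` of the class of `M_w`. -/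
theorem quotientFiltration_le_map (n : ℕ) :
    quotientFiltration K n ≤ (quotientFiltration K n).map (nfEnd K) := by
  refine Submodule.span_le.2 ?_
  rintro _ ⟨u, ⟨hu, hn⟩, rfl⟩
  obtain ⟨t, ht, h⟩ := exists_nf_mkQ_M_eq K hu
  simp only [h]
  have key : nfSpan K {u.1.length} ≤ ((quotientFiltration K n).map (nfEnd K)).comap
      ((sylvesterIdeal K).mkQ ∘ₗ (plus K).subtype) := by
    refine Submodule.span_le.2 ?_
    rintro _ ⟨w, ⟨hw, hwn⟩, rfl⟩
    rw [Set.mem_singleton_iff] at hwn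
    refine ⟨(sylvesterIdeal K).mkQ (M K (toPacked w)), Submodule.subset_span
      ⟨toPacked w, ⟨by rwa [toPacked_val, Ne, pack_eq_nil], ?_⟩, rfl⟩, ?_⟩
    · rwa [toPacked_val, length_pack, hwn]
    · rw [nfEnd_mkQ, nfMap_M_toPacked]
      rfl
  exact key ht

/-- The image of the filtration step has at least the dimension of the step, so by rank and nullity
there is no kernel. That `nfEnd` preserves the step is not needed. -/
theorem eq_zero_of_nfEnd_eq_zero {n : ℕ} {x : SylvesterQuotient K}
    (hx : x ∈ quotientFiltration K n) (h : nfEnd K x = 0) : x = 0 := by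
  have := finite_quotientFiltration K n
  have hrank := LinearMap.finrank_range_add_finrank_ker ((nfEnd K).domRestrict (quotientFiltration K n))
  rw [LinearMap.range_domRestrict] at hrank
  have hle := Submodule.finrank_mono (quotientFiltration_le_map K n)
  have hker : LinearMap.ker ((nfEnd K).domRestrict (quotientFiltration K n)) = ⊥ :=
    Submodule.finrank_eq_zero.1 (by omega)
  have hmem : (⟨x, hx⟩ : quotientFiltration K n) ∈
      LinearMap.ker ((nfEnd K).domRestrict (quotientFiltration K n)) := h
  rw [hker, Submodule.mem_bot] at hmem
  exact congrArg Subtype.val hmem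

theorem exists_mkQ_mem_quotientFiltration {x : WQSym K} (hx : x ∈ plus K) :
    ∃ n, (sylvesterIdeal K).mkQ x ∈ quotientFiltration K n := by
  refine ⟨x.support.sup fun u => u.1.length, ?_⟩
  rw [eq_sum_M K x, map_sum]
  refine Submodule.sum_mem _ fun u hu => ?_
  rw [← eq_sum_M K x, map_smul]
  refine Submodule.smul_mem _ _ (Submodule.subset_span ⟨u, ⟨fun h => ?_, ?_⟩, rfl⟩)
  · rw [LinearMap.mem_ker, counit_apply] at hx
    rw [Finsupp.mem_support_iff, show u = toPacked [] from Subtype.ext h] at hu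
    exact hu hx
  · exact Finset.le_sup (f := fun u : PackedWord => u.1.length) hu

/-- Write `x` as the normal-form image of some `y`. That `x` vanishes in the quotient says that
`nfEnd` kills the class of `y`, so this class is zero; and `nfMap` vanishes on the ideal. -/
theorem eq_zero_of_mem_TDPlus {x : plus K} (hx : x ∈ TDPlus K)
    (h : (x : WQSym K) ∈ sylvesterIdeal K) : x = 0 := by
  have hle : nfSpan K Set.univ ≤ (plus K).map (nfMap K) := by
    refine Submodule.span_le.2 ?_
    rintro _ ⟨w, ⟨hw, -⟩, rfl⟩
    exact ⟨M K (toPacked w), M_mem_plus K (by rwa [toPacked_val, Ne, pack_eq_nil]),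
      nfMap_M_toPacked K w⟩
  obtain ⟨y, hy, rfl⟩ := hle (TDPlus_le_nfSpan K hx)
  obtain ⟨n, hn⟩ := exists_mkQ_mem_quotientFiltration K hy
  have h0 : nfEnd K ((sylvesterIdeal K).mkQ y) = 0 := by
    rw [nfEnd_mkQ]
    exact (Submodule.Quotient.mk_eq_zero _).2 h
  exact nfMap_eq_zero K ((Submodule.Quotient.mk_eq_zero _).1 (eq_zero_of_nfEnd_eq_zero K hn h0))

theorem bijective_mkQ_comp_subtype :
    Function.Bijective ((sylvesterIdeal K).mkQ ∘ₗ (TD K).subtype) := by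
  constructor
  · refine (injective_iff_map_eq_zero _).2 fun x hx => ?_
    have hmem : (x : WQSym K) ∈ sylvesterIdeal K := (Submodule.Quotient.mk_eq_zero _).1 hx
    have hplus := sylvesterIdeal_le_plus K hmem
    have h := eq_zero_of_mem_TDPlus K (x := ⟨x, hplus⟩) ((coe_mem_TD_iff K).1 x.2) hmem
    exact Subtype.ext (congrArg (fun y : plus K => (y : WQSym K)) h)
  · rw [← LinearMap.range_eq_top, eq_top_iff, ← (sylvesterIdeal K).range_mkQ]
    rintro _ ⟨x, rfl⟩
    rw [eq_sum_M K x, map_sum]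
    refine Submodule.sum_mem _ fun u _ => ?_
    rw [map_smul]
    refine Submodule.smul_mem _ _ ?_
    by_cases hu : u.1 = []
    · rw [show u = toPacked [] from Subtype.ext hu]
      exact ⟨⟨M K (toPacked []), one_mem_TD K⟩, rfl⟩
    · obtain ⟨t, ht, h⟩ := exists_nf_mkQ_M_eq K hu
      have hle : nfSpan K {u.1.length} ≤ TDPlus K := by
        refine Submodule.span_le.2 ?_
        rintro _ ⟨w, -, rfl⟩
        exact nf_mem_TDPlus K w
      rw [h]
      exact ⟨⟨t, (coe_mem_TD_iff K).2 (hle ht)⟩, rfl⟩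

end WQSym

end

theorem mainTheorem4 (K : Type*) [Field K] [CharZero K] :
    ∃ (S : TriOps K (SylvesterQuotient K)) (T : TriOps K (TD K)),
      (TriOps.IsHom (WQSym.ops K) S (sylvesterIdeal K).mkQ ∧
        S.IsTridendriform ∧ S.IsBidendriform ∧ S.IsHopf) ∧
      (TriOps.IsHom T (WQSym.ops K) (TD K).subtype ∧
        T.IsTridendriform ∧ T.IsBidendriform ∧ T.IsHopf) ∧
      ∃ e : SylvesterQuotient K ≃ₗ[K] TD K, TriOps.IsHom S T e.toLinearMap := by
  obtain ⟨S, hS⟩ := WQSym.exists_sylvesterQuotient_ops K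
  obtain ⟨T, hT⟩ := WQSym.exists_TD_ops K
  have hsurj : Function.Surjective (sylvesterIdeal K).mkQ := Submodule.mkQ_surjective _
  have hS1 := hS.isTridendriform hsurj (WQSym.isTridendriform K)
  have hS2 := hS.isBidendriform hsurj (WQSym.isBidendriform K)
  have hS3 := WQSym.isHopf_of_isHom_mkQ hS
  let φ : TD K ≃ₗ[K] SylvesterQuotient K :=
    LinearEquiv.ofBijective _ (WQSym.bijective_mkQ_comp_subtype K)
  -- The isomorphism is inclusion followed by projection, so compatibility with all operations is
  -- automatic. Its inverse then carries the laws and the antipode from the quotient to TD.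
  have hφ : TriOps.IsHom T S φ.toLinearMap := hS.comp hT
  have he := hφ.symm
  exact ⟨S, T, ⟨hS, hS1, hS2, hS3⟩, ⟨hT, he.isTridendriform φ.symm.surjective hS1,
    he.isBidendriform φ.symm.surjective hS2, he.isHopf hS3⟩, φ.symm, he⟩
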